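/- **Theorem (Soundness for homotopy semantics).** Let $(\mathcal L,h)$ be an essentially finite $h$-signature (for instance one underlying a $\mathrm{FOL}_{\cong}$-signature, i.e. one that contains all the logical sorts allowed by $h$), let $\mathbb T$ be a set of $\mathcal L$-sequents and $\sigma$ an $\mathcal L$-sequent. If $\sigma$ is derivable from $\mathbb T$ in the deductive system $\mathcal D_{\cong}$ (resp. $\mathcal D_{\cong}$ with the law of excluded middle), then every homotopy $\mathcal L$-structure in HoTT (resp. HoTT + LEM) that satisfies all sequents of $\mathbb T$ satisfies $\sigma$. Here the notions are as follows. *Signatures.* An inverse category is a skeletal category without non-identity endomorphisms in which every object is the domain of finitely many arrows; $K/\!/\mathcal L$ is the set of non-identity arrows with domain $K$, and an arrow in it is top-level if it is not a composite of two non-identity arrows. An $h$-signature is an inverse category $\mathcal L$ with a proper order (a strict order on objects with $K_f<K$ for each non-identity $f\colon K\to K_f$, and compatible enumerations of each $K/\!/\mathcal L$ and of the non-logical objects) and a function $h\colon\mathrm{ob}\,\mathcal L\to\mathbb N\cup\{\infty\}$. Each object ("sort") is either non-logical, in which case $h\neq 0$, or is one of the following logical sorts, each occurring at most once (with $\infty-m=\infty$):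 - $\cong_K$, where $h(K)\ge 2$, with exactly two top-level arrows $s,t\colon{\cong_K}\to K$, $gs=gt$ for all $g\in K/\!/\mathcal L$, and $h(\cong_K)=h(K)-1$; - $\rho_K$, where $h(K)\ge 2$, with exactly one top-level arrow $r\colon\rho_K\to{\cong_K}$, $sr=tr$, and $h(\rho_K)=h(K)-2$; - $\tau_f$, where $f\colon A\to K$ is top-level and $\cong_K\in\mathcal L$, with exactly three top-level arrows $e\colon\tau_f\to{\cong_K}$ and $f_1,f_2\colon\tau_f\to A$, $se=ff_1$, $te=ff_2$, $gf_1=gf_2$ for all $g\in A/\!/\mathcal L\setminus\{f\}$, and $h(\tau_f)=h(A)-1$. It is essentially finite if it has finitely many non-logical sorts. *Syntax.* Sort expressions are $A(x_f)_{f\in A/\!/\mathcal L}$ with variables $x_f$; contexts are lists of variable declarations; $A(x_f)_f$ is well-formed in $\Gamma$ if each $x_f\colon K_f(x_{pf})_{p\in K_f/\!/\mathcal L}$ is declared in $\Gamma$. Formulas are built from $\top,\bot,\wedge,\vee,\to$ and $\forall x{:}K,\exists x{:}K$; a sort expression $K$ is also used as the formula $\exists x{:}K.\top$. A sequent $\Gamma\mid\phi\Rightarrow\psi$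 consists of a well-formed context and two formulas well-formed in it. *Deductive system.* All sequents are well-formed. The rules of $\mathcal D_{\cong}$ are: identity, cut, substitution along context morphisms, weakening and exchange of contexts; $\phi\Rightarrow\top$; $\bot\Rightarrow\phi$; $\exists x{:}K.\phi\Rightarrow\exists x{:}K.\top$; the two-way rules: $\theta\Rightarrow\phi\wedge\psi$ iff $\theta\Rightarrow\phi$ and $\theta\Rightarrow\psi$; $\phi\vee\psi\Rightarrow\theta$ iff $\phi\Rightarrow\theta$ and $\psi\Rightarrow\theta$; $\theta\Rightarrow(\phi\to\psi)$ iff $\theta\wedge\phi\Rightarrow\psi$; $\Gamma\mid\theta\Rightarrow\forall x{:}K.\phi$ iff $\Gamma,x{:}K\mid\theta\Rightarrow\phi$; $\Gamma\mid\exists x{:}K.\phi\Rightarrow\theta$ iff $\Gamma,x{:}K\mid\phi\Rightarrow\theta$; the Frobenius and distributivity axioms; and - $(\rho)$: $\Gamma,x{:}K\mid\theta\Rightarrow\exists q{:}x\cong x.\,\rho(q)$; - $(\tau\rho)$: $\Gamma,x{:}K,\alpha{:}A,q{:}x\cong x\mid\rho(q)\wedge\theta\Rightarrow\tau_f(q,\alpha,\alpha)$;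 - (J): from $\Gamma,x{:}K,q{:}x\cong x\mid\rho(q)\wedge\theta[x,x,q]\Rightarrow\phi[x,x,q]$ infer $\Gamma,x{:}K,y{:}K,p{:}x\cong y\mid\theta\Rightarrow\phi$. LEM is the axiom $\Gamma\mid\top\Rightarrow\phi\vee(\phi\to\bot)$. *Semantics.* HoTT is the formal system of intensional Martin-Löf type theory with $\Pi,\Sigma,\mathrm{Id},\mathbf 1,\mathbf 0,+$, propositional truncation $\|\cdot\|$, function extensionality and a univalent universe $\mathcal U$ (with decoding $\mathrm{El}$) closed under these; HoTT + LEM adds an inhabitant of $\prod_{X:\mathcal U}\mathrm{isProp}(\mathrm{El}\,X)\to \mathrm{El}\,X+(\mathrm{El}\,X\to\mathbf 0)$. With $\mathcal U_m$ the type of types in $\mathcal U$ of $h$-level $m$ (and $\mathcal U_\infty=\mathcal U$), a homotopy $\mathcal L$-structure $\mathcal M$ is a derivable term (in some context, possibly empty) of the iterated $\Sigma$-type of the types $T_K=\prod_{f\in K/\!/\mathcal L}(x_f:[\![K_f(x_{pf})_p]\!])\,.\,\mathcal U_{h(K)}$, $K$ running over the non-logical sorts in order; if $K/\!/\mathcal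 L=\varnothing$ then $T_K=\mathbf 1\to\mathcal U_{h(K)}$. Sorts are interpreted by - $[\![K(\mathbf x)]\!]=\mathrm{El}(K^{\mathcal M}(\mathbf x))$ for $K$ non-logical, - $[\![{\cong_K}(\mathbf x)]\!]=\mathrm{Id}_{[\![K(x_{ps})_p]\!]}(x_s,x_t)$, - $[\![\rho_K(\mathbf x)]\!]=\mathrm{Id}(x_r,\mathrm{refl}_{x_{sr}})$, - $[\![\tau_f(\mathbf x)]\!]=\mathrm{Id}_{[\![A(x_{pf_2})_p]\!]}\big(x_{f_2},\mathrm{trans}^{P}_{x_e}(x_{f_1})\big)$, where $P(w)$ is $[\![A(x_{pf_1})_p]\!]$ with $w$ put in position $f$; and formulas by $\top\mapsto\mathbf 1$, $\bot\mapsto\mathbf 0$, $\wedge\mapsto\times$, $\to\;\mapsto\;\to$, $\forall\mapsto\Pi$, $\phi\vee\psi\mapsto\|[\![\phi]\!]+[\![\psi]\!]\|$, $\exists x{:}K.\phi\mapsto\|\Sigma_{x:[\![K]\!]}[\![\phi]\!]\|$. The structure $\mathcal M$ satisfies $\Gamma\mid\phi\Rightarrow\psi$ if a term of $\prod_{[\![\Gamma]\!]}[\![\phi]\!]\to[\![\psi]\!]$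 is derivable (in the context of $\mathcal M$). -/

import Mathlib

open CategoryTheory

/-! ## Homotopy type theory as a formal system

Raw expressions use de Bruijn indices: `var 0` is the variable bound last. -/

namespace HoTT

/-- Raw types and terms. The number of variables bound in an argument is given in the comments;
arguments without a comment bind none. -/
inductive Expr : Type
  | var (i : ℕ)
  -- types; `B` binds one variable
  | U
  | El (a : Expr)
  | Pi (A B : Expr)
  | Sg (A B : Expr)
  | Id (A a b : Expr)
  | One
  | Zero
  | Sum (A B : Expr)
  | Tr (A : Expr)
  -- codes in the universe; in `cPi` and `cSg` the argument `b` binds one variable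
  | cPi (a b : Expr)
  | cSg (a b : Expr)
  | cId (a x y : Expr)
  | cOne
  | cZero
  | cSum (a b : Expr)
  | cTr (a : Expr)
  -- functions; `b` binds one variable
  | lam (A b : Expr)
  | app (f a : Expr)
  -- pairs; `C` binds one variable, `d` two
  | pair (a b : Expr)
  | indSg (C d p : Expr)
  -- unit, empty and sum types; `C`, `l` and `r` bind one variable
  | star
  | indOne (C c t : Expr)
  | indZero (C t : Expr)
  | inl (a : Expr)
  | inr (b : Expr)
  | indSum (C l r t : Expr)
  -- identity types, with based path induction; `C` binds two variables
  | refl (a : Expr)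
  | indId (a C d b p : Expr)
  -- propositional truncation: the point `|a|`, the path between two points, the recursor
  | tr (a : Expr)
  | squash (x y : Expr)
  | trRec (B h f t : Expr)
  -- axioms; in `funext` the argument `B` binds one variable
  | funext (A B f g : Expr)
  | ua (X Y : Expr)
  | lem

namespace Expr

def liftR (r : ℕ → ℕ) : ℕ → ℕ
  | 0 => 0
  | n + 1 => r n + 1

def rename (r : ℕ → ℕ) : Expr → Expr
  | var i => var (r i)
  | U => U
  | El a => El (a.rename r)
  | Pi A B => Pi (A.rename r) (B.rename (liftR r))
  | Sg A B => Sg (A.rename r) (B.rename (liftR r))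
  | Id A a b => Id (A.rename r) (a.rename r) (b.rename r)
  | One => One
  | Zero => Zero
  | Sum A B => Sum (A.rename r) (B.rename r)
  | Tr A => Tr (A.rename r)
  | cPi a b => cPi (a.rename r) (b.rename (liftR r))
  | cSg a b => cSg (a.rename r) (b.rename (liftR r))
  | cId a x y => cId (a.rename r) (x.rename r) (y.rename r)
  | cOne => cOne
  | cZero => cZero
  | cSum a b => cSum (a.rename r) (b.rename r)
  | cTr a => cTr (a.rename r)
  | lam A b => lam (A.rename r) (b.rename (liftR r))
  | app f a => app (f.rename r) (a.rename r)
  | pair a b => pair (a.rename r) (b.rename r)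
  | indSg C d p => indSg (C.rename (liftR r)) (d.rename (liftR (liftR r))) (p.rename r)
  | star => star
  | indOne C c t => indOne (C.rename (liftR r)) (c.rename r) (t.rename r)
  | indZero C t => indZero (C.rename (liftR r)) (t.rename r)
  | inl a => inl (a.rename r)
  | inr b => inr (b.rename r)
  | indSum C l s t =>
      indSum (C.rename (liftR r)) (l.rename (liftR r)) (s.rename (liftR r)) (t.rename r)
  | refl a => refl (a.rename r)
  | indId a C d b p =>
      indId (a.rename r) (C.rename (liftR (liftR r))) (d.rename r) (b.rename r) (p.rename r)
  | tr a => tr (a.rename r)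
  | squash x y => squash (x.rename r) (y.rename r)
  | trRec B h f t => trRec (B.rename r) (h.rename r) (f.rename r) (t.rename r)
  | funext A B f g => funext (A.rename r) (B.rename (liftR r)) (f.rename r) (g.rename r)
  | ua X Y => ua (X.rename r) (Y.rename r)
  | lem => lem

/-- Weakening by `n` variables. -/
def wkN (n : ℕ) (e : Expr) : Expr := e.rename (· + n)

/-- Weakening by one variable. -/
def wk (e : Expr) : Expr := e.rename Nat.succ

def liftS (s : ℕ → Expr) : ℕ → Expr
  | 0 => var 0
  | n + 1 => (s n).wk

/-- Simultaneous substitution. -/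
def subst (s : ℕ → Expr) : Expr → Expr
  | var i => s i
  | U => U
  | El a => El (a.subst s)
  | Pi A B => Pi (A.subst s) (B.subst (liftS s))
  | Sg A B => Sg (A.subst s) (B.subst (liftS s))
  | Id A a b => Id (A.subst s) (a.subst s) (b.subst s)
  | One => One
  | Zero => Zero
  | Sum A B => Sum (A.subst s) (B.subst s)
  | Tr A => Tr (A.subst s)
  | cPi a b => cPi (a.subst s) (b.subst (liftS s))
  | cSg a b => cSg (a.subst s) (b.subst (liftS s))
  | cId a x y => cId (a.subst s) (x.subst s) (y.subst s)
  | cOne => cOne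
  | cZero => cZero
  | cSum a b => cSum (a.subst s) (b.subst s)
  | cTr a => cTr (a.subst s)
  | lam A b => lam (A.subst s) (b.subst (liftS s))
  | app f a => app (f.subst s) (a.subst s)
  | pair a b => pair (a.subst s) (b.subst s)
  | indSg C d p => indSg (C.subst (liftS s)) (d.subst (liftS (liftS s))) (p.subst s)
  | star => star
  | indOne C c t => indOne (C.subst (liftS s)) (c.subst s) (t.subst s)
  | indZero C t => indZero (C.subst (liftS s)) (t.subst s)
  | inl a => inl (a.subst s)
  | inr b => inr (b.subst s)
  | indSum C l r t =>
      indSum (C.subst (liftS s)) (l.subst (liftS s)) (r.subst (liftS s)) (t.subst s)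
  | refl a => refl (a.subst s)
  | indId a C d b p =>
      indId (a.subst s) (C.subst (liftS (liftS s))) (d.subst s) (b.subst s) (p.subst s)
  | tr a => tr (a.subst s)
  | squash x y => squash (x.subst s) (y.subst s)
  | trRec B h f t => trRec (B.subst s) (h.subst s) (f.subst s) (t.subst s)
  | funext A B f g => funext (A.subst s) (B.subst (liftS s)) (f.subst s) (g.subst s)
  | ua X Y => ua (X.subst s) (Y.subst s)
  | lem => lem

/-- For `B` over `Γ, x` and `t` over `Γ` extended by `k` variables: `B[t/x]` over the latter. -/
def plug (k : ℕ) (B t : Expr) : Expr :=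
  B.subst fun
    | 0 => t
    | n + 1 => var (n + k)

/-- `B[a/x]` for `B` over `Γ, x`. -/
def inst (B a : Expr) : Expr := B.plug 0 a

/-- `C[a/x, b/y]` for `C` over `Γ, x, y`. -/
def inst2 (C a b : Expr) : Expr :=
  C.subst fun
    | 0 => b
    | 1 => a
    | n + 2 => var n

def arrow (A B : Expr) : Expr := Pi A B.wk

def prod (A B : Expr) : Expr := Sg A B.wk

/-- First projection from `Sg A B`. -/
def fst (A p : Expr) : Expr := indSg A.wk (var 1) p

/-- Second projection from `Sg A B`. -/
def snd (A B p : Expr) : Expr := indSg (B.plug 1 (fst A.wk (var 0))) (var 0) p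

/-- `trans_p^{x.P}(t)` for `p : Id A a b` and `t : P[a/x]`. -/
def trans (P a b p t : Expr) : Expr := indId a P.wk t b p

/-- `Σ (x : A), Π (y : A), x = y`. -/
def isContr (A : Expr) : Expr := Sg A (Pi A.wk (Id A.wk.wk (var 1) (var 0)))

/-- `Π (x y : A), x = y`. -/
def isProp (A : Expr) : Expr := Pi A (Pi A.wk (Id A.wk.wk (var 1) (var 0)))

def isOfHLevel : ℕ → Expr → Expr
  | 0, A => isContr A
  | n + 1, A => Pi A (Pi A.wk (isOfHLevel n (Id A.wk.wk (var 1) (var 0))))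

/-- `(Σ (g : B → A), Π (y : B), f (g y) = y) × (Σ (g : B → A), Π (x : A), g (f x) = x)`. -/
def isEquiv (A B f : Expr) : Expr :=
  prod
    (Sg (arrow B A) (Pi B.wk (Id B.wk.wk (app f.wk.wk (app (var 1) (var 0))) (var 0))))
    (Sg (arrow B A) (Pi A.wk (Id A.wk.wk (app (var 1) (app f.wk.wk (var 0))) (var 0))))

def equiv (A B : Expr) : Expr := Sg (arrow A B) (isEquiv A.wk B.wk (var 0))

/-- The identity equivalence, of type `equiv A A`. -/
def idEquiv (A : Expr) : Expr :=
  pair (lam A (var 0))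
    (pair (pair (lam A (var 0)) (lam A (refl (var 0))))
      (pair (lam A (var 0)) (lam A (refl (var 0)))))

/-- The canonical map `Id U X Y → (El X ≃ El Y)`. -/
def idToEquiv (X Y : Expr) : Expr :=
  lam (Id U X Y)
    (indId X.wk (equiv (El X.wk.wk.wk) (El (var 1))) (idEquiv (El X.wk)) Y.wk (var 0))

/-- Univalence for `X Y : U`: the canonical map is an equivalence. -/
def uaTy (X Y : Expr) : Expr :=
  isEquiv (Id U X Y) (equiv (El X) (El Y)) (idToEquiv X Y)

/-- The canonical map `f = g → Π (x : A), f x = g x` for `f g : Pi A B`. -/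
def happly (A B f g : Expr) : Expr :=
  lam (Id (Pi A B) f g)
    (indId f.wk
      (Pi A.wk.wk.wk
        (Id (B.rename (liftR (· + 3))) (app f.wk.wk.wk.wk (var 0)) (app (var 2) (var 0))))
      (lam A.wk (refl (app f.wk.wk (var 0)))) g.wk (var 0))

/-- Function extensionality for `f g : Pi A B`: the canonical map is an equivalence. -/
def funextTy (A B f g : Expr) : Expr :=
  isEquiv (Id (Pi A B) f g) (Pi A (Id B (app f.wk (var 0)) (app g.wk (var 0))))
    (happly A B f g)

/-- The law of excluded middle: `Π (X : U), isProp X → X + (X → 0)`. -/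
def lemTy : Expr :=
  Pi U (Pi (isProp (El (var 0))) (Sum (El (var 1)) (arrow (El (var 1)) Zero)))

end Expr

open HoTT.Expr

/-- The right-hand sides of judgments: well-formed context, type, term, equal types,
equal terms. -/
inductive Jdg : Type
  | ok
  | ty (A : Expr)
  | tm (a A : Expr)
  | tyEq (A B : Expr)
  | tmEq (a b A : Expr)

def Jdg.subst (s : ℕ → Expr) : Jdg → Jdg
  | ok => ok
  | ty A => ty (A.subst s)
  | tm a A => tm (a.subst s) (A.subst s)
  | tyEq A B => tyEq (A.subst s) (B.subst s)
  | tmEq a b A => tmEq (a.subst s) (b.subst s) (A.subst s)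

open HoTT.Jdg

/-- `Der cl Γ J`: the judgment `Γ ⊢ J` is derivable in HoTT (`cl = false`) or in HoTT with the
law of excluded middle (`cl = true`). The head of the list `Γ` is the type of `var 0`.
The type theory is intensional Martin-Löf type theory with `Π` (with `η`), `Σ`, `Id`, `1`, `0`,
`+`, propositional truncation, function extensionality and a univalent universe à la Tarski that
is closed under these type formers. -/
inductive Der (cl : Bool) : List Expr → Jdg → Prop
  -- contexts, variables, substitution along context morphisms (which includes weakening)
  | ctxNil : Der cl [] ok
  | ctxCons {Γ A} : Der cl Γ (ty A) → Der cl (A :: Γ) ok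
  | var {Γ i A} : Der cl Γ ok → Γ[i]? = some A → Der cl Γ (tm (.var i) (A.wkN (i + 1)))
  | subst {Γ Δ J s} : Der cl Δ ok →
      (∀ i A, Γ[i]? = some A → Der cl Δ (tm (s i) ((A.wkN (i + 1)).subst s))) →
      Der cl Γ J → Der cl Δ (J.subst s)
  | substTyEq {Γ Δ A s s'} : Der cl Δ ok →
      (∀ i A, Γ[i]? = some A → Der cl Δ (tm (s i) ((A.wkN (i + 1)).subst s))) →
      (∀ i A, Γ[i]? = some A → Der cl Δ (tm (s' i) ((A.wkN (i + 1)).subst s'))) →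
      (∀ i A, Γ[i]? = some A → Der cl Δ (tmEq (s i) (s' i) ((A.wkN (i + 1)).subst s))) →
      Der cl Γ (ty A) → Der cl Δ (tyEq (A.subst s) (A.subst s'))
  | substTmEq {Γ Δ a A s s'} : Der cl Δ ok →
      (∀ i A, Γ[i]? = some A → Der cl Δ (tm (s i) ((A.wkN (i + 1)).subst s))) →
      (∀ i A, Γ[i]? = some A → Der cl Δ (tm (s' i) ((A.wkN (i + 1)).subst s'))) →
      (∀ i A, Γ[i]? = some A → Der cl Δ (tmEq (s i) (s' i) ((A.wkN (i + 1)).subst s))) →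
      Der cl Γ (tm a A) → Der cl Δ (tmEq (a.subst s) (a.subst s') (A.subst s))
  -- judgmental equality
  | tyRefl {Γ A} : Der cl Γ (ty A) → Der cl Γ (tyEq A A)
  | tySymm {Γ A B} : Der cl Γ (tyEq A B) → Der cl Γ (tyEq B A)
  | tyTrans {Γ A B C} : Der cl Γ (tyEq A B) → Der cl Γ (tyEq B C) → Der cl Γ (tyEq A C)
  | tmRefl {Γ a A} : Der cl Γ (tm a A) → Der cl Γ (tmEq a a A)
  | tmSymm {Γ a b A} : Der cl Γ (tmEq a b A) → Der cl Γ (tmEq b a A)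
  | tmTrans {Γ a b c A} :
      Der cl Γ (tmEq a b A) → Der cl Γ (tmEq b c A) → Der cl Γ (tmEq a c A)
  | conv {Γ a A B} : Der cl Γ (tm a A) → Der cl Γ (tyEq A B) → Der cl Γ (tm a B)
  | convEq {Γ a b A B} :
      Der cl Γ (tmEq a b A) → Der cl Γ (tyEq A B) → Der cl Γ (tmEq a b B)
  -- type formation, with congruence
  | uForm {Γ} : Der cl Γ ok → Der cl Γ (ty U)
  | elForm {Γ a} : Der cl Γ (tm a U) → Der cl Γ (ty (El a))
  | elCong {Γ a a'} : Der cl Γ (tmEq a a' U) → Der cl Γ (tyEq (El a) (El a'))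
  | piForm {Γ A B} : Der cl Γ (ty A) → Der cl (A :: Γ) (ty B) → Der cl Γ (ty (Pi A B))
  | piCong {Γ A A' B B'} : Der cl Γ (tyEq A A') → Der cl (A :: Γ) (tyEq B B') →
      Der cl Γ (tyEq (Pi A B) (Pi A' B'))
  | sgForm {Γ A B} : Der cl Γ (ty A) → Der cl (A :: Γ) (ty B) → Der cl Γ (ty (Sg A B))
  | sgCong {Γ A A' B B'} : Der cl Γ (tyEq A A') → Der cl (A :: Γ) (tyEq B B') →
      Der cl Γ (tyEq (Sg A B) (Sg A' B'))
  | idForm {Γ A a b} : Der cl Γ (ty A) → Der cl Γ (tm a A) → Der cl Γ (tm b A) →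
      Der cl Γ (ty (Id A a b))
  | idCong {Γ A A' a a' b b'} : Der cl Γ (tyEq A A') → Der cl Γ (tmEq a a' A) →
      Der cl Γ (tmEq b b' A) → Der cl Γ (tyEq (Id A a b) (Id A' a' b'))
  | oneForm {Γ} : Der cl Γ ok → Der cl Γ (ty One)
  | zeroForm {Γ} : Der cl Γ ok → Der cl Γ (ty Zero)
  | sumForm {Γ A B} : Der cl Γ (ty A) → Der cl Γ (ty B) → Der cl Γ (ty (Sum A B))
  | sumCong {Γ A A' B B'} : Der cl Γ (tyEq A A') → Der cl Γ (tyEq B B') →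
      Der cl Γ (tyEq (Sum A B) (Sum A' B'))
  | trForm {Γ A} : Der cl Γ (ty A) → Der cl Γ (ty (Tr A))
  | trCong {Γ A A'} : Der cl Γ (tyEq A A') → Der cl Γ (tyEq (Tr A) (Tr A'))
  -- codes in the universe, with congruence and decoding
  | cPi {Γ a b} : Der cl Γ (tm a U) → Der cl (El a :: Γ) (tm b U) → Der cl Γ (tm (cPi a b) U)
  | cPiCong {Γ a a' b b'} : Der cl Γ (tmEq a a' U) → Der cl (El a :: Γ) (tmEq b b' U) →
      Der cl Γ (tmEq (.cPi a b) (.cPi a' b') U)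
  | elPi {Γ a b} : Der cl Γ (tm a U) → Der cl (El a :: Γ) (tm b U) →
      Der cl Γ (tyEq (El (.cPi a b)) (Pi (El a) (El b)))
  | cSg {Γ a b} : Der cl Γ (tm a U) → Der cl (El a :: Γ) (tm b U) → Der cl Γ (tm (cSg a b) U)
  | cSgCong {Γ a a' b b'} : Der cl Γ (tmEq a a' U) → Der cl (El a :: Γ) (tmEq b b' U) →
      Der cl Γ (tmEq (.cSg a b) (.cSg a' b') U)
  | elSg {Γ a b} : Der cl Γ (tm a U) → Der cl (El a :: Γ) (tm b U) →
      Der cl Γ (tyEq (El (.cSg a b)) (Sg (El a) (El b)))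
  | cId {Γ a x y} : Der cl Γ (tm a U) → Der cl Γ (tm x (El a)) → Der cl Γ (tm y (El a)) →
      Der cl Γ (tm (cId a x y) U)
  | cIdCong {Γ a a' x x' y y'} : Der cl Γ (tmEq a a' U) → Der cl Γ (tmEq x x' (El a)) →
      Der cl Γ (tmEq y y' (El a)) → Der cl Γ (tmEq (.cId a x y) (.cId a' x' y') U)
  | elId {Γ a x y} : Der cl Γ (tm a U) → Der cl Γ (tm x (El a)) → Der cl Γ (tm y (El a)) →
      Der cl Γ (tyEq (El (.cId a x y)) (Id (El a) x y))
  | cOne {Γ} : Der cl Γ ok → Der cl Γ (tm cOne U)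
  | elOne {Γ} : Der cl Γ ok → Der cl Γ (tyEq (El .cOne) One)
  | cZero {Γ} : Der cl Γ ok → Der cl Γ (tm cZero U)
  | elZero {Γ} : Der cl Γ ok → Der cl Γ (tyEq (El .cZero) Zero)
  | cSum {Γ a b} : Der cl Γ (tm a U) → Der cl Γ (tm b U) → Der cl Γ (tm (cSum a b) U)
  | cSumCong {Γ a a' b b'} : Der cl Γ (tmEq a a' U) → Der cl Γ (tmEq b b' U) →
      Der cl Γ (tmEq (.cSum a b) (.cSum a' b') U)
  | elSum {Γ a b} : Der cl Γ (tm a U) → Der cl Γ (tm b U) →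
      Der cl Γ (tyEq (El (.cSum a b)) (Sum (El a) (El b)))
  | cTr {Γ a} : Der cl Γ (tm a U) → Der cl Γ (tm (cTr a) U)
  | cTrCong {Γ a a'} : Der cl Γ (tmEq a a' U) → Der cl Γ (tmEq (.cTr a) (.cTr a') U)
  | elTr {Γ a} : Der cl Γ (tm a U) → Der cl Γ (tyEq (El (.cTr a)) (Tr (El a)))
  -- dependent functions
  | lam {Γ A B b} : Der cl Γ (ty A) → Der cl (A :: Γ) (tm b B) → Der cl Γ (tm (lam A b) (Pi A B))
  | lamCong {Γ A A' B b b'} : Der cl Γ (tyEq A A') → Der cl (A :: Γ) (tmEq b b' B) →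
      Der cl Γ (tmEq (.lam A b) (.lam A' b') (Pi A B))
  | app {Γ A B f a} : Der cl (A :: Γ) (ty B) → Der cl Γ (tm f (Pi A B)) → Der cl Γ (tm a A) →
      Der cl Γ (tm (app f a) (B.inst a))
  | appCong {Γ A B f f' a a'} : Der cl (A :: Γ) (ty B) → Der cl Γ (tmEq f f' (Pi A B)) →
      Der cl Γ (tmEq a a' A) → Der cl Γ (tmEq (.app f a) (.app f' a') (B.inst a))
  | piBeta {Γ A B b a} : Der cl Γ (ty A) → Der cl (A :: Γ) (tm b B) → Der cl Γ (tm a A) →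
      Der cl Γ (tmEq (.app (.lam A b) a) (b.inst a) (B.inst a))
  | piEta {Γ A B f} : Der cl (A :: Γ) (ty B) → Der cl Γ (tm f (Pi A B)) →
      Der cl Γ (tmEq f (.lam A (.app f.wk (.var 0))) (Pi A B))
  -- dependent pairs
  | pair {Γ A B a b} : Der cl (A :: Γ) (ty B) → Der cl Γ (tm a A) → Der cl Γ (tm b (B.inst a)) →
      Der cl Γ (tm (pair a b) (Sg A B))
  | pairCong {Γ A B a a' b b'} : Der cl (A :: Γ) (ty B) → Der cl Γ (tmEq a a' A) →
      Der cl Γ (tmEq b b' (B.inst a)) → Der cl Γ (tmEq (.pair a b) (.pair a' b') (Sg A B))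
  | indSg {Γ A B C d p} : Der cl (Sg A B :: Γ) (ty C) →
      Der cl (B :: A :: Γ) (tm d (C.plug 2 (.pair (.var 1) (.var 0)))) →
      Der cl Γ (tm p (Sg A B)) → Der cl Γ (tm (indSg C d p) (C.inst p))
  | indSgCong {Γ A B C C' d d' p p'} : Der cl (Sg A B :: Γ) (tyEq C C') →
      Der cl (B :: A :: Γ) (tmEq d d' (C.plug 2 (.pair (.var 1) (.var 0)))) →
      Der cl Γ (tmEq p p' (Sg A B)) →
      Der cl Γ (tmEq (.indSg C d p) (.indSg C' d' p') (C.inst p))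
  | sgBeta {Γ A B C d a b} : Der cl (Sg A B :: Γ) (ty C) →
      Der cl (B :: A :: Γ) (tm d (C.plug 2 (.pair (.var 1) (.var 0)))) →
      Der cl Γ (tm a A) → Der cl Γ (tm b (B.inst a)) →
      Der cl Γ (tmEq (.indSg C d (.pair a b)) (d.inst2 a b) (C.inst (.pair a b)))
  -- the unit type and the empty type
  | star {Γ} : Der cl Γ ok → Der cl Γ (tm star One)
  | indOne {Γ C c t} : Der cl (One :: Γ) (ty C) → Der cl Γ (tm c (C.inst .star)) →
      Der cl Γ (tm t One) → Der cl Γ (tm (indOne C c t) (C.inst t))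
  | indOneCong {Γ C C' c c' t t'} : Der cl (One :: Γ) (tyEq C C') →
      Der cl Γ (tmEq c c' (C.inst .star)) → Der cl Γ (tmEq t t' One) →
      Der cl Γ (tmEq (.indOne C c t) (.indOne C' c' t') (C.inst t))
  | oneBeta {Γ C c} : Der cl (One :: Γ) (ty C) → Der cl Γ (tm c (C.inst .star)) →
      Der cl Γ (tmEq (.indOne C c .star) c (C.inst .star))
  | indZero {Γ C t} : Der cl (Zero :: Γ) (ty C) → Der cl Γ (tm t Zero) →
      Der cl Γ (tm (indZero C t) (C.inst t))
  | indZeroCong {Γ C C' t t'} : Der cl (Zero :: Γ) (tyEq C C') → Der cl Γ (tmEq t t' Zero) →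
      Der cl Γ (tmEq (.indZero C t) (.indZero C' t') (C.inst t))
  -- binary sums
  | inl {Γ A B a} : Der cl Γ (ty B) → Der cl Γ (tm a A) → Der cl Γ (tm (inl a) (Sum A B))
  | inlCong {Γ A B a a'} : Der cl Γ (ty B) → Der cl Γ (tmEq a a' A) →
      Der cl Γ (tmEq (.inl a) (.inl a') (Sum A B))
  | inr {Γ A B b} : Der cl Γ (ty A) → Der cl Γ (tm b B) → Der cl Γ (tm (inr b) (Sum A B))
  | inrCong {Γ A B b b'} : Der cl Γ (ty A) → Der cl Γ (tmEq b b' B) →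
      Der cl Γ (tmEq (.inr b) (.inr b') (Sum A B))
  | indSum {Γ A B C l r t} : Der cl (Sum A B :: Γ) (ty C) →
      Der cl (A :: Γ) (tm l (C.plug 1 (.inl (.var 0)))) →
      Der cl (B :: Γ) (tm r (C.plug 1 (.inr (.var 0)))) →
      Der cl Γ (tm t (Sum A B)) → Der cl Γ (tm (indSum C l r t) (C.inst t))
  | indSumCong {Γ A B C C' l l' r r' t t'} : Der cl (Sum A B :: Γ) (tyEq C C') →
      Der cl (A :: Γ) (tmEq l l' (C.plug 1 (.inl (.var 0)))) →
      Der cl (B :: Γ) (tmEq r r' (C.plug 1 (.inr (.var 0)))) →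
      Der cl Γ (tmEq t t' (Sum A B)) →
      Der cl Γ (tmEq (.indSum C l r t) (.indSum C' l' r' t') (C.inst t))
  | inlBeta {Γ A B C l r a} : Der cl (Sum A B :: Γ) (ty C) →
      Der cl (A :: Γ) (tm l (C.plug 1 (.inl (.var 0)))) →
      Der cl (B :: Γ) (tm r (C.plug 1 (.inr (.var 0)))) →
      Der cl Γ (tm a A) →
      Der cl Γ (tmEq (.indSum C l r (.inl a)) (l.inst a) (C.inst (.inl a)))
  | inrBeta {Γ A B C l r b} : Der cl (Sum A B :: Γ) (ty C) →
      Der cl (A :: Γ) (tm l (C.plug 1 (.inl (.var 0)))) →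
      Der cl (B :: Γ) (tm r (C.plug 1 (.inr (.var 0)))) →
      Der cl Γ (tm b B) →
      Der cl Γ (tmEq (.indSum C l r (.inr b)) (r.inst b) (C.inst (.inr b)))
  -- identity types
  | refl {Γ A a} : Der cl Γ (tm a A) → Der cl Γ (tm (refl a) (Id A a a))
  | reflCong {Γ A a a'} : Der cl Γ (tmEq a a' A) →
      Der cl Γ (tmEq (.refl a) (.refl a') (Id A a a))
  | indId {Γ A a C d b p} : Der cl Γ (tm a A) →
      Der cl (Id A.wk a.wk (.var 0) :: A :: Γ) (ty C) →
      Der cl Γ (tm d (C.inst2 a (.refl a))) → Der cl Γ (tm b A) → Der cl Γ (tm p (Id A a b)) →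
      Der cl Γ (tm (indId a C d b p) (C.inst2 b p))
  | indIdCong {Γ A a a' C C' d d' b b' p p'} : Der cl Γ (tmEq a a' A) →
      Der cl (Id A.wk a.wk (.var 0) :: A :: Γ) (tyEq C C') →
      Der cl Γ (tmEq d d' (C.inst2 a (.refl a))) → Der cl Γ (tmEq b b' A) →
      Der cl Γ (tmEq p p' (Id A a b)) →
      Der cl Γ (tmEq (.indId a C d b p) (.indId a' C' d' b' p') (C.inst2 b p))
  | idBeta {Γ A a C d} : Der cl Γ (tm a A) →
      Der cl (Id A.wk a.wk (.var 0) :: A :: Γ) (ty C) →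
      Der cl Γ (tm d (C.inst2 a (.refl a))) →
      Der cl Γ (tmEq (.indId a C d a (.refl a)) d (C.inst2 a (.refl a)))
  -- propositional truncation
  | tr {Γ A a} : Der cl Γ (tm a A) → Der cl Γ (tm (tr a) (Tr A))
  | trTmCong {Γ A a a'} : Der cl Γ (tmEq a a' A) → Der cl Γ (tmEq (.tr a) (.tr a') (Tr A))
  | squash {Γ A x y} : Der cl Γ (tm x (Tr A)) → Der cl Γ (tm y (Tr A)) →
      Der cl Γ (tm (squash x y) (Id (Tr A) x y))
  | squashCong {Γ A x x' y y'} : Der cl Γ (tmEq x x' (Tr A)) → Der cl Γ (tmEq y y' (Tr A)) →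
      Der cl Γ (tmEq (.squash x y) (.squash x' y') (Id (Tr A) x y))
  | trRec {Γ A B h f t} : Der cl Γ (ty B) → Der cl Γ (tm h (isProp B)) →
      Der cl Γ (tm f (arrow A B)) → Der cl Γ (tm t (Tr A)) → Der cl Γ (tm (trRec B h f t) B)
  | trRecCong {Γ A B B' h h' f f' t t'} : Der cl Γ (tyEq B B') →
      Der cl Γ (tmEq h h' (isProp B)) → Der cl Γ (tmEq f f' (arrow A B)) →
      Der cl Γ (tmEq t t' (Tr A)) → Der cl Γ (tmEq (.trRec B h f t) (.trRec B' h' f' t') B)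
  | trBeta {Γ A B h f a} : Der cl Γ (ty B) → Der cl Γ (tm h (isProp B)) →
      Der cl Γ (tm f (arrow A B)) → Der cl Γ (tm a A) →
      Der cl Γ (tmEq (.trRec B h f (.tr a)) (.app f a) B)
  -- function extensionality, univalence, excluded middle
  | funext {Γ A B f g} : Der cl (A :: Γ) (ty B) → Der cl Γ (tm f (Pi A B)) →
      Der cl Γ (tm g (Pi A B)) → Der cl Γ (tm (funext A B f g) (funextTy A B f g))
  | funextCong {Γ A A' B B' f f' g g'} : Der cl Γ (tyEq A A') → Der cl (A :: Γ) (tyEq B B') →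
      Der cl Γ (tmEq f f' (Pi A B)) → Der cl Γ (tmEq g g' (Pi A B)) →
      Der cl Γ (tmEq (.funext A B f g) (.funext A' B' f' g') (funextTy A B f g))
  | ua {Γ X Y} : Der cl Γ (tm X U) → Der cl Γ (tm Y U) → Der cl Γ (tm (ua X Y) (uaTy X Y))
  | uaCong {Γ X X' Y Y'} : Der cl Γ (tmEq X X' U) → Der cl Γ (tmEq Y Y' U) →
      Der cl Γ (tmEq (.ua X Y) (.ua X' Y') (uaTy X Y))
  | lem {Γ} : cl = true → Der cl Γ ok → Der cl Γ (tm lem lemTy)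

end HoTT

/-! ## Signatures -/

namespace FOLIso

/-- A non-identity arrow `K ⟶ A` of an inverse category. Inverse categories have no non-identity
endomorphisms, so these are the arrows with distinct domain and codomain. -/
structure NHom {C : Type} [SmallCategory C] (K A : C) where
  hom : K ⟶ A
  ne : A ≠ K

/-- The set `K // L` of non-identity arrows with domain `K`. -/
structure Arr {C : Type} [SmallCategory C] (K : C) where
  cod : C
  arr : NHom K cod

/-- A FOLDS signature: an inverse category with a proper order. The order on the arrows with
domain `K` is given by listing `K // L` in increasing order; finite fan-out is part of this. -/
structure Signature where
  Obj : Type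
  [cat : SmallCategory Obj]
  endo_eq_id : ∀ {K : Obj} (f : K ⟶ K), f = 𝟙 K
  skeletal : Skeletal Obj
  lt : Obj → Obj → Prop
  lt_irrefl : ∀ K, ¬ lt K K
  lt_trans : ∀ {A B K}, lt A B → lt B K → lt A K
  lt_of_arr : ∀ {K A : Obj}, NHom K A → lt A K
  arrows : (K : Obj) → List (Arr K)
  arrows_nodup : ∀ K, (arrows K).Nodup
  mem_arrows : ∀ {K} (f : Arr K), f ∈ arrows K
  arrows_ordered : ∀ K, (arrows K).Pairwise fun f g => ¬ lt g.cod f.cod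

attribute [instance] Signature.cat

variable {L : Signature}

/-- The composite `g ∘ f` of non-identity arrows. -/
def NHom.comp {K A B : L.Obj} (f : NHom K A) (g : NHom A B) : NHom K B where
  hom := f.hom ≫ g.hom
  ne := by
    rintro rfl
    exact L.lt_irrefl _ (L.lt_trans (L.lt_of_arr f) (L.lt_of_arr g))

/-- The composite `p ∘ f` as an element of `K // L`. -/
def NHom.andThen {K A : L.Obj} (f : NHom K A) (p : Arr A) : Arr K := ⟨p.cod, f.comp p.arr⟩

def NHom.toArr {K A : L.Obj} (f : NHom K A) : Arr K := ⟨A, f⟩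

/-- An arrow is top-level if it does not factor through another one. -/
def NHom.TopLevel {K A : L.Obj} (f : NHom K A) : Prop :=
  ∀ (B : L.Obj) (g : NHom K B) (k : NHom B A), f ≠ g.comp k

/-- The number of objects below `K`; it decreases along non-identity arrows. -/
noncomputable def Signature.rank (L : Signature) (K : L.Obj) : ℕ :=
  Set.ncard {A : L.Obj | Nonempty (NHom K A)}

theorem Signature.rank_lt (L : Signature) {K A : L.Obj} (f : NHom K A) : L.rank A < L.rank K := by
  refine Set.ncard_lt_ncard ⟨?_, ?_⟩ ?_
  · rintro B ⟨g⟩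
    exact ⟨f.comp g⟩
  · intro h
    obtain ⟨g⟩ := h (show A ∈ {A : L.Obj | Nonempty (NHom K A)} from ⟨f⟩)
    exact g.ne rfl
  · refine (List.finite_toSet ((L.arrows K).map Arr.cod)).subset ?_
    rintro B ⟨g⟩
    exact List.mem_map.2 ⟨⟨B, g⟩, L.mem_arrows _, rfl⟩

/-- The kind of the sort `E`: a non-logical sort, the isomorphism sort `≅_K` with its arrows
`s`, `t`, the reflexivity sort `ρ_K` with its arrow `r` to `I = ≅_K`, or the transport sort `τ_f`
for `f : A ⟶ K` with its arrows `e` to `I = ≅_K` and `f₁`, `f₂` to `A`. -/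
inductive Kind {C : Type} [SmallCategory C] (E : C) : Type
  | nonlogical
  | iso (K : C) (s t : NHom E K)
  | refl (K I : C) (s t : NHom I K) (r : NHom E I)
  | transp (A K I : C) (f : NHom A K) (s t : NHom I K) (e : NHom E I) (f₁ f₂ : NHom E A)

/-- An essentially finite `h`-signature. The field `sorts` lists the non-logical sorts in
increasing order. Subtraction on `ℕ∞` satisfies `⊤ - m = ⊤`. -/
structure HSignature extends Signature where
  kind : (E : Obj) → Kind E
  h : Obj → ℕ∞
  iso_spec : ∀ {E K : Obj} {s t : NHom E K}, kind E = .iso K s t →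
    2 ≤ h K ∧ s ≠ t ∧
    (∀ {B : Obj} (g : NHom E B),
      NHom.TopLevel (L := toSignature) g ↔
        (⟨B, g⟩ : Arr E) = ⟨K, s⟩ ∨ (⟨B, g⟩ : Arr E) = ⟨K, t⟩) ∧
    (∀ {B : Obj} (g : NHom K B), s.hom ≫ g.hom = t.hom ≫ g.hom) ∧
    h E = h K - 1
  refl_spec : ∀ {E K I : Obj} {s t : NHom I K} {r : NHom E I}, kind E = .refl K I s t r →
    kind I = .iso K s t ∧ 2 ≤ h K ∧
    (∀ {B : Obj} (g : NHom E B),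
      NHom.TopLevel (L := toSignature) g ↔ (⟨B, g⟩ : Arr E) = ⟨I, r⟩) ∧
    r.hom ≫ s.hom = r.hom ≫ t.hom ∧
    h E = h K - 2
  transp_spec : ∀ {E A K I : Obj} {f : NHom A K} {s t : NHom I K} {e : NHom E I}
    {f₁ f₂ : NHom E A}, kind E = .transp A K I f s t e f₁ f₂ →
    kind I = .iso K s t ∧ NHom.TopLevel (L := toSignature) f ∧
    f₁ ≠ f₂ ∧ (⟨I, e⟩ : Arr E) ≠ ⟨A, f₁⟩ ∧ (⟨I, e⟩ : Arr E) ≠ ⟨A, f₂⟩ ∧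
    (∀ {B : Obj} (g : NHom E B),
      NHom.TopLevel (L := toSignature) g ↔
        (⟨B, g⟩ : Arr E) = ⟨I, e⟩ ∨ (⟨B, g⟩ : Arr E) = ⟨A, f₁⟩ ∨ (⟨B, g⟩ : Arr E) = ⟨A, f₂⟩) ∧
    e.hom ≫ s.hom = f₁.hom ≫ f.hom ∧ e.hom ≫ t.hom = f₂.hom ≫ f.hom ∧
    (∀ {B : Obj} (g : NHom A B), (⟨B, g⟩ : Arr A) ≠ ⟨K, f⟩ →
      f₁.hom ≫ g.hom = f₂.hom ≫ g.hom) ∧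
    h E = h A - 1
  -- each logical symbol occurs at most once
  iso_unique : ∀ {E E' K : Obj} {s t : NHom E K} {s' t' : NHom E' K},
    kind E = .iso K s t → kind E' = .iso K s' t' → E = E'
  refl_unique : ∀ {E E' K I : Obj} {s t : NHom I K} {r : NHom E I} {r' : NHom E' I},
    kind E = .refl K I s t r → kind E' = .refl K I s t r' → E = E'
  transp_unique : ∀ {E E' A K I : Obj} {f : NHom A K} {s t : NHom I K} {e : NHom E I}
    {f₁ f₂ : NHom E A} {e' : NHom E' I} {f₁' f₂' : NHom E' A},
    kind E = .transp A K I f s t e f₁ f₂ → kind E' = .transp A K I f s t e' f₁' f₂' → E = E'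
  -- sorts of `h`-level `0` are logical (by `iso_spec`, not isomorphism sorts)
  h_ne_zero_of_nonlogical : ∀ {E : Obj}, kind E = .nonlogical → h E ≠ 0
  sorts : List Obj
  sorts_nodup : sorts.Nodup
  mem_sorts : ∀ {K}, K ∈ sorts ↔ kind K = .nonlogical
  sorts_ordered : sorts.Pairwise fun A B => ¬ lt B A

/-! ## Syntax -/

/-- A raw sort `A(x_f)_{f ∈ A // L}`; variables are de Bruijn indices. -/
structure SortExpr (L : Signature) where
  head : L.Obj
  args : Arr head → ℕ

def SortExpr.rename (r : ℕ → ℕ) (K : SortExpr L) : SortExpr L := ⟨K.head, fun f => r (K.args f)⟩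

/-- The sort `K_f(x_{pf})_p` that the variable at position `f` of `K(x_f)_f` has to have. -/
def SortExpr.face (K : SortExpr L) (f : Arr K.head) : SortExpr L :=
  ⟨f.cod, fun p => K.args (f.arr.andThen p)⟩

inductive Form (L : Signature) : Type
  | bot
  | top
  | and (φ ψ : Form L)
  | or (φ ψ : Form L)
  | imp (φ ψ : Form L)
  | all (K : SortExpr L) (φ : Form L)
  | ex (K : SortExpr L) (φ : Form L)

namespace Form

/-- Substitution of variables for variables. -/
def rename : (ℕ → ℕ) → Form L → Form L
  | _, bot => bot
  | _, top => top
  | r, and φ ψ => and (φ.rename r) (ψ.rename r)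
  | r, or φ ψ => or (φ.rename r) (ψ.rename r)
  | r, imp φ ψ => imp (φ.rename r) (ψ.rename r)
  | r, all K φ => all (K.rename r) (φ.rename (HoTT.Expr.liftR r))
  | r, ex K φ => ex (K.rename r) (φ.rename (HoTT.Expr.liftR r))

def wk (φ : Form L) : Form L := φ.rename Nat.succ

/-- A sort `K`, read as the formula `∃ x : K. ⊤`. -/
def ofSort (K : SortExpr L) : Form L := ex K top

end Form

/-- Raw contexts; the head of the list is the sort of the variable `0`. -/
abbrev Ctx (L : Signature) := List (SortExpr L)

/-- `Γ ⊢ x : K`. -/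
def HasSort (Γ : Ctx L) (x : ℕ) (K : SortExpr L) : Prop :=
  ∃ K₀, Γ[x]? = some K₀ ∧ K = K₀.rename (· + (x + 1))

/-- `Γ ⊢ K Sort`, for a well-formed context `Γ`. -/
def SortWF (Γ : Ctx L) (K : SortExpr L) : Prop :=
  ∀ f : Arr K.head, HasSort Γ (K.args f) (K.face f)

/-- `Γ ok`. -/
def CtxWF : Ctx L → Prop
  | [] => True
  | K :: Γ => CtxWF Γ ∧ SortWF Γ K

/-- `Γ ⊢ φ formula`, for a well-formed context `Γ`. -/
def FormWF : Ctx L → Form L → Prop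
  | _, .bot => True
  | _, .top => True
  | Γ, .and φ ψ => FormWF Γ φ ∧ FormWF Γ ψ
  | Γ, .or φ ψ => FormWF Γ φ ∧ FormWF Γ ψ
  | Γ, .imp φ ψ => FormWF Γ φ ∧ FormWF Γ ψ
  | Γ, .all K φ => SortWF Γ K ∧ FormWF (K :: Γ) φ
  | Γ, .ex K φ => SortWF Γ K ∧ FormWF (K :: Γ) φ

/-- The variables `r 0, r 1, …` form a context morphism `Γ ⇒ Δ`. -/
def CtxMor (Γ Δ : Ctx L) (r : ℕ → ℕ) : Prop :=
  ∀ x K, HasSort Δ x K → HasSort Γ (r x) (K.rename r)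

/-- A raw sequent `Γ | φ ⇒ ψ`. -/
structure Sequent (L : Signature) where
  ctx : Ctx L
  hyp : Form L
  concl : Form L

def Sequent.WF (σ : Sequent L) : Prop :=
  CtxWF σ.ctx ∧ FormWF σ.ctx σ.hyp ∧ FormWF σ.ctx σ.concl

/-- A theory: a set of (well-formed) sequents. -/
structure Theory (L : Signature) where
  axioms : Set (Sequent L)
  wf : ∀ σ ∈ axioms, σ.WF

/-! ## The deductive system -/

/-- `r` acting below `n` bound variables. -/
def liftN (r : ℕ → ℕ) : ℕ → ℕ → ℕ
  | 0 => r
  | n + 1 => HoTT.Expr.liftR (liftN r n)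

/-- Substitution in a telescope. -/
def renameTele (r : ℕ → ℕ) : Ctx L → Ctx L
  | [] => []
  | K :: Γ => K.rename (liftN r Γ.length) :: renameTele r Γ

/-- The transposition of the variables `0` and `1`. -/
def swap01 : ℕ → ℕ
  | 0 => 1
  | 1 => 0
  | n + 2 => n + 2

/-- The map identifying the variables `0` and `1`. -/
def contract01 : ℕ → ℕ
  | 0 => 0
  | n + 1 => n

/-- `Entails L cl T σ`: the sequent `σ` is derivable from `T` in the deductive system of
first-order logic with isomorphism, intuitionistically (`cl = false`) or with excluded middle
(`cl = true`). All sequents that occur are well-formed; in `rho`, `tauRho` and `J` this determines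
the arguments of the logical sorts which are not displayed. -/
inductive Entails (L : HSignature) (cl : Bool) (T : Theory L.toSignature) :
    Sequent L.toSignature → Prop
  | ax {σ} : σ ∈ T.axioms → Entails L cl T σ
  -- structural rules
  | iden {Γ φ} : (Sequent.mk Γ φ φ).WF → Entails L cl T ⟨Γ, φ, φ⟩
  | sub {Γ Δ φ ψ r} : CtxWF Γ → CtxMor Γ Δ r → Entails L cl T ⟨Δ, φ, ψ⟩ →
      Entails L cl T ⟨Γ, φ.rename r, ψ.rename r⟩
  | cut {Γ φ ψ χ} : Entails L cl T ⟨Γ, φ, ψ⟩ → Entails L cl T ⟨Γ, ψ, χ⟩ →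
      Entails L cl T ⟨Γ, φ, χ⟩
  | conWk {Γ K φ ψ} : SortWF Γ K → Entails L cl T ⟨Γ, φ, ψ⟩ →
      Entails L cl T ⟨K :: Γ, φ.wk, ψ.wk⟩
  | conExch {Γ Γ' K K' φ ψ} : SortWF Γ K → SortWF Γ K' →
      Entails L cl T ⟨Γ' ++ K'.rename Nat.succ :: K :: Γ, φ, ψ⟩ →
      Entails L cl T ⟨renameTele swap01 Γ' ++ K.rename Nat.succ :: K' :: Γ,
        φ.rename (liftN swap01 Γ'.length), ψ.rename (liftN swap01 Γ'.length)⟩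
  -- logical rules
  | top {Γ φ} : (Sequent.mk Γ φ .top).WF → Entails L cl T ⟨Γ, φ, .top⟩
  | bot {Γ φ} : (Sequent.mk Γ .bot φ).WF → Entails L cl T ⟨Γ, .bot, φ⟩
  | exTop {Γ K φ} : (Sequent.mk Γ (.ex K φ) (.ex K .top)).WF →
      Entails L cl T ⟨Γ, .ex K φ, .ex K .top⟩
  | andIntro {Γ θ φ ψ} : Entails L cl T ⟨Γ, θ, φ⟩ → Entails L cl T ⟨Γ, θ, ψ⟩ →
      Entails L cl T ⟨Γ, θ, .and φ ψ⟩
  | andLeft {Γ θ φ ψ} : Entails L cl T ⟨Γ, θ, .and φ ψ⟩ → Entails L cl T ⟨Γ, θ, φ⟩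
  | andRight {Γ θ φ ψ} : Entails L cl T ⟨Γ, θ, .and φ ψ⟩ → Entails L cl T ⟨Γ, θ, ψ⟩
  | orElim {Γ θ φ ψ} : Entails L cl T ⟨Γ, φ, θ⟩ → Entails L cl T ⟨Γ, ψ, θ⟩ →
      Entails L cl T ⟨Γ, .or φ ψ, θ⟩
  | orLeft {Γ θ φ ψ} : Entails L cl T ⟨Γ, .or φ ψ, θ⟩ → Entails L cl T ⟨Γ, φ, θ⟩
  | orRight {Γ θ φ ψ} : Entails L cl T ⟨Γ, .or φ ψ, θ⟩ → Entails L cl T ⟨Γ, ψ, θ⟩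
  | impIntro {Γ θ φ ψ} : Entails L cl T ⟨Γ, .and θ φ, ψ⟩ → Entails L cl T ⟨Γ, θ, .imp φ ψ⟩
  | impElim {Γ θ φ ψ} : Entails L cl T ⟨Γ, θ, .imp φ ψ⟩ → Entails L cl T ⟨Γ, .and θ φ, ψ⟩
  | allIntro {Γ K θ φ} : FormWF Γ θ → Entails L cl T ⟨K :: Γ, θ.wk, φ⟩ →
      Entails L cl T ⟨Γ, θ, .all K φ⟩
  | allElim {Γ K θ φ} : Entails L cl T ⟨Γ, θ, .all K φ⟩ → Entails L cl T ⟨K :: Γ, θ.wk, φ⟩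
  | exElim {Γ K θ φ} : FormWF Γ θ → Entails L cl T ⟨K :: Γ, φ, θ.wk⟩ →
      Entails L cl T ⟨Γ, .ex K φ, θ⟩
  | exIntro {Γ K θ φ} : Entails L cl T ⟨Γ, .ex K φ, θ⟩ → Entails L cl T ⟨K :: Γ, φ, θ.wk⟩
  | frob {Γ K φ ψ} : (Sequent.mk Γ (.and φ (.ex K ψ)) (.ex K (.and φ.wk ψ))).WF →
      Entails L cl T ⟨Γ, .and φ (.ex K ψ), .ex K (.and φ.wk ψ)⟩
  | dist {Γ φ ψ χ} : (Sequent.mk Γ (.and φ (.or ψ χ)) (.or (.and φ ψ) (.and φ χ))).WF →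
      Entails L cl T ⟨Γ, .and φ (.or ψ χ), .or (.and φ ψ) (.and φ χ)⟩
  | lem {Γ φ} : cl = true → (Sequent.mk Γ .top (.or φ (.imp φ .bot))).WF →
      Entails L cl T ⟨Γ, .top, .or φ (.imp φ .bot)⟩
  /- `Γ, x : K | θ ⇒ ∃ q : x ≅ x. ρ(q)` -/
  | rho {Γ K θ A I R} {s t : NHom I A} {r : NHom R I} {q : Arr I → ℕ} {w : Arr R → ℕ} :
      L.kind I = .iso A s t → L.kind R = .refl A I s t r →
      q s.toArr = 0 → q t.toArr = 0 → w r.toArr = 0 →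
      (Sequent.mk (K :: Γ) θ (.ex ⟨I, q⟩ (.ofSort ⟨R, w⟩))).WF →
      Entails L cl T ⟨K :: Γ, θ, .ex ⟨I, q⟩ (.ofSort ⟨R, w⟩)⟩
  /- `Γ, x : K, α : A, q : x ≅ x | ρ(q) ∧ θ ⇒ τ_f(q, α, α)` -/
  | tauRho {Γ K A' θ A B I R E} {f : NHom B A} {s t : NHom I A} {r : NHom R I}
      {e : NHom E I} {f₁ f₂ : NHom E B} {q : Arr I → ℕ} {w : Arr R → ℕ} {u : Arr E → ℕ} :
      L.kind R = .refl A I s t r → L.kind E = .transp B A I f s t e f₁ f₂ →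
      q s.toArr = 1 → q t.toArr = 1 → w r.toArr = 0 →
      u e.toArr = 0 → u f₁.toArr = 1 → u f₂.toArr = 1 →
      (Sequent.mk (⟨I, q⟩ :: A' :: K :: Γ) (.and (.ofSort ⟨R, w⟩) θ) (.ofSort ⟨E, u⟩)).WF →
      Entails L cl T ⟨⟨I, q⟩ :: A' :: K :: Γ, .and (.ofSort ⟨R, w⟩) θ, .ofSort ⟨E, u⟩⟩
  /- from `Γ, x : K, q : x ≅ x | ρ(q) ∧ θ[x, x, q] ⇒ φ[x, x, q]` infer
  `Γ, x : K, y : K, p : x ≅ y | θ ⇒ φ` -/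
  | J {Γ K θ φ A I R} {s t : NHom I A} {r : NHom R I} {p : Arr I → ℕ} {w : Arr R → ℕ} :
      L.kind I = .iso A s t → L.kind R = .refl A I s t r →
      p s.toArr = 1 → p t.toArr = 0 → w r.toArr = 0 →
      (Sequent.mk (⟨I, p⟩ :: K.rename Nat.succ :: K :: Γ) θ φ).WF →
      Entails L cl T ⟨⟨I, fun g => contract01 (p g)⟩ :: K :: Γ,
        .and (.ofSort ⟨R, w⟩) (θ.rename (HoTT.Expr.liftR contract01)),
        φ.rename (HoTT.Expr.liftR contract01)⟩ →
      Entails L cl T ⟨⟨I, p⟩ :: K.rename Nat.succ :: K :: Γ, θ, φ⟩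

/-! ## Homotopy semantics -/

open HoTT HoTT.Expr

/-- The type `U_m` of types of `h`-level `m` in `U`, with `U_∞ = U`. -/
noncomputable def typesOfHLevel (m : ℕ∞) : Expr :=
  open Classical in if m = ⊤ then U else Sg U (isOfHLevel m.toNat (El (var 0)))

/-- The type underlying a term of `U_m`. -/
noncomputable def underlying (m : ℕ∞) (c : Expr) : Expr :=
  open Classical in if m = ⊤ then El c else El (fst U c)

/-- `app[c(p₁, …, pₙ)]`; a function of no arguments is applied to the point of `1`. -/
def apps (c : Expr) : List Expr → Expr
  | [] => app c star
  | p :: ps => ps.foldl app (app c p)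

/-- The value `t` at `i`, the values of `a` elsewhere. -/
noncomputable def setAt {ι : Type} (a : ι → Expr) (i : ι) (t : Expr) : ι → Expr :=
  open Classical in fun j => if j = i then t else a j

namespace HSignature

variable (L : HSignature)

/-- The type interpreting the sort `K` with the term `a f` at position `f`, where non-logical
sorts `A` are interpreted by the terms `N A`. -/
noncomputable def interpSort (N : L.Obj → Expr) (K : L.Obj) (a : Arr K → Expr) : Expr :=
  match L.kind K with
  | .nonlogical => underlying (L.h K) (apps (N K) ((L.arrows K).map a))
  | .iso A s t =>
      Id (interpSort N A fun p => a (NHom.andThen (L := L.toSignature) s p))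
        (a (NHom.toArr (L := L.toSignature) s)) (a (NHom.toArr (L := L.toSignature) t))
  | .refl A I s t r =>
      let r' := NHom.andThen (L := L.toSignature) r
      let x := a (r' ⟨A, s⟩)
      Id (Id (interpSort N A fun p => a (r' (NHom.andThen (L := L.toSignature) s p)))
          x (a (r' ⟨A, t⟩)))
        (a (NHom.toArr (L := L.toSignature) r)) (.refl x)
  | .transp A B _ f _ _ e f₁ f₂ =>
      let x₁ := NHom.andThen (L := L.toSignature) f₁
      let x₂ := NHom.andThen (L := L.toSignature) f₂
      let P := interpSort (fun C => (N C).wk) A (setAt (fun p => (a (x₁ p)).wk) ⟨B, f⟩ (var 0))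
      Id (interpSort N A fun p => a (x₂ p))
        (a (NHom.toArr (L := L.toSignature) f₂))
        (trans P (a (x₁ ⟨B, f⟩)) (a (x₂ ⟨B, f⟩)) (a (NHom.toArr (L := L.toSignature) e))
          (a (NHom.toArr (L := L.toSignature) f₁)))
termination_by L.rank K
decreasing_by
  · exact L.rank_lt s
  · exact (L.rank_lt s).trans (L.rank_lt r)
  · exact L.rank_lt f₁
  · exact L.rank_lt f₁

/-- `Π (f : K̂_f)_f. U_{h(K)}`, where `f` runs over the given list of arrows and `a` assigns terms
to the arrows already bound. -/
noncomputable def sortTyAux (K : L.Obj) :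
    (L.Obj → Expr) → (Arr K → Expr) → List (Arr K) → Expr
  | _, _, [] => typesOfHLevel (L.h K)
  | N, a, f :: fs =>
      Pi (L.interpSort N f.cod fun p => a (NHom.andThen (L := L.toSignature) f.arr p))
        (sortTyAux K (fun C => (N C).wk) (setAt (fun g => (a g).wk) f (var 0)) fs)

/-- The type `T_K` of interpretations of a non-logical sort `K`, given interpretations `N` of the
smaller ones. -/
noncomputable def sortTy (N : L.Obj → Expr) (K : L.Obj) : Expr :=
  match L.arrows K with
  | [] => arrow One (typesOfHLevel (L.h K))
  | f :: fs => L.sortTyAux K N (fun _ => star) (f :: fs)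

/-- `Σ (K : T_K)` over the given list of non-logical sorts. -/
noncomputable def strucTyAux : (L.Obj → Expr) → List L.Obj → Expr
  | _, [] => One
  | N, [K] => L.sortTy N K
  | N, K :: K' :: Ks =>
      Sg (L.sortTy N K) (strucTyAux (setAt (fun A => (N A).wk) K (var 0)) (K' :: Ks))

/-- The closed type of homotopy `L`-structures. -/
noncomputable def strucTy : Expr := L.strucTyAux (fun _ => star) L.sorts

/-- The projections of a term `M` of `strucTyAux N Ks`, added to `N`. -/
noncomputable def projAux : (L.Obj → Expr) → List L.Obj → Expr → L.Obj → Expr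
  | N, [], _ => N
  | N, [K], M => setAt N K M
  | N, K :: K' :: Ks, M =>
      projAux (setAt N K (fst (L.sortTy N K) M)) (K' :: Ks)
        (snd (L.sortTy N K) (L.strucTyAux (setAt (fun A => (N A).wk) K (var 0)) (K' :: Ks)) M)

/-- `K^M`, for `K` non-logical. -/
noncomputable def proj (M : Expr) : L.Obj → Expr := L.projAux (fun _ => star) L.sorts M

/-- The type interpreting a formula; `v` assigns terms to its variables. -/
noncomputable def interpForm : (L.Obj → Expr) → (ℕ → Expr) → Form L.toSignature → Expr
  | _, _, .bot => Zero
  | _, _, .top => One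
  | N, v, .and φ ψ => prod (interpForm N v φ) (interpForm N v ψ)
  | N, v, .or φ ψ => Tr (Sum (interpForm N v φ) (interpForm N v ψ))
  | N, v, .imp φ ψ => arrow (interpForm N v φ) (interpForm N v ψ)
  | N, v, .all K φ =>
      Pi (L.interpSort N K.head fun f => v (K.args f)) (interpForm (fun A => (N A).wk) (liftS v) φ)
  | N, v, .ex K φ =>
      Tr (Sg (L.interpSort N K.head fun f => v (K.args f))
        (interpForm (fun A => (N A).wk) (liftS v) φ))

/-- `Π (Γ^M) B`. -/
noncomputable def piCtx (M : Expr) : Ctx L.toSignature → Expr → Expr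
  | [], B => B
  | K :: Γ, B =>
      piCtx M Γ (Pi (L.interpSort (fun A => (L.proj M A).wkN Γ.length) K.head
        fun f => var (K.args f)) B)

/-- `(Γ | φ ⇒ ψ)^M = Π (Γ^M) (φ^M → ψ^M)`. -/
noncomputable def interpSequent (M : Expr) (σ : Sequent L.toSignature) : Expr :=
  let N := fun A => (L.proj M A).wkN σ.ctx.length
  L.piCtx M σ.ctx (arrow (L.interpForm N var σ.hyp) (L.interpForm N var σ.concl))

/-- `M` is a homotopy `L`-structure, in the context `Γ₀` of HoTT or of HoTT with excluded middle. -/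
def IsStructure (cl : Bool) (Γ₀ : List Expr) (M : Expr) : Prop :=
  Der cl Γ₀ (.tm M L.strucTy)

/-- `M ⊨ σ`: the type `σ^M` is inhabited. -/
def Satisfies (cl : Bool) (Γ₀ : List Expr) (M : Expr) (σ : Sequent L.toSignature) : Prop :=
  ∃ t, Der cl Γ₀ (.tm t (L.interpSequent M σ))

/-- `T ⊨ σ`: every homotopy structure that satisfies the sequents of `T` satisfies `σ`. Structures
may be given by closed terms (`Γ₀ = []`) or by terms in a context. -/
def SemConsequence (cl : Bool) (T : Theory L.toSignature) (σ : Sequent L.toSignature) : Prop :=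
  ∀ (Γ₀ : List Expr) (M : Expr), L.IsStructure cl Γ₀ M →
    (∀ σ' ∈ T.axioms, L.Satisfies cl Γ₀ M σ') → L.Satisfies cl Γ₀ M σ

end HSignature

end FOLIso

/-! Soundness is proved through a forcing relation in the style of Kripke. A world is a context `E`
of type theory together with terms `N` over `E` interpreting the non-logical sorts. A sequent is
forced (`Forces`) if, in every world of a given class and for every valuation of its context by
terms over `E`, inhabitation of the hypothesis implies inhabitation of the conclusion. The classes
considered are closed under extension of `E` (`IsWorldClass`), so a rule that binds a variable or
discharges a hypothesis is checked in the extended world, where the new variable is an ordinary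
term. Induction on derivations then gives `Entails.forces`.

For a structure `M` over `Γ₀`, the worlds are the contexts with a substitution to `Γ₀`, along which
`M` is pulled back. Satisfaction in `M` is forcing over these worlds (`satisfies_iff_forces`). A
term of the iterated Π-type can be substituted along any valuation. Conversely, forcing is evaluated
at the generic world, `Γ₀` extended by the interpretation of the context, with the variables as
their own valuation, and the result is λ-abstracted. The theorem translates the axioms and the
conclusion through this equivalence.

Two typing results carry the logical rules. Well-typed arguments of a sort yield a type with a code
in the universe (`sortFormWF`, by induction on the number of objects below the sort). A well-formed
formula yields a type that is a proposition and has a code (`ValWF.interpForm`). Being a proposition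
is what permits elimination out of the truncations in `∨` and `∃`; function extensionality is needed
for `→` and `∀`. Having a code is what lets excluded middle, which quantifies over the universe,
apply.

The rules for isomorphism come from identity types: (ρ) from reflexivity, (τρ) because transport
along a loop equal to reflexivity fixes every element (`Inh.id_trans_of_refl`), and (J) from based
path induction with the implication of the two formulas as motive. -/

namespace HoTT.Expr

/-! ### Calculus of substitutions -/

/-- The substitution `t, s 0, s 1, …`. -/
def scons (t : Expr) (s : ℕ → Expr) : ℕ → Expr
  | 0 => t
  | n + 1 => s n

/-- The weakening substitution. -/
def shift : ℕ → Expr := fun i => var (i + 1)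

/-- Composition of substitutions, `s` first. -/
def comp (s t : ℕ → Expr) : ℕ → Expr := fun i => (s i).subst t

theorem liftS_var_comp (r : ℕ → ℕ) : liftS (fun i => var (r i)) = fun i => var (liftR r i) := by
  funext i
  cases i <;> rfl

theorem rename_eq_subst (e : Expr) (r : ℕ → ℕ) : e.rename r = e.subst fun i => var (r i) := by
  induction e generalizing r <;> simp [rename, subst, liftS_var_comp, *]

theorem liftR_comp (r r' : ℕ → ℕ) : (fun i => liftR r' (liftR r i)) = liftR fun i => r' (r i) := by
  funext i
  cases i <;> rfl

/-- A substitution passes under a binder by weakening its values. Hence the composition laws are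
first proved for renamings and for renamings mixed with substitutions; the binder case of
`subst_subst` rests on them. -/
theorem rename_rename (e : Expr) (r r' : ℕ → ℕ) :
    (e.rename r).rename r' = e.rename fun i => r' (r i) := by
  induction e generalizing r r' <;> simp [rename, liftR_comp, *]

theorem liftS_liftR (r : ℕ → ℕ) (s : ℕ → Expr) :
    (fun i => liftS s (liftR r i)) = liftS fun i => s (r i) := by
  funext i
  cases i <;> rfl

theorem subst_rename_left (e : Expr) (r : ℕ → ℕ) (s : ℕ → Expr) :
    (e.rename r).subst s = e.subst fun i => s (r i) := by
  induction e generalizing r s <;> simp [rename, subst, liftS_liftR, *]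

theorem liftS_rename (s : ℕ → Expr) (r : ℕ → ℕ) :
    (fun i => (liftS s i).rename (liftR r)) = liftS fun i => (s i).rename r := by
  funext i
  cases i with
  | zero => rfl
  | succ n => simp [liftS, wk, rename_rename, liftR]

theorem rename_subst (e : Expr) (s : ℕ → Expr) (r : ℕ → ℕ) :
    (e.subst s).rename r = e.subst fun i => (s i).rename r := by
  induction e generalizing r s <;> simp [rename, subst, liftS_rename, *]

theorem liftS_liftS (s t : ℕ → Expr) :
    (fun i => (liftS s i).subst (liftS t)) = liftS fun i => (s i).subst t := by
  funext i
  cases i with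
  | zero => rfl
  | succ n => simp [liftS, wk, subst_rename_left, rename_subst]

@[simp]
theorem subst_subst (e : Expr) (s t : ℕ → Expr) : (e.subst s).subst t = e.subst (comp s t) := by
  unfold comp
  induction e generalizing s t <;> simp [subst, liftS_liftS, *]

-- With this and `subst_subst`, every substitution becomes a single one built from `scons`, `shift`
-- and `comp`, which the simp lemmas below normalise. The type demanded by a typing rule and the
-- type at hand are usually matched by reducing both to this form.
@[simp]
theorem liftS_eq (s : ℕ → Expr) : liftS s = scons (var 0) (comp s shift) := by
  funext i
  cases i with
  | zero => rfl
  | succ n => exact rename_eq_subst _ _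

theorem liftS_var : liftS var = var := by
  funext i
  cases i <;> rfl

@[simp]
theorem subst_var (e : Expr) : e.subst var = e := by
  induction e <;> simp only [subst, liftS_var, *]

@[simp]
theorem wk_eq (e : Expr) : e.wk = e.subst shift := rename_eq_subst _ _

@[simp]
theorem comp_var_left (s : ℕ → Expr) : comp var s = s := rfl

@[simp]
theorem comp_var_right (s : ℕ → Expr) : comp s var = s := by
  funext i
  simp [comp]

@[simp]
theorem comp_assoc (s t u : ℕ → Expr) : comp (comp s t) u = comp s (comp t u) := by
  funext i
  simp [comp]

@[simp]
theorem comp_shift_scons (t : Expr) (s : ℕ → Expr) : comp shift (scons t s) = s := rfl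

@[simp]
theorem comp_scons (t : Expr) (s u : ℕ → Expr) :
    comp (scons t s) u = scons (t.subst u) (comp s u) := by
  funext i
  cases i <;> rfl

@[simp]
theorem scons_var_shift : scons (var 0) shift = var := by
  funext i
  cases i <;> rfl

@[simp]
theorem scons_eta (s : ℕ → Expr) : scons (s 0) (comp shift s) = s := by
  funext i
  cases i <;> rfl

@[simp]
theorem scons_zero (t : Expr) (s : ℕ → Expr) : scons t s 0 = t := rfl

@[simp]
theorem scons_succ (t : Expr) (s : ℕ → Expr) (n : ℕ) : scons t s (n + 1) = s n := rfl

@[simp]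
theorem scons_one (t : Expr) (s : ℕ → Expr) : scons t s 1 = s 0 := rfl

@[simp]
theorem scons_two (t : Expr) (s : ℕ → Expr) : scons t s 2 = s 1 := rfl

@[simp]
theorem shift_apply (i : ℕ) : shift i = var (i + 1) := rfl

@[simp]
theorem comp_apply (s t : ℕ → Expr) (i : ℕ) : comp s t i = (s i).subst t := rfl

@[simp]
theorem inst_eq (B a : Expr) : B.inst a = B.subst (scons a var) := by
  unfold inst plug
  congr 1

@[simp]
theorem plug_one_eq (B t : Expr) : B.plug 1 t = B.subst (scons t shift) := by
  unfold plug
  congr 1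

@[simp]
theorem plug_two_eq (B t : Expr) : B.plug 2 t = B.subst (scons t (comp shift shift)) := by
  unfold plug
  congr 1

@[simp]
theorem inst2_eq (C a b : Expr) : C.inst2 a b = C.subst (scons b (scons a var)) := by
  unfold inst2
  congr 1
  funext i
  rcases i with _ | _ | i <;> rfl

theorem wkN_succ (n : ℕ) (e : Expr) : e.wkN (n + 1) = (e.wkN n).subst shift := by
  simp [wkN, rename_eq_subst]
  rfl

theorem wkN_zero (e : Expr) : e.wkN 0 = e := by
  simp only [wkN, rename_eq_subst, Nat.add_zero]
  exact subst_var e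

theorem wkN_one (e : Expr) : e.wkN 1 = e.subst shift := by
  simp [wkN_succ, wkN_zero]

theorem wkN_add_one_scons (n : ℕ) (e t : Expr) (s : ℕ → Expr) :
    (e.wkN (n + 1)).subst (scons t s) = (e.wkN n).subst s := by
  simp [wkN_succ]

theorem rename_liftR_add_three (e : Expr) :
    e.rename (liftR (· + 3)) =
      e.subst (scons (var 0) (comp shift (comp shift (comp shift shift)))) := by
  rw [rename_eq_subst]
  congr 1
  funext i
  cases i <;> rfl

attribute [simp] subst

@[simp]
theorem subst_arrow (A B : Expr) (s : ℕ → Expr) :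
    (arrow A B).subst s = arrow (A.subst s) (B.subst s) := by
  simp [arrow]

@[simp]
theorem subst_prod (A B : Expr) (s : ℕ → Expr) :
    (prod A B).subst s = prod (A.subst s) (B.subst s) := by
  simp [prod]

end HoTT.Expr

/-! ### Admissible structural rules of the type theory -/

namespace HoTT

open HoTT.Expr HoTT.Jdg

variable {cl : Bool} {Γ Δ : List Expr} {A B C a b p t : Expr} {J : Jdg} {s : ℕ → Expr}

attribute [simp] Jdg.subst

/-- Apart from the two context rules, each rule has a premise over the context of its conclusion. -/
theorem Der.ctx_ok (h : Der cl Γ J) : Der cl Γ ok := by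
  induction h <;> first | assumption | exact .ctxNil | (apply Der.ctxCons; assumption)

theorem Der.ty_of_ok_cons (h : Der cl (A :: Γ) ok) : Der cl Γ (ty A) := by
  generalize hΔ : A :: Γ = Δ at h
  generalize hJ : ok = J at h
  induction h with
  | ctxCons h _ => cases hΔ; exact h
  -- The substitution rule can also conclude `ok`, but then the target context is already
  -- well-formed by its first premise.
  | subst _ _ _ ih _ _ => exact ih hΔ rfl
  | _ => cases hΔ <;> cases hJ

/-- `s` is a context morphism from `Δ` to `Γ`. -/
def SubstWF (cl : Bool) (Δ : List Expr) (s : ℕ → Expr) (Γ : List Expr) : Prop :=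
  ∀ i A, Γ[i]? = some A → Der cl Δ (tm (s i) ((A.wkN (i + 1)).subst s))

theorem Der.substWF (h : Der cl Γ J) (hs : SubstWF cl Δ s Γ) (hΔ : Der cl Δ ok) :
    Der cl Δ (J.subst s) :=
  .subst hΔ hs h

theorem SubstWF.shift (hA : Der cl Γ (ty A)) : SubstWF cl (A :: Γ) shift Γ := fun i A' h => by
  have := Der.var (cl := cl) (Γ := A :: Γ) (i := i + 1) (A := A') (.ctxCons hA) (by simpa using h)
  simpa [wkN_succ] using this

theorem SubstWF.id (hΓ : Der cl Γ ok) : SubstWF cl Γ Expr.var Γ := fun i A' h => by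
  simpa using Der.var hΓ h

theorem Der.weaken (h : Der cl Γ J) (hA : Der cl Γ (ty A)) :
    Der cl (A :: Γ) (J.subst Expr.shift) :=
  h.substWF (.shift hA) (.ctxCons hA)

theorem SubstWF.comp_shift (hs : SubstWF cl Δ s Γ) (hA : Der cl Δ (ty A)) :
    SubstWF cl (A :: Δ) (comp s Expr.shift) Γ := fun i A' h => by
  simpa using (hs i A' h).weaken hA

theorem SubstWF.scons (hs : SubstWF cl Δ s Γ) (ht : Der cl Δ (tm t (A.subst s))) :
    SubstWF cl Δ (scons t s) (A :: Γ) := fun i A' h => by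
  cases i with
  | zero => obtain rfl : A = A' := by simpa using h
            simpa [wkN_one] using ht
  | succ n => simpa [wkN_add_one_scons] using hs n A' (by simpa using h)

theorem Der.var_zero (hA : Der cl Γ (ty A)) :
    Der cl (A :: Γ) (tm (.var 0) (A.subst Expr.shift)) := by
  simpa [wkN_one] using Der.var (cl := cl) (Γ := A :: Γ) (i := 0) (.ctxCons hA) rfl

theorem Der.var_one (hB : Der cl (A :: Γ) (ty B)) :
    Der cl (B :: A :: Γ) (tm (.var 1) (A.subst (comp Expr.shift Expr.shift))) := by
  simpa using (Der.var_zero hB.ctx_ok.ty_of_ok_cons).weaken hB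

theorem Der.instantiate (h : Der cl (A :: Γ) J) (ha : Der cl Γ (tm a A)) :
    Der cl Γ (J.subst (scons a .var)) :=
  h.substWF (SubstWF.scons (.id ha.ctx_ok) (by simpa using ha)) ha.ctx_ok

theorem SubstWF.lift (hs : SubstWF cl Δ s Γ) (hA : Der cl Δ (ty (A.subst s))) :
    SubstWF cl (A.subst s :: Δ) (Expr.scons (.var 0) (comp s Expr.shift)) (A :: Γ) :=
  (hs.comp_shift hA).scons (by simpa using Der.var_zero hA)

theorem Der.weaken_under (h : Der cl (B :: Γ) J) (hA : Der cl Γ (ty A)) :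
    Der cl (B.subst Expr.shift :: A :: Γ)
      (J.subst (Expr.scons (.var 0) (comp Expr.shift Expr.shift))) := by
  have hB := h.ctx_ok.ty_of_ok_cons.weaken hA
  exact h.substWF (SubstWF.lift (.shift hA) hB) (.ctxCons hB)

/-- The type `A` is inhabited. -/
def Inh (cl : Bool) (Γ : List Expr) (A : Expr) : Prop := ∃ t, Der cl Γ (tm t A)

theorem Inh.substWF (h : Inh cl Γ A) (hs : SubstWF cl Δ s Γ) (hΔ : Der cl Δ ok) :
    Inh cl Δ (A.subst s) :=
  h.elim fun _ h => ⟨_, h.substWF hs hΔ⟩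

theorem Inh.weaken (h : Inh cl Γ B) (hA : Der cl Γ (ty A)) :
    Inh cl (A :: Γ) (B.subst Expr.shift) :=
  h.substWF (.shift hA) (.ctxCons hA)

theorem Inh.conv (h : Inh cl Γ A) (hAB : Der cl Γ (tyEq A B)) : Inh cl Γ B :=
  h.elim fun _ h => ⟨_, h.conv hAB⟩

/-! ### Functions -/

theorem Inh.lam (h : Inh cl (A :: Γ) B) : Inh cl Γ (Pi A B) :=
  h.elim fun _ h => ⟨_, .lam h.ctx_ok.ty_of_ok_cons h⟩

theorem Inh.app (hB : Der cl (A :: Γ) (ty B)) (h : Inh cl Γ (Pi A B)) (ha : Der cl Γ (tm a A)) :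
    Inh cl Γ (B.subst (scons a .var)) :=
  h.elim fun _ h => ⟨_, by simpa using Der.app hB h ha⟩

/-- The weakened function is applied to the new variable. -/
theorem Inh.unlam (hB : Der cl (A :: Γ) (ty B)) (h : Inh cl Γ (Pi A B)) : Inh cl (A :: Γ) B := by
  have hA := hB.ctx_ok.ty_of_ok_cons
  have := Inh.app (hB.weaken_under hA) (by simpa using h.weaken hA) (.var_zero hA)
  simpa using this

theorem Der.arrowForm (hA : Der cl Γ (ty A)) (hB : Der cl Γ (ty B)) : Der cl Γ (ty (arrow A B)) :=
  .piForm hA (by simpa using hB.weaken hA)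

theorem Inh.arrow_intro (h : Inh cl (A :: Γ) (B.subst Expr.shift)) : Inh cl Γ (arrow A B) := by
  simpa [arrow] using h.lam

theorem Inh.arrow_elim (hB : Der cl Γ (ty B)) (h : Inh cl Γ (arrow A B)) (hA : Der cl Γ (ty A))
    (ha : Inh cl Γ A) : Inh cl Γ B := by
  obtain ⟨a, ha⟩ := ha
  have := Inh.app (B := B.subst Expr.shift) (hB.weaken hA) (by simpa [arrow] using h) ha
  simpa using this

/-! ### Pairs -/

theorem Der.prodForm (hA : Der cl Γ (ty A)) (hB : Der cl Γ (ty B)) : Der cl Γ (ty (prod A B)) :=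
  .sgForm hA (by simpa using hB.weaken hA)

theorem Der.fst (hB : Der cl (A :: Γ) (ty B)) (hp : Der cl Γ (tm p (Sg A B))) :
    Der cl Γ (tm (fst A p) A) := by
  have hA := hB.ctx_ok.ty_of_ok_cons
  have := Der.indSg (C := A.subst Expr.shift) (d := .var 1) (hA.weaken (.sgForm hA hB))
    (by simpa using Der.var_one hB) hp
  simpa [Expr.fst] using this

theorem Der.fst_pair (hB : Der cl (A :: Γ) (ty B)) (ha : Der cl Γ (tm a A))
    (hb : Der cl Γ (tm b (B.inst a))) : Der cl Γ (tmEq (Expr.fst A (.pair a b)) a A) := by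
  have hA := hB.ctx_ok.ty_of_ok_cons
  have := Der.sgBeta (C := A.subst Expr.shift) (d := .var 1) (hA.weaken (.sgForm hA hB))
    (by simpa using Der.var_one hB) ha hb
  simpa [Expr.fst] using this

@[simp]
theorem Expr.subst_fst (A p : Expr) (s : ℕ → Expr) :
    (Expr.fst A p).subst s = Expr.fst (A.subst s) (p.subst s) := by
  simp [Expr.fst]

/-- Instantiation of a type at judgmentally equal terms. -/
theorem Der.instantiateEq (hB : Der cl (A :: Γ) (ty B)) (ha : Der cl Γ (tm a A))
    (hb : Der cl Γ (tm b A)) (hab : Der cl Γ (tmEq a b A)) :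
    Der cl Γ (tyEq (B.subst (scons a .var)) (B.subst (scons b .var))) := by
  refine .substTyEq ha.ctx_ok (SubstWF.scons (.id ha.ctx_ok) (by simpa using ha))
    (SubstWF.scons (.id ha.ctx_ok) (by simpa using hb)) (fun i A' h => ?_) hB
  cases i with
  | zero => obtain rfl : A = A' := by simpa using h
            simpa [wkN_one] using hab
  | succ n => simpa [wkN_add_one_scons] using Der.tmRefl (Der.var ha.ctx_ok (by simpa using h))

/-- The motive is `B` at the first projection. On a pair, the branch `var 0` has type `B` at the
first component, so it must be converted along the β-rule for the first projection. -/
theorem Der.snd (hB : Der cl (A :: Γ) (ty B)) (hp : Der cl Γ (tm p (Sg A B))) :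
    Der cl Γ (tm (snd A B p) (B.subst (scons (Expr.fst A p) .var))) := by
  have hA := hB.ctx_ok.ty_of_ok_cons
  have hS := Der.sgForm hA hB
  have hf : Der cl (Sg A B :: Γ) (tm (Expr.fst (A.subst Expr.shift) (.var 0))
      (A.subst Expr.shift)) := by
    refine Der.fst (hB.weaken_under hS) ?_
    simpa using Der.var_zero hS
  have hC : Der cl (Sg A B :: Γ)
      (ty (B.subst (scons (Expr.fst (A.subst Expr.shift) (.var 0)) Expr.shift))) := by
    simpa using (hB.weaken_under hS).instantiate hf
  have hA2 := (hA.weaken hA).weaken hB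
  have hB2 := (hB.weaken_under hA).weaken_under (B := A.subst Expr.shift) hB
  simp only [Jdg.subst, subst_subst] at hA2 hB2
  have h1 : Der cl (B :: A :: Γ) (tm (.var 1) (A.subst (comp Expr.shift Expr.shift))) :=
    .var_one hB
  have h0 := Der.var_zero hB
  have hp' : Der cl (B :: A :: Γ) (tm (.var 0) ((B.subst (scons (.var 0)
      (comp Expr.shift (comp Expr.shift Expr.shift)))).inst (.var 1))) := by
    -- Over `Γ, A, B` the first component is `var 1`; inserting it in the twice weakened family is
    -- the same as weakening `B` once.
    have e : scons (.var 1) (comp Expr.shift Expr.shift) = Expr.shift := by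
      funext i; cases i <;> rfl
    simpa [e] using h0
  have hpair := Der.pair (by simpa using hB2) h1 hp'
  have hf1 := Der.fst (by simpa using hB2) hpair
  have heq := Der.instantiateEq (by simpa using hB2) h1 hf1
    (.tmSymm (.fst_pair (by simpa using hB2) h1 hp'))
  have := Der.indSg hC (d := .var 0) (.conv h0 ?_) hp
  · simpa [Expr.snd] using this
  · have e : scons (.var 1) (comp Expr.shift Expr.shift) = Expr.shift := by
      funext i; cases i <;> rfl
    simpa [e] using heq

theorem Inh.pair (hB : Der cl (A :: Γ) (ty B)) (ha : Der cl Γ (tm a A))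
    (hb : Inh cl Γ (B.subst (scons a .var))) : Inh cl Γ (Sg A B) :=
  hb.elim fun _ hb => ⟨_, .pair hB ha (by simpa using hb)⟩

theorem Inh.prod_intro (hB : Der cl Γ (ty B)) (ha : Inh cl Γ A) (hb : Inh cl Γ B)
    (hA : Der cl Γ (ty A)) : Inh cl Γ (prod A B) := by
  obtain ⟨a, ha⟩ := ha
  simpa [Expr.prod] using Inh.pair (B := B.subst Expr.shift) (hB.weaken hA) ha (by simpa using hb)

theorem Inh.prod_left (hA : Der cl Γ (ty A)) (hB : Der cl Γ (ty B)) (h : Inh cl Γ (prod A B)) :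
    Inh cl Γ A :=
  h.elim fun _ h =>
    ⟨_, Der.fst (B := B.subst Expr.shift) (hB.weaken hA) (by simpa [Expr.prod] using h)⟩

theorem Inh.prod_right (hA : Der cl Γ (ty A)) (hB : Der cl Γ (ty B)) (h : Inh cl Γ (prod A B)) :
    Inh cl Γ B :=
  h.elim fun _ h => ⟨_, by
    simpa using Der.snd (B := B.subst Expr.shift) (hB.weaken hA) (by simpa [Expr.prod] using h)⟩

theorem Inh.sg_ind (hC : Der cl (Sg A B :: Γ) (ty C))
    (h : Inh cl (B :: A :: Γ)
      (C.subst (scons (.pair (.var 1) (.var 0)) (comp Expr.shift Expr.shift))))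
    (hp : Der cl Γ (tm p (Sg A B))) : Inh cl Γ (C.subst (scons p .var)) :=
  h.elim fun _ h => ⟨_, by simpa using Der.indSg hC (by simpa using h) hp⟩

theorem Inh.sg_elim (hS : Der cl Γ (ty (Sg A B))) (hC : Der cl Γ (ty C))
    (h : Inh cl (B :: A :: Γ) (C.subst (comp Expr.shift Expr.shift)))
    (hp : Inh cl Γ (Sg A B)) : Inh cl Γ C := by
  obtain ⟨p, hp⟩ := hp
  simpa using Inh.sg_ind (C := C.subst Expr.shift) (hC.weaken hS) (by simpa using h) hp

/-! ### Sums and truncations -/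

theorem Inh.sum_elim (hA : Der cl Γ (ty A)) (hB : Der cl Γ (ty B)) (hC : Der cl Γ (ty C))
    (hl : Inh cl (A :: Γ) (C.subst Expr.shift)) (hr : Inh cl (B :: Γ) (C.subst Expr.shift))
    (h : Inh cl Γ (Sum A B)) : Inh cl Γ C := by
  obtain ⟨l, hl⟩ := hl
  obtain ⟨r, hr⟩ := hr
  obtain ⟨t, ht⟩ := h
  have := Der.indSum (C := C.subst Expr.shift) (hC.weaken (.sumForm hA hB))
    (by simpa using hl) (by simpa using hr) ht
  exact ⟨_, by simpa using this⟩

theorem Inh.tr_elim (hB : Der cl Γ (ty B)) (hp : Inh cl Γ (isProp B))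
    (h : Inh cl (A :: Γ) (B.subst Expr.shift)) (ht : Inh cl Γ (Tr A)) : Inh cl Γ B := by
  obtain ⟨p, hp⟩ := hp
  obtain ⟨f, hf⟩ := h.arrow_intro
  obtain ⟨t, ht⟩ := ht
  exact ⟨_, .trRec hB hp hf ht⟩

theorem Inh.tr (h : Inh cl Γ A) : Inh cl Γ (Tr A) := h.elim fun _ h => ⟨_, .tr h⟩

theorem Inh.inl (hB : Der cl Γ (ty B)) (h : Inh cl Γ A) : Inh cl Γ (Sum A B) :=
  h.elim fun _ h => ⟨_, .inl hB h⟩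

theorem Inh.inr (hA : Der cl Γ (ty A)) (h : Inh cl Γ B) : Inh cl Γ (Sum A B) :=
  h.elim fun _ h => ⟨_, .inr hA h⟩

theorem Inh.exfalso (hC : Der cl Γ (ty C)) (h : Inh cl Γ Zero) : Inh cl Γ C :=
  h.elim fun _ h => ⟨_, by
    simpa using Der.indZero (C := C.subst Expr.shift) (hC.weaken (.zeroForm hC.ctx_ok)) h⟩

end HoTT

namespace HoTT

open HoTT.Expr HoTT.Jdg

variable {cl : Bool} {Γ Δ : List Expr} {A B C a a' b b' f g p t : Expr} {s : ℕ → Expr}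

/-! ### Identity types -/

theorem Der.pathForm (hA : Der cl Γ (ty A)) (ha : Der cl Γ (tm a A)) :
    Der cl (A :: Γ) (ty (Id (A.subst shift) (a.subst shift) (.var 0))) :=
  .idForm (hA.weaken hA) (ha.weaken hA) (.var_zero hA)

theorem Inh.path_ind (ha : Der cl Γ (tm a A))
    (hC : Der cl (Id (A.subst shift) (a.subst shift) (.var 0) :: A :: Γ) (ty C))
    (hd : Inh cl Γ (C.subst (scons (.refl a) (scons a .var))))
    (hb : Der cl Γ (tm b A)) (hp : Der cl Γ (tm p (Id A a b))) :
    Inh cl Γ (C.subst (scons p (scons b .var))) := by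
  obtain ⟨d, hd⟩ := hd
  exact ⟨_, by simpa using Der.indId (C := C) ha (by simpa using hC) (by simpa using hd) hb hp⟩

/-- Path induction with a motive that does not depend on the path. -/
theorem Inh.transport (ha : Der cl Γ (tm a A)) (hb : Der cl Γ (tm b A))
    (hp : Inh cl Γ (Id A a b)) (hC : Der cl (A :: Γ) (ty C))
    (h : Inh cl Γ (C.subst (scons a .var))) : Inh cl Γ (C.subst (scons b .var)) := by
  obtain ⟨p, hp⟩ := hp
  have hA := hC.ctx_ok.ty_of_ok_cons
  simpa using Inh.path_ind (C := C.subst shift) ha (hC.weaken (.pathForm hA ha))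
    (by simpa using h) hb hp

theorem Inh.id_refl (ha : Der cl Γ (tm a A)) : Inh cl Γ (Id A a a) := ⟨_, .refl ha⟩

theorem Inh.id_symm (hA : Der cl Γ (ty A)) (ha : Der cl Γ (tm a A)) (hb : Der cl Γ (tm b A))
    (h : Inh cl Γ (Id A a b)) : Inh cl Γ (Id A b a) := by
  simpa using h.transport (C := Id (A.subst shift) (.var 0) (a.subst shift)) ha hb
    (.idForm (hA.weaken hA) (.var_zero hA) (ha.weaken hA)) (by simpa using Inh.id_refl ha)

theorem Inh.id_trans (hA : Der cl Γ (ty A)) (ha : Der cl Γ (tm a A)) (hb : Der cl Γ (tm b A))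
    (hc : Der cl Γ (tm p A)) (h : Inh cl Γ (Id A a b)) (h' : Inh cl Γ (Id A b p)) :
    Inh cl Γ (Id A a p) := by
  simpa using h'.transport (C := Id (A.subst shift) (a.subst shift) (.var 0)) hb hc
    (.pathForm hA ha) (by simpa using h)

theorem Inh.id_map (hA : Der cl Γ (ty A)) (hB : Der cl Γ (ty B))
    (hf : Der cl (A :: Γ) (tm f (B.subst shift))) (ha : Der cl Γ (tm a A))
    (hb : Der cl Γ (tm b A)) (h : Inh cl Γ (Id A a b)) :
    Inh cl Γ (Id B (f.subst (scons a .var)) (f.subst (scons b .var))) := by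
  have hfa : Der cl Γ (tm (f.subst (scons a .var)) B) := by simpa using hf.instantiate ha
  have := h.transport (C := Id (B.subst shift) ((f.subst (scons a .var)).subst shift) f) ha hb
    (.idForm (hB.weaken hA) (hfa.weaken hA) hf) (by simpa using Inh.id_refl hfa)
  simpa using this

/-! ### Propositions -/

@[simp]
theorem Expr.subst_isProp (A : Expr) (s : ℕ → Expr) :
    (isProp A).subst s = isProp (A.subst s) := by
  simp [isProp]

theorem Der.isPropBody (hA : Der cl Γ (ty A)) :
    Der cl (A.subst shift :: A :: Γ) (ty (Id (A.subst (comp shift shift)) (.var 1) (.var 0))) := by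
  have hA1 := hA.weaken hA
  exact .idForm (by simpa using hA1.weaken hA1) (.var_one hA1) (by simpa using Der.var_zero hA1)

theorem Der.isPropForm (hA : Der cl Γ (ty A)) : Der cl Γ (ty (isProp A)) := by
  simpa [isProp] using Der.piForm hA (.piForm (hA.weaken hA) (.isPropBody hA))

theorem Inh.isProp_intro
    (h : Inh cl (A.subst shift :: A :: Γ) (Id (A.subst (comp shift shift)) (.var 1) (.var 0))) :
    Inh cl Γ (isProp A) := by
  simpa [isProp] using h.lam.lam

theorem Inh.isProp_elim (hA : Der cl Γ (ty A)) (h : Inh cl Γ (isProp A))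
    (ha : Der cl Γ (tm a A)) (hb : Der cl Γ (tm b A)) : Inh cl Γ (Id A a b) := by
  have h1 := Inh.app (.piForm (hA.weaken hA) (.isPropBody hA)) (by simpa [isProp] using h) ha
  have hc := (Der.isPropBody hA).substWF
    (((SubstWF.id ha.ctx_ok).scons (A := A) (by simpa using ha)).lift (A := A.subst shift)
      (by simpa using hA)) (.ctxCons (by simpa using hA))
  have h2 := Inh.app (A := A) (by simpa using hc) (by simpa using h1) hb
  simpa using h2

theorem Inh.isProp_one (hΓ : Der cl Γ ok) : Inh cl Γ (isProp One) := by
  have h1 : Der cl Γ (ty One) := .oneForm hΓ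
  have h2 : Der cl (One :: Γ) (ty One) := .oneForm (.ctxCons h1)
  refine Inh.isProp_intro ?_
  -- By induction on the unit type every element equals `star`; two elements are then compared
  -- through it.
  have key {Γ} {a b : Expr} (ha : Der cl Γ (tm a One)) (hb : Der cl Γ (tm b One)) :
      Inh cl Γ (Id One a b) := by
    have hO : Der cl Γ (ty One) := .oneForm ha.ctx_ok
    have hs : Der cl Γ (tm star One) := .star ha.ctx_ok
    have h {c : Expr} (hc : Der cl Γ (tm c One)) : Inh cl Γ (Id One star c) := by
      have := Der.indOne (C := Id One star (.var 0)) (c := refl star) (t := c)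
        (by simpa using Der.pathForm hO hs) (by simpa using Der.refl hs) hc
      exact ⟨_, by simpa using this⟩
    exact ((h ha).id_symm hO hs ha).id_trans hO ha hs hb (h hb)
  simpa using key (by simpa using Der.var_one h2) (by simpa using Der.var_zero h2)

theorem Inh.isProp_zero (hΓ : Der cl Γ ok) : Inh cl Γ (isProp Zero) := by
  have h2 : Der cl (Zero :: Γ) (ty Zero) := .zeroForm (.ctxCons (.zeroForm hΓ))
  refine Inh.isProp_intro (Inh.exfalso ?_ ⟨.var 0, by simpa using Der.var_zero h2⟩)
  exact .isPropBody (.zeroForm hΓ)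

theorem Inh.isProp_tr (hA : Der cl Γ (ty A)) : Inh cl Γ (isProp (Tr A)) := by
  have hT := Der.trForm hA
  have h2 := hT.weaken hT
  exact .isProp_intro ⟨_, .squash (by simpa using Der.var_one h2) (by simpa using Der.var_zero h2)⟩

/-- One component is changed at a time, with the pair of `a'` and `b` in between. -/
theorem Inh.id_pair (hA : Der cl Γ (ty A)) (hB : Der cl Γ (ty B)) (ha : Der cl Γ (tm a A))
    (ha' : Der cl Γ (tm a' A)) (hb : Der cl Γ (tm b B)) (hb' : Der cl Γ (tm b' B))
    (h : Inh cl Γ (Id A a a')) (h' : Inh cl Γ (Id B b b')) :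
    Inh cl Γ (Id (prod A B) (.pair a b) (.pair a' b')) := by
  have hP := Der.prodForm hA hB
  have pr {Γ} {A B a b : Expr} (hA : Der cl Γ (ty A)) (hB : Der cl Γ (ty B))
      (ha : Der cl Γ (tm a A)) (hb : Der cl Γ (tm b B)) :
      Der cl Γ (tm (.pair a b) (Expr.prod A B)) :=
    Der.pair (by simpa using hB.weaken hA) ha (by simpa using hb)
  have h1 := h.id_map (f := .pair (.var 0) (b.subst shift)) hA hP
    (by simpa using pr (hA.weaken hA) (hB.weaken hA) (.var_zero hA) (hb.weaken hA)) ha ha'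
  have h2 := h'.id_map (f := .pair (a'.subst shift) (.var 0)) hB hP
    (by simpa using pr (hA.weaken hB) (hB.weaken hB) (ha'.weaken hB) (.var_zero hB)) hb hb'
  exact Inh.id_trans hP (pr hA hB ha hb) (pr hA hB ha' hb) (pr hA hB ha' hb')
    (by simpa using h1) (by simpa using h2)

/-- Σ-induction on each of the two elements reduces the claim to pairs, whose components are equal
because both factors are propositions. -/
theorem Inh.id_prod (hA : Der cl Γ (ty A)) (hB : Der cl Γ (ty B)) (pA : Inh cl Γ (isProp A))
    (pB : Inh cl Γ (isProp B)) (hp : Der cl Γ (tm a (prod A B)))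
    (hq : Der cl Γ (tm b (prod A B))) : Inh cl Γ (Id (prod A B) a b) := by
  have pr {Γ} {A B a b : Expr} (hA : Der cl Γ (ty A)) (hB : Der cl Γ (ty B))
      (ha : Der cl Γ (tm a A)) (hb : Der cl Γ (tm b B)) :
      Der cl Γ (tm (.pair a b) (Expr.prod A B)) :=
    Der.pair (by simpa using hB.weaken hA) ha (by simpa using hb)
  have ind {Γ} {A B C p : Expr} (hA : Der cl Γ (ty A)) (hB : Der cl Γ (ty B))
      (hC : Der cl (Expr.prod A B :: Γ) (ty C))
      (h : Inh cl (B.subst shift :: A :: Γ)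
        (C.subst (scons (.pair (.var 1) (.var 0)) (comp shift shift))))
      (hp : Der cl Γ (tm p (Expr.prod A B))) : Inh cl Γ (C.subst (scons p .var)) := by
    simp only [Expr.prod, wk_eq] at hC hp
    exact Inh.sg_ind hC h hp
  have hP := Der.prodForm hA hB
  have key := ind (C := Id ((prod A B).subst shift) (.var 0) (b.subst shift)) hA hB
    (.idForm (hP.weaken hP) (.var_zero hP) (hq.weaken hP)) ?_ hp
  · simpa using key
  have hB1 := hB.weaken hA
  have hA2 := (hA.weaken hA).weaken hB1
  have hB2 := hB1.weaken hB1
  have hP2 := (hP.weaken hA).weaken hB1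
  have hq2 := (hq.weaken hA).weaken hB1
  have pA2 := (pA.weaken hA).weaken hB1
  have pB2 := (pB.weaken hA).weaken hB1
  simp only [Jdg.subst, subst_subst, Expr.subst_prod, Expr.subst_isProp] at hA2 hB2 hP2 hq2 pA2 pB2
  have h1 := Der.var_one hB1
  have h0 := Der.var_zero hB1
  simp only [subst_subst] at h0
  have hpr := pr hA2 hB2 h1 h0
  have key := ind (C := Id ((prod A B).subst (comp shift (comp shift shift)))
      ((Expr.pair (.var 1) (.var 0)).subst shift) (.var 0)) hA2 hB2
    (by simpa using Der.idForm (hP2.weaken hP2) (hpr.weaken hP2) (.var_zero hP2)) ?_ hq2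
  · simpa using key
  have hB3 := hB2.weaken hA2
  have hA4 := (hA2.weaken hA2).weaken hB3
  have hB4 := (hB2.weaken hA2).weaken hB3
  have pA4 := (pA2.weaken hA2).weaken hB3
  have pB4 := (pB2.weaken hA2).weaken hB3
  have h3 := (h1.weaken hA2).weaken hB3
  have h2 := (h0.weaken hA2).weaken hB3
  have h1' := Der.var_one hB3
  have h0' := Der.var_zero hB3
  simp only [Jdg.subst, subst_subst, Expr.subst_isProp] at hA4 hB4 pA4 pB4 h3 h2 h1' h0'
  -- After both inductions the first pair consists of the variables 3 and 2, the second of 1 and 0.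
  simpa using Inh.id_pair hA4 hB4 h3 h1' h2 h0' (pA4.isProp_elim hA4 h3 h1')
    (pB4.isProp_elim hB4 h2 h0')

theorem Inh.isProp_prod (hA : Der cl Γ (ty A)) (hB : Der cl Γ (ty B)) (pA : Inh cl Γ (isProp A))
    (pB : Inh cl Γ (isProp B)) : Inh cl Γ (isProp (prod A B)) := by
  have hP := Der.prodForm hA hB
  have hP1 := hP.weaken hP
  refine .isProp_intro ?_
  have := Inh.id_prod ((hA.weaken hP).weaken hP1) ((hB.weaken hP).weaken hP1)
    (by simpa using (pA.weaken hP).weaken hP1) (by simpa using (pB.weaken hP).weaken hP1)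
    (by simpa using Der.var_one hP1) (by simpa using Der.var_zero hP1)
  simpa using this

/-! ### Function extensionality -/

theorem Der.appArrow (hA : Der cl Γ (ty A)) (hB : Der cl Γ (ty B))
    (hf : Der cl Γ (tm f (arrow A B))) (ha : Der cl Γ (tm a A)) : Der cl Γ (tm (.app f a) B) := by
  have := Der.app (B := B.subst shift) (hB.weaken hA) (by simpa [arrow] using hf) ha
  simpa using this

theorem Der.appVar (hB : Der cl (A :: Γ) (ty B)) (hf : Der cl Γ (tm f (Pi A B))) :
    Der cl (A :: Γ) (tm (.app (f.subst shift) (.var 0)) B) := by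
  have hA := hB.ctx_ok.ty_of_ok_cons
  have := Der.app (hB.weaken_under hA) (by simpa using hf.weaken hA) (.var_zero hA)
  simpa using this

theorem Der.retractionForm (hA : Der cl Γ (ty A)) (hB : Der cl Γ (ty B))
    (hf : Der cl Γ (tm f (arrow A B))) :
    Der cl Γ (ty (Sg (arrow B A) (Pi A.wk
      (Id A.wk.wk (.app (.var 1) (.app f.wk.wk (.var 0))) (.var 0))))) := by
  have hF := Der.arrowForm hB hA
  have hA1 := hA.weaken hF
  have hB2 := (hB.weaken hF).weaken hA1
  have hA2 := hA1.weaken hA1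
  have hf2 := (hf.weaken hF).weaken hA1
  have h1 := Der.var_one hA1
  have h0 := Der.var_zero hA1
  simp only [Jdg.subst, subst_subst, subst_arrow] at hA2 hB2 hf2 h1 h0
  simpa using Der.sgForm hF (.piForm hA1 (.idForm hA2
    (.appArrow hB2 hA2 h1 (.appArrow hA2 hB2 hf2 h0)) h0))

theorem Inh.sg_fst (hS : Der cl (A :: Γ) (ty B)) (h : Inh cl Γ (Sg A B)) : Inh cl Γ A :=
  h.elim fun _ h => ⟨_, .fst hS h⟩

theorem Der.sectionBody (hA : Der cl Γ (ty A)) (hB : Der cl Γ (ty B))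
    (hf : Der cl Γ (tm f (arrow A B))) :
    Der cl (arrow B A :: Γ) (ty (Pi B.wk
      (Id B.wk.wk (.app f.wk.wk (.app (.var 1) (.var 0))) (.var 0)))) := by
  have hF := Der.arrowForm hB hA
  have hB1 := hB.weaken hF
  have hA2 := (hA.weaken hF).weaken hB1
  have hB2 := hB1.weaken hB1
  have hf2 := (hf.weaken hF).weaken hB1
  have h1 := Der.var_one hB1
  have h0 := Der.var_zero hB1
  simp only [Jdg.subst, subst_subst, subst_arrow] at hA2 hB2 hf2 h1 h0
  simpa using Der.piForm hB1 (.idForm hB2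
    (.appArrow hA2 hB2 hf2 (.appArrow hB2 hA2 h1 h0)) h0)

/-- The backward map is the first component of the section half of the equivalence data; the
homotopies are discarded. -/
theorem Inh.of_isEquiv (hA : Der cl Γ (ty A)) (hB : Der cl Γ (ty B))
    (hf : Der cl Γ (tm f (arrow A B))) (h : Inh cl Γ (isEquiv A B f)) : Inh cl Γ (arrow B A) :=
  (h.prod_left (.sgForm (.arrowForm hB hA) (.sectionBody hA hB hf))
    (.retractionForm hA hB hf)).sg_fst (.sectionBody hA hB hf)

theorem Der.homotopyForm (hB : Der cl (A :: Γ) (ty B)) (hf : Der cl Γ (tm f (Pi A B)))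
    (hg : Der cl Γ (tm g (Pi A B))) :
    Der cl Γ (ty (Pi A (Id B (.app (f.subst shift) (.var 0)) (.app (g.subst shift) (.var 0))))) :=
  .piForm hB.ctx_ok.ty_of_ok_cons (.idForm hB (.appVar hB hf) (.appVar hB hg))

/-- The function extensionality axiom only says that this map is an equivalence. To extract an
inverse with `Inh.of_isEquiv`, the map itself has to be typed. -/
theorem Der.happly (hB : Der cl (A :: Γ) (ty B)) (hf : Der cl Γ (tm f (Pi A B)))
    (hg : Der cl Γ (tm g (Pi A B))) :
    Der cl Γ (tm (happly A B f g) (arrow (Id (Pi A B) f g)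
      (Pi A (Id B (.app (f.subst shift) (.var 0)) (.app (g.subst shift) (.var 0)))))) := by
  have hA := hB.ctx_ok.ty_of_ok_cons
  have hP := Der.piForm hA hB
  have hI := Der.idForm hP hf hg
  have hP1 := hP.weaken hI
  have hf1 := hf.weaken hI
  have hg1 := hg.weaken hI
  have hB1 := hB.weaken_under hI
  have hP2 := hP1.weaken hP1
  have hB2 := hB1.weaken_under hP1
  have hf2 := hf1.weaken hP1
  have hI2 := Der.pathForm hP1 hf1
  have hB3 := hB2.weaken_under hI2
  have hf3 := hf2.weaken hI2
  have hg3 := (Der.var_zero hP1).weaken hI2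
  simp only [Jdg.subst, Expr.subst, liftS_eq, subst_subst, comp_scons, comp_shift_scons,
    scons_zero, comp_assoc, shift_apply] at *
  have hC := Der.homotopyForm hB3 hf3 hg3
  have hd := Der.lam hB1.ctx_ok.ty_of_ok_cons (Der.refl (Der.appVar hB1 hf1))
  have := Der.indId hf1 (by simpa using hC) (by simpa using hd) hg1 (by simpa using Der.var_zero hI)
  have := Der.lam hI this
  simpa [arrow, Expr.happly, rename_liftR_add_three] using this

theorem Inh.funext (hB : Der cl (A :: Γ) (ty B)) (hf : Der cl Γ (tm f (Pi A B)))
    (hg : Der cl Γ (tm g (Pi A B)))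
    (h : Inh cl (A :: Γ) (Id B (.app (f.subst shift) (.var 0)) (.app (g.subst shift) (.var 0)))) :
    Inh cl Γ (Id (Pi A B) f g) := by
  have hH := Der.homotopyForm hB hf hg
  have hI := Der.idForm (.piForm hB.ctx_ok.ty_of_ok_cons hB) hf hg
  have := Inh.of_isEquiv hI hH (.happly hB hf hg)
    ⟨_, by simpa [funextTy] using Der.funext hB hf hg⟩
  exact this.arrow_elim hI hH h.lam

/-- Two functions agree pointwise because the fibres are propositions, hence are equal by function
extensionality. -/
theorem Inh.isProp_pi (hB : Der cl (A :: Γ) (ty B)) (pB : Inh cl (A :: Γ) (isProp B)) :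
    Inh cl Γ (isProp (Pi A B)) := by
  have hA := hB.ctx_ok.ty_of_ok_cons
  have hP := Der.piForm hA hB
  have hP1 := hP.weaken hP
  have hA2 := (hA.weaken hP).weaken hP1
  have hB2 := (hB.weaken_under hP).weaken_under hP1
  have pB2 := (pB.substWF (SubstWF.lift (.shift hP) (hA.weaken hP))
    (.ctxCons (hA.weaken hP))).substWF (SubstWF.lift (.shift hP1) hA2) (.ctxCons hA2)
  refine .isProp_intro ?_
  have h1 := Der.var_one hP1
  have h0 := Der.var_zero hP1
  simp only [Jdg.subst, Expr.subst, liftS_eq, subst_subst, comp_scons, comp_shift_scons,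
    scons_zero, comp_assoc, Expr.subst_isProp] at *
  have := Inh.funext hB2 h1 h0 (pB2.isProp_elim hB2 (.appVar hB2 h1) (.appVar hB2 h0))
  simpa using this

theorem Inh.isProp_arrow (hA : Der cl Γ (ty A)) (hB : Der cl Γ (ty B))
    (pB : Inh cl Γ (isProp B)) : Inh cl Γ (isProp (arrow A B)) := by
  simpa [arrow] using Inh.isProp_pi (B := B.subst shift) (hB.weaken hA)
    (by simpa using pB.weaken hA)

end HoTT

namespace HoTT

open HoTT.Expr HoTT.Jdg

variable {cl : Bool} {Γ Δ : List Expr} {A A' B C a b c : Expr} {J : Jdg} {s : ℕ → Expr} {n : ℕ}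

theorem Jdg.subst_var (J : Jdg) : J.subst .var = J := by
  cases J <;> simp

/-- The identity substitution is a context morphism between the two contexts, its last variable
being typed by conversion. -/
theorem Der.convCtx (h : Der cl (A :: Γ) J) (hA' : Der cl Γ (ty A')) (hA : Der cl Γ (tyEq A' A)) :
    Der cl (A' :: Γ) J := by
  have hv : SubstWF cl (A' :: Γ) .var (A :: Γ) := by
    rw [← scons_var_shift]
    exact (SubstWF.shift hA').scons ((Der.var_zero hA').conv (hA.weaken hA'))
  exact J.subst_var ▸ h.substWF hv (.ctxCons hA')

theorem Der.isPropCong (hA : Der cl Γ (ty A)) (h : Der cl Γ (tyEq A B)) :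
    Der cl Γ (tyEq (isProp A) (isProp B)) := by
  have hA1 := hA.weaken hA
  have h2 := (h.weaken hA).weaken hA1
  have h1 := h.weaken hA
  simp only [Jdg.subst, subst_subst] at h2
  simpa [isProp] using Der.piCong h (.piCong h1
    (.idCong h2 (.tmRefl (.var_one hA1)) (.tmRefl (by simpa using Der.var_zero hA1))))

@[simp]
theorem Expr.subst_trans (P a b p t : Expr) (s : ℕ → Expr) :
    (Expr.trans P a b p t).subst s = Expr.trans (P.subst (scons (var 0) (comp s shift)))
      (a.subst s) (b.subst s) (p.subst s) (t.subst s) := by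
  simp [Expr.trans]

/-! ### Small types -/

/-- The type `A` has a code in the universe. -/
def IsSmall (cl : Bool) (Γ : List Expr) (A : Expr) : Prop :=
  ∃ c, Der cl Γ (tm c U) ∧ Der cl Γ (tyEq (El c) A)

theorem IsSmall.el (h : Der cl Γ (tm c U)) : IsSmall cl Γ (El c) := ⟨c, h, .tyRefl (.elForm h)⟩

theorem IsSmall.one (hΓ : Der cl Γ ok) : IsSmall cl Γ One := ⟨_, .cOne hΓ, .elOne hΓ⟩

theorem IsSmall.zero (hΓ : Der cl Γ ok) : IsSmall cl Γ Zero := ⟨_, .cZero hΓ, .elZero hΓ⟩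

theorem IsSmall.id (h : IsSmall cl Γ A) (ha : Der cl Γ (tm a A)) (hb : Der cl Γ (tm b A)) :
    IsSmall cl Γ (Id A a b) := by
  obtain ⟨c, hc, h⟩ := h
  have ha' := ha.conv h.tySymm
  have hb' := hb.conv h.tySymm
  exact ⟨_, .cId hc ha' hb', .tyTrans (.elId hc ha' hb') (.idCong h (.tmRefl ha') (.tmRefl hb'))⟩

theorem IsSmall.pi (hA : IsSmall cl Γ A) (hB : IsSmall cl (A :: Γ) B) : IsSmall cl Γ (Pi A B) := by
  obtain ⟨c, hc, h⟩ := hA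
  obtain ⟨d, hd, h'⟩ := hB
  -- The rule for codes wants the code of `B` over `El c` rather than over `A`.
  have hd := hd.convCtx (.elForm hc) h
  exact ⟨_, .cPi hc hd, .tyTrans (.elPi hc hd) (.piCong h (h'.convCtx (.elForm hc) h))⟩

theorem IsSmall.sg (hA : IsSmall cl Γ A) (hB : IsSmall cl (A :: Γ) B) : IsSmall cl Γ (Sg A B) := by
  obtain ⟨c, hc, h⟩ := hA
  obtain ⟨d, hd, h'⟩ := hB
  have hd := hd.convCtx (.elForm hc) h
  exact ⟨_, .cSg hc hd, .tyTrans (.elSg hc hd) (.sgCong h (h'.convCtx (.elForm hc) h))⟩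

theorem IsSmall.weaken (hB : IsSmall cl Γ B) (hA : Der cl Γ (ty A)) :
    IsSmall cl (A :: Γ) (B.subst shift) := by
  obtain ⟨c, hc, h⟩ := hB
  exact ⟨_, hc.weaken hA, h.weaken hA⟩

theorem IsSmall.arrow (hA : Der cl Γ (ty A)) (sA : IsSmall cl Γ A) (sB : IsSmall cl Γ B) :
    IsSmall cl Γ (arrow A B) := by
  simpa [Expr.arrow] using sA.pi (sB.weaken hA)

theorem IsSmall.prod (hA : Der cl Γ (ty A)) (sA : IsSmall cl Γ A) (sB : IsSmall cl Γ B) :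
    IsSmall cl Γ (Expr.prod A B) := by
  simpa [Expr.prod] using sA.sg (sB.weaken hA)

theorem IsSmall.sum (sA : IsSmall cl Γ A) (sB : IsSmall cl Γ B) : IsSmall cl Γ (Sum A B) := by
  obtain ⟨c, hc, h⟩ := sA
  obtain ⟨d, hd, h'⟩ := sB
  exact ⟨_, .cSum hc hd, .tyTrans (.elSum hc hd) (.sumCong h h')⟩

theorem IsSmall.tr (sA : IsSmall cl Γ A) : IsSmall cl Γ (Tr A) := by
  obtain ⟨c, hc, h⟩ := sA
  exact ⟨_, .cTr hc, .tyTrans (.elTr hc) (.trCong h)⟩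

/-! ### Excluded middle -/

/-- The axiom is applied to a code of `A`, and the result is converted along the equality of `A`
with the decoded code. -/
theorem Inh.lem (hcl : cl = true) (hA : Der cl Γ (ty A)) (sA : IsSmall cl Γ A)
    (pA : Inh cl Γ (isProp A)) : Inh cl Γ (Sum A (arrow A Zero)) := by
  obtain ⟨c, hc, h⟩ := sA
  have hΓ := hA.ctx_ok
  have hU : Der cl Γ (ty U) := .uForm hΓ
  have h0 : Der cl (U :: Γ) (tm (.var 0) U) := by simpa using Der.var_zero hU
  have hp := Der.isPropForm (Der.elForm h0)
  have h1 : Der cl (isProp (El (.var 0)) :: U :: Γ) (tm (.var 1) U) := by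
    simpa using Der.var_one hp
  have hS : Der cl (isProp (El (.var 0)) :: U :: Γ)
      (ty (Sum (El (.var 1)) (arrow (El (.var 1)) Zero))) :=
    .sumForm (.elForm h1) (.arrowForm (.elForm h1) (.zeroForm h1.ctx_ok))
  have hE := Der.elForm hc
  have hL := Inh.app (.piForm hp hS) ⟨_, by simpa [lemTy] using Der.lem hcl hΓ⟩ hc
  have pE : Inh cl Γ (isProp (El c)) := pA.conv (.isPropCong hA h.tySymm)
  have hSc : Der cl Γ (ty (Sum (El c) (arrow (El c) Zero))) :=
    .sumForm hE (.arrowForm hE (.zeroForm hΓ))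
  have hL := Inh.arrow_elim hSc (by simpa [arrow] using hL) (.isPropForm hE) pE
  refine hL.conv (.sumCong h ?_)
  simpa [arrow] using Der.piCong h (.tyRefl (.zeroForm (.ctxCons hE)))

/-! ### `h`-levels -/

@[simp]
theorem Expr.subst_isOfHLevel (n : ℕ) (A : Expr) (s : ℕ → Expr) :
    (isOfHLevel n A).subst s = isOfHLevel n (A.subst s) := by
  induction n generalizing A s with
  | zero => simp [isOfHLevel, isContr]
  | succ n ih => simp [isOfHLevel, ih]

theorem Der.isOfHLevelForm (hA : Der cl Γ (ty A)) : Der cl Γ (ty (isOfHLevel n A)) := by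
  induction n generalizing A Γ with
  | zero =>
    simpa [isOfHLevel, isContr] using Der.sgForm hA (.piForm (hA.weaken hA) (.isPropBody hA))
  | succ n ih =>
    simpa [isOfHLevel] using Der.piForm hA (.piForm (hA.weaken hA) (ih (.isPropBody hA)))

end HoTT

/-! ### Substitution in the auxiliary expressions of the semantics -/

namespace FOLIso

open HoTT HoTT.Expr HoTT.Jdg

variable {cl : Bool} {Γ : List Expr} {c : Expr}

@[simp]
theorem subst_typesOfHLevel (m : ℕ∞) (s : ℕ → Expr) :
    (typesOfHLevel m).subst s = typesOfHLevel m := by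
  unfold typesOfHLevel
  split <;> simp

theorem typesOfHLevel_form (m : ℕ∞) (hΓ : Der cl Γ ok) : Der cl Γ (ty (typesOfHLevel m)) := by
  have hU : Der cl Γ (ty U) := .uForm hΓ
  unfold typesOfHLevel
  split
  · exact hU
  · exact .sgForm hU (.isOfHLevelForm (.elForm (by simpa using Der.var_zero hU)))

@[simp]
theorem subst_underlying (m : ℕ∞) (c : Expr) (s : ℕ → Expr) :
    (underlying m c).subst s = underlying m (c.subst s) := by
  unfold underlying
  split <;> simp

theorem underlying_small {m : ℕ∞} (hc : Der cl Γ (tm c (typesOfHLevel m))) :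
    IsSmall cl Γ (underlying m c) ∧ Der cl Γ (ty (underlying m c)) := by
  have hU : Der cl Γ (ty U) := .uForm hc.ctx_ok
  unfold typesOfHLevel at hc
  unfold underlying
  split_ifs at hc ⊢
  · exact ⟨.el hc, .elForm hc⟩
  · have := Der.fst (.isOfHLevelForm (.elForm (by simpa using Der.var_zero hU))) hc
    exact ⟨.el this, .elForm this⟩

theorem foldl_app_subst (l : List Expr) (c : Expr) (s : ℕ → Expr) :
    (l.foldl app c).subst s = (l.map (Expr.subst s)).foldl app (c.subst s) := by
  induction l generalizing c with
  | nil => rfl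
  | cons a l ih => simp [ih]

@[simp]
theorem subst_apps (c : Expr) (l : List Expr) (s : ℕ → Expr) :
    (apps c l).subst s = apps (c.subst s) (l.map (Expr.subst s)) := by
  cases l <;> simp [apps, foldl_app_subst]

@[simp]
theorem setAt_self {ι : Type} (a : ι → Expr) (i : ι) (t : Expr) : setAt a i t i = t := by
  simp [setAt]

theorem setAt_of_ne {ι : Type} (a : ι → Expr) {i j : ι} (t : Expr) (h : j ≠ i) :
    setAt a i t j = a j := by
  simp [setAt, h]

theorem subst_setAt {ι : Type} (a : ι → Expr) (i : ι) (t : Expr) (s : ℕ → Expr) :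
    (fun j => (setAt a i t j).subst s) = setAt (fun j => (a j).subst s) i (t.subst s) := by
  funext j
  by_cases h : j = i
  · subst h; simp
  · simp [setAt_of_ne _ _ h]

end FOLIso

namespace FOLIso

/-! ### Arrows of a signature -/

section

variable {L : Signature} {K A : L.Obj}

theorem NHom.andThen_andThen (f : NHom K A) (p : Arr A) (q : Arr p.cod) :
    NHom.andThen (L := L) (f.andThen p).arr q = f.andThen (NHom.andThen (L := L) p.arr q) := by
  simp [NHom.andThen, NHom.comp]

theorem NHom.andThen_congr {I : L.Obj} {f : NHom K A} {g : NHom K I} {p : Arr A} {q : NHom I p.cod}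
    (h : f.hom ≫ p.arr.hom = g.hom ≫ q.hom) : f.andThen p = g.andThen ⟨p.cod, q⟩ := by
  simp [NHom.andThen, NHom.comp, h]

theorem NHom.andThen_ne (f : NHom K A) (p : Arr A) : f.andThen p ≠ f.toArr := fun h => by
  have hc : p.cod = A := congrArg Arr.cod h
  exact p.arr.ne hc

/-- A composite through `g` has a smaller codomain than `g`, so it cannot be listed after `g`.
Initial segments of the enumeration are thus closed under composition, which makes the list of
arguments a telescope. -/
theorem Signature.andThen_mem_of_arrows_eq {P fs : List (Arr K)} (hl : L.arrows K = P ++ fs)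
    {g : Arr K} (hg : g ∈ P) (p : Arr g.cod) : NHom.andThen (L := L) g.arr p ∈ P := by
  have hm := L.mem_arrows (NHom.andThen (L := L) g.arr p)
  rw [hl, List.mem_append] at hm
  refine hm.resolve_right fun hm => ?_
  have ho := L.arrows_ordered K
  rw [hl, List.pairwise_append] at ho
  exact ho.2.2 g hg _ hm (L.lt_of_arr p.arr)

theorem Signature.andThen_head_mem_of_arrows_eq {P fs : List (Arr K)} {f : Arr K}
    (hl : L.arrows K = P ++ f :: fs) (p : Arr f.cod) : NHom.andThen (L := L) f.arr p ∈ P := by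
  have := L.andThen_mem_of_arrows_eq (P := P ++ [f]) (fs := fs) (by simp [hl]) (g := f) (by simp) p
  simp only [List.mem_append, List.mem_singleton] at this
  exact this.resolve_right (NHom.andThen_ne f.arr p)

theorem Signature.head_notMem_of_arrows_eq {P fs : List (Arr K)} {f : Arr K}
    (hl : L.arrows K = P ++ f :: fs) : f ∉ P := fun hf => by
  have := L.arrows_nodup K
  rw [hl, List.nodup_append] at this
  exact this.2.2 f hf f (by simp) rfl

end

namespace HSignature

open HoTT HoTT.Expr HoTT.Jdg

variable {L : HSignature} {cl : Bool} {E Δ : List Expr} {N N' : L.Obj → Expr} {K A B I : L.Obj}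

/-! ### Interpretation of sorts -/

theorem interpSort_nonlogical (hk : L.kind K = .nonlogical) (N : L.Obj → Expr)
    (a : Arr K → Expr) :
    L.interpSort N K a = underlying (L.h K) (apps (N K) ((L.arrows K).map a)) := by
  rw [interpSort, hk]

theorem interpSort_iso {s t : NHom K A} (hk : L.kind K = .iso A s t) (N : L.Obj → Expr)
    (a : Arr K → Expr) :
    L.interpSort N K a = Id (L.interpSort N A fun p => a (NHom.andThen (L := L.toSignature) s p))
      (a (NHom.toArr (L := L.toSignature) s)) (a (NHom.toArr (L := L.toSignature) t)) := by
  rw [interpSort, hk]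

/-- The inner identity type in the clause for `ρ` is the interpretation of the isomorphism sort `I`,
so that facts known for `I` apply to it. -/
theorem interpSort_refl {s t : NHom I A} {r : NHom K I} (hk : L.kind K = .refl A I s t r)
    (N : L.Obj → Expr) (a : Arr K → Expr) :
    L.interpSort N K a =
      Id (L.interpSort N I fun p => a (NHom.andThen (L := L.toSignature) r p))
        (a (NHom.toArr (L := L.toSignature) r))
        (.refl (a (NHom.andThen (L := L.toSignature) r ⟨A, s⟩))) := by
  rw [interpSort, hk, interpSort_iso (L.refl_spec hk).1]
  rfl

theorem interpSort_transp {f : NHom A B} {s t : NHom I B} {e : NHom K I} {f₁ f₂ : NHom K A}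
    (hk : L.kind K = .transp A B I f s t e f₁ f₂) (N : L.Obj → Expr) (a : Arr K → Expr) :
    L.interpSort N K a =
      Id (L.interpSort N A fun p => a (NHom.andThen (L := L.toSignature) f₂ p))
        (a (NHom.toArr (L := L.toSignature) f₂))
        (Expr.trans (L.interpSort (fun C => (N C).subst shift) A
            (setAt (fun p => (a (NHom.andThen (L := L.toSignature) f₁ p)).subst shift)
              ⟨B, f⟩ (var 0)))
          (a (NHom.andThen (L := L.toSignature) f₁ ⟨B, f⟩))
          (a (NHom.andThen (L := L.toSignature) f₂ ⟨B, f⟩))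
          (a (NHom.toArr (L := L.toSignature) e)) (a (NHom.toArr (L := L.toSignature) f₁))) := by
  rw [interpSort, hk]
  simp only [wk_eq]

theorem induction_rank {P : L.Obj → Prop} (h : ∀ K, (∀ A, Nonempty (NHom K A) → P A) → P K)
    (K : L.Obj) : P K :=
  (measure L.rank).wf.induction K fun K ih => h K fun _ ⟨f⟩ => ih _ (L.rank_lt f)

@[simp]
theorem subst_interpSort (N : L.Obj → Expr) (K : L.Obj) (a : Arr K → Expr) (s : ℕ → Expr) :
    (L.interpSort N K a).subst s =
      L.interpSort (fun A => (N A).subst s) K fun f => (a f).subst s := by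
  induction K using induction_rank generalizing N s with
  | h K ih =>
    cases hk : L.kind K with
    | nonlogical => simp [interpSort_nonlogical hk, Function.comp_def]
    | iso A s t => simp [interpSort_iso hk, ih A ⟨s⟩]
    | refl A I s t r => simp [interpSort_refl hk, ih I ⟨r⟩]
    | transp A B I f s t e f₁ f₂ =>
      simp [interpSort_transp hk, ih A ⟨f₁⟩, subst_setAt]

/-- Only `K` and the sorts below it enter. This is why interpreting a further sort does not disturb
the types assigned to the earlier ones. -/
theorem interpSort_congr (h : ∀ A, A = K ∨ Nonempty (NHom K A) → N A = N' A)
    (a : Arr K → Expr) : L.interpSort N K a = L.interpSort N' K a := by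
  induction K using induction_rank generalizing N N' with
  | h K ih =>
    have hb {A} (f : NHom K A) : ∀ C, C = A ∨ Nonempty (NHom A C) → N C = N' C := by
      rintro C (rfl | ⟨⟨g⟩⟩)
      · exact h _ (.inr ⟨f⟩)
      · exact h _ (.inr ⟨NHom.comp (L := L.toSignature) f g⟩)
    cases hk : L.kind K with
    | nonlogical => simp [interpSort_nonlogical hk, h K (.inl rfl)]
    | iso A s t => simp only [interpSort_iso hk, ih A ⟨s⟩ (hb s)]
    | refl A I s t r => simp only [interpSort_refl hk, ih I ⟨r⟩ (hb r)]
    | transp A B I f s t e f₁ f₂ =>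
      simp only [interpSort_transp hk, ih A ⟨f₁⟩ (hb f₁)]
      rw [ih A ⟨f₁⟩ (N := fun C => (N C).subst shift) (N' := fun C => (N' C).subst shift)
        fun C hC => by rw [hb f₁ C hC]]

@[simp]
theorem subst_sortTyAux (N : L.Obj → Expr) (a : Arr K → Expr) (fs : List (Arr K)) (s : ℕ → Expr) :
    (L.sortTyAux K N a fs).subst s =
      L.sortTyAux K (fun A => (N A).subst s) (fun f => (a f).subst s) fs := by
  induction fs generalizing N a s with
  | nil => simp [sortTyAux]
  | cons f fs ih => simp [sortTyAux, ih, subst_setAt]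

theorem sortTyAux_congr (h : ∀ A, Nonempty (NHom K A) → N A = N' A) (a : Arr K → Expr)
    (fs : List (Arr K)) : L.sortTyAux K N a fs = L.sortTyAux K N' a fs := by
  induction fs generalizing N N' a with
  | nil => simp [sortTyAux]
  | cons f fs ih =>
    simp only [sortTyAux]
    rw [ih (N := fun C => (N C).wk) (N' := fun C => (N' C).wk) fun C hC => by rw [h C hC],
      interpSort_congr (N := N) (N' := N')]
    rintro A (rfl | ⟨⟨g⟩⟩)
    · exact h _ ⟨f.arr⟩
    · exact h _ ⟨NHom.comp (L := L.toSignature) f.arr g⟩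

@[simp]
theorem subst_sortTy (N : L.Obj → Expr) (K : L.Obj) (s : ℕ → Expr) :
    (L.sortTy N K).subst s = L.sortTy (fun A => (N A).subst s) K := by
  unfold sortTy
  split <;> simp

theorem sortTy_congr (h : ∀ A, Nonempty (NHom K A) → N A = N' A) :
    L.sortTy N K = L.sortTy N' K := by
  unfold sortTy
  split
  · rfl
  · exact sortTyAux_congr h _ _

/-- The terms `a f` have the types required of arguments of the sort `K`. -/
def ArgsWF (L : HSignature) (cl : Bool) (E : List Expr) (N : L.Obj → Expr) (K : L.Obj)
    (a : Arr K → Expr) : Prop :=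
  ∀ f : Arr K, Der cl E (tm (a f)
    (L.interpSort N f.cod fun p => a (NHom.andThen (L := L.toSignature) f.arr p)))

/-- The terms `N A` interpret the non-logical sorts `A` in the set `S`. -/
def InterpWF (L : HSignature) (cl : Bool) (E : List Expr) (N : L.Obj → Expr) (S : Set L.Obj) :
    Prop :=
  ∀ A ∈ S, L.kind A = .nonlogical → Der cl E (tm (N A) (L.sortTy N A))

/-- The sorts strictly below `K`. -/
def below (L : HSignature) (K : L.Obj) : Set L.Obj := {A | Nonempty (NHom K A)}

theorem below_subset (f : NHom K A) : insert A (L.below A) ⊆ L.below K := by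
  rintro C (rfl | ⟨⟨g⟩⟩)
  · exact ⟨f⟩
  · exact ⟨NHom.comp (L := L.toSignature) f g⟩

theorem InterpWF.mono {S S' : Set L.Obj} (h : L.InterpWF cl E N S) (hS : S' ⊆ S) :
    L.InterpWF cl E N S' := fun A hA => h A (hS hA)

theorem InterpWF.substWF {S : Set L.Obj} {s : ℕ → Expr} (h : L.InterpWF cl E N S)
    (hs : SubstWF cl Δ s E) (hΔ : Der cl Δ ok) :
    L.InterpWF cl Δ (fun A => (N A).subst s) S := fun A hA hk => by
  simpa using (h A hA hk).substWF hs hΔ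

theorem InterpWF.weaken {S : Set L.Obj} {T : Expr} (h : L.InterpWF cl E N S)
    (hT : Der cl E (ty T)) : L.InterpWF cl (T :: E) (fun A => (N A).subst shift) S :=
  h.substWF (.shift hT) (.ctxCons hT)

/-- By associativity of composition, the arguments at composites through `f` have the types that `A`
requires of its own arguments. -/
theorem ArgsWF.face {a : Arr K → Expr} (h : L.ArgsWF cl E N K a) (f : NHom K A) :
    L.ArgsWF cl E N A fun p => a (NHom.andThen (L := L.toSignature) f p) := fun p =>
  (congrArg (fun b => Der cl E (tm _ (L.interpSort N p.cod b))) (funext fun q =>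
    congrArg a (NHom.andThen_andThen f p q))).mp (h (NHom.andThen (L := L.toSignature) f p))

/-- Well-typed arguments of the sort `K` yield a type, which has a code in the universe. -/
def SortFormWF (L : HSignature) (cl : Bool) (K : L.Obj) : Prop :=
  ∀ (E : List Expr) (N : L.Obj → Expr) (a : Arr K → Expr), Der cl E ok →
    L.InterpWF cl E N (insert K (L.below K)) → L.ArgsWF cl E N K a →
    IsSmall cl E (L.interpSort N K a) ∧ Der cl E (ty (L.interpSort N K a))

/-- Here and below, `P` is the initial segment of arrows already bound. The domain of the next
binder mentions only composites through `f`, and these lie in `P`. -/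
theorem sortTyAux_binder (ih : ∀ A ∈ L.below K, L.SortFormWF cl A) {P fs : List (Arr K)}
    {f : Arr K} (hl : L.arrows K = P ++ f :: fs) (hE : Der cl E ok)
    (hN : L.InterpWF cl E N (L.below K)) {a : Arr K → Expr}
    (ha : ∀ g ∈ P, Der cl E (tm (a g)
      (L.interpSort N g.cod fun p => a (NHom.andThen (L := L.toSignature) g.arr p)))) :
    Der cl E (ty (L.interpSort N f.cod fun p =>
      a (NHom.andThen (L := L.toSignature) f.arr p))) := by
  refine (ih f.cod ⟨f.arr⟩ E N _ hE (hN.mono (below_subset f.arr)) fun p => ?_).2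
  exact (congrArg (fun b => Der cl E (tm _ (L.interpSort N p.cod b))) (funext fun q =>
    congrArg a (NHom.andThen_andThen f.arr p q))).mp (ha _ (L.andThen_head_mem_of_arrows_eq hl p))

/-- This is the inductive invariant for passing under one binder. Setting the value at `f` does not
affect the types of the arguments, because `f` is neither in `P` nor a composite through itself. -/
theorem sortTyAux_args {P fs : List (Arr K)} {f : Arr K} (hl : L.arrows K = P ++ f :: fs)
    {a : Arr K → Expr}
    (hf : Der cl E (ty (L.interpSort N f.cod fun p =>
      a (NHom.andThen (L := L.toSignature) f.arr p))))
    (ha : ∀ g ∈ P, Der cl E (tm (a g)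
      (L.interpSort N g.cod fun p => a (NHom.andThen (L := L.toSignature) g.arr p)))) :
    ∀ g ∈ P ++ [f], Der cl
      (L.interpSort N f.cod (fun p => a (NHom.andThen (L := L.toSignature) f.arr p)) :: E)
      (tm (setAt (fun g => (a g).subst shift) f (var 0) g)
        (L.interpSort (fun C => (N C).subst shift) g.cod fun p =>
          setAt (fun g => (a g).subst shift) f (var 0)
            (NHom.andThen (L := L.toSignature) g.arr p))) := by
  intro g hg
  rcases List.mem_append.1 hg with hg | hg
  · have hne (g') (hg' : g' ∈ P) : g' ≠ f :=
      fun h => L.head_notMem_of_arrows_eq hl (h ▸ hg')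
    have := (ha g hg).weaken hf
    simp only [Jdg.subst, subst_interpSort] at this
    rw [setAt_of_ne _ _ (hne g hg)]
    convert this using 3
    funext p
    exact setAt_of_ne _ _ (hne _ (L.andThen_mem_of_arrows_eq hl hg p))
  · obtain rfl := List.mem_singleton.1 hg
    have hfp (p) : setAt (fun h => (a h).subst shift) g (var 0)
        (NHom.andThen (L := L.toSignature) g.arr p) =
        (a (NHom.andThen (L := L.toSignature) g.arr p)).subst shift :=
      setAt_of_ne _ _ (NHom.andThen_ne g.arr p)
    simpa [hfp] using Der.var_zero hf

theorem sortTyAux_form (ih : ∀ A ∈ L.below K, L.SortFormWF cl A) {P fs : List (Arr K)}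
    (hl : L.arrows K = P ++ fs) (hE : Der cl E ok) (hN : L.InterpWF cl E N (L.below K))
    {a : Arr K → Expr}
    (ha : ∀ g ∈ P, Der cl E (tm (a g)
      (L.interpSort N g.cod fun p => a (NHom.andThen (L := L.toSignature) g.arr p)))) :
    Der cl E (ty (L.sortTyAux K N a fs)) := by
  induction fs generalizing P E N a with
  | nil => exact typesOfHLevel_form _ hE
  | cons f fs ihfs =>
    have hf := sortTyAux_binder ih hl hE hN ha
    simp only [sortTyAux, wk_eq]
    exact .piForm hf (ihfs (P := P ++ [f]) (by simp [hl]) (.ctxCons hf) (hN.weaken hf)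
      (sortTyAux_args hl hf ha))

theorem sortTy_form (ih : ∀ A ∈ L.below K, L.SortFormWF cl A) (hE : Der cl E ok)
    (hN : L.InterpWF cl E N (L.below K)) : Der cl E (ty (L.sortTy N K)) := by
  unfold sortTy
  split
  · exact .arrowForm (.oneForm hE) (typesOfHLevel_form _ hE)
  · next h => exact sortTyAux_form (P := []) ih h hE hN (by simp)

/-- Arguments are supplied one by one. The assignment `a₀` records those supplied so far and need
agree with `a` only on `P`, since the remaining Π-type binds the others. -/
theorem foldl_app_form (ih : ∀ A ∈ L.below K, L.SortFormWF cl A) {P fs : List (Arr K)}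
    (hl : L.arrows K = P ++ fs) (hE : Der cl E ok) (hN : L.InterpWF cl E N (L.below K))
    {a a₀ : Arr K → Expr} (ha : L.ArgsWF cl E N K a) (haa : ∀ g ∈ P, a₀ g = a g) {c : Expr}
    (hc : Der cl E (tm c (L.sortTyAux K N a₀ fs))) :
    Der cl E (tm ((fs.map a).foldl app c) (typesOfHLevel (L.h K))) := by
  induction fs generalizing P a₀ c with
  | nil => simpa [sortTyAux] using hc
  | cons f fs ihfs =>
    have ha₀ : ∀ g ∈ P, Der cl E (tm (a₀ g)
        (L.interpSort N g.cod fun p => a₀ (NHom.andThen (L := L.toSignature) g.arr p))) := by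
      intro g hg
      convert ha g using 2
      · exact haa g hg
      · congr 1
        funext p
        exact haa _ (L.andThen_mem_of_arrows_eq hl hg p)
    have hb : (fun p => a₀ (NHom.andThen (L := L.toSignature) f.arr p)) =
        fun p => a (NHom.andThen (L := L.toSignature) f.arr p) :=
      funext fun p => haa _ (L.andThen_head_mem_of_arrows_eq hl p)
    have hne {g} (hg : g ∈ P) : g ≠ f := fun h => L.head_notMem_of_arrows_eq hl (h ▸ hg)
    have hf := sortTyAux_binder ih hl hE hN ha₀
    have hbody := sortTyAux_form (P := P ++ [f]) (fs := fs) ih (by simp [hl]) (.ctxCons hf)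
      (hN.weaken hf) (sortTyAux_args hl hf ha₀)
    simp only [sortTyAux, wk_eq] at hc
    have happ := Der.app hbody hc (by rw [hb]; exact ha f)
    -- Instantiating the bound variable at `f` by `a f` amounts to updating `a₀` there.
    refine ihfs (P := P ++ [f]) (a₀ := setAt a₀ f (a f)) (by simp [hl]) ?_ ?_
    · intro g hg
      rcases List.mem_append.1 hg with hg | hg
      · rw [setAt_of_ne _ _ (hne hg), haa g hg]
      · obtain rfl := List.mem_singleton.1 hg
        simp
    · simpa [subst_setAt] using happ

end HSignature

end FOLIso

/-! ### Transport -/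

namespace HoTT

open HoTT.Expr HoTT.Jdg

variable {cl : Bool} {Γ : List Expr} {A P a b p q t : Expr}

theorem Der.trans (ha : Der cl Γ (tm a A)) (hb : Der cl Γ (tm b A))
    (hp : Der cl Γ (tm p (Id A a b))) (hP : Der cl (A :: Γ) (ty P))
    (ht : Der cl Γ (tm t (P.subst (scons a .var)))) :
    Der cl Γ (tm (Expr.trans P a b p t) (P.subst (scons b .var))) := by
  have hA := hP.ctx_ok.ty_of_ok_cons
  have hC := hP.weaken (.pathForm hA ha)
  have := Der.indId ha (by simpa using hC) (by simpa using ht) hb hp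
  simpa [Expr.trans] using this

theorem Der.trans_refl (ha : Der cl Γ (tm a A)) (hP : Der cl (A :: Γ) (ty P))
    (ht : Der cl Γ (tm t (P.subst (scons a .var)))) :
    Der cl Γ (tmEq (Expr.trans P a a (.refl a) t) t (P.subst (scons a .var))) := by
  have hA := hP.ctx_ok.ty_of_ok_cons
  have hC := hP.weaken (.pathForm hA ha)
  have := Der.idBeta ha (by simpa using hC) (d := t) (by simpa using ht)
  simpa [Expr.trans] using this

/-- Transport along a loop that is equal to reflexivity is the identity. -/
theorem Inh.id_trans_of_refl (ha : Der cl Γ (tm a A)) (hP : Der cl (A :: Γ) (ty P))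
    (ht : Der cl Γ (tm t (P.subst (scons a .var)))) (hq : Der cl Γ (tm q (Id A a a)))
    (h : Inh cl Γ (Id (Id A a a) q (.refl a))) :
    Inh cl Γ (Id (P.subst (scons a .var)) t (Expr.trans P a a q t)) := by
  have hA := hP.ctx_ok.ty_of_ok_cons
  have hI := Der.idForm hA ha ha
  have hPa : Der cl Γ (ty (P.subst (scons a .var))) := hP.instantiate ha
  have hr := Der.refl ha
  have hP1 := hP.weaken_under hI
  have ht1 := ht.weaken hI
  have htr := Der.trans (ha.weaken hI) (ha.weaken hI) (by simpa using Der.var_zero hI) hP1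
    (by simpa using ht1)
  simp only [Jdg.subst, subst_subst] at ht1
  have hC := Der.idForm (by simpa using hPa.weaken hI) ht1 (by simpa using htr)
  have hrefl := (Inh.id_refl ht).conv
    (.idCong (.tyRefl hPa) (.tmRefl ht) (.tmSymm (.trans_refl ha hP ht)))
  -- Path induction does not apply to the loop `q` directly, as both ends are fixed. Instead the
  -- loop varies in the motive, which is transported from reflexivity, where it holds by the
  -- computation rule, to `q`.
  have := (h.id_symm hI hq hr).transport hr hq hC
    (by simpa using hrefl)
  simpa using this

end HoTT

/-! ### Well-formedness of the interpreted sorts -/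

namespace FOLIso

namespace HSignature

open HoTT HoTT.Expr HoTT.Jdg

variable {L : HSignature} {cl : Bool} {E Δ : List Expr} {N N' : L.Obj → Expr} {K A B I : L.Obj}

theorem iso_andThen {s t : NHom K A} (hk : L.kind K = .iso A s t) (p : Arr A) :
    NHom.andThen (L := L.toSignature) s p = NHom.andThen (L := L.toSignature) t p :=
  NHom.andThen_congr (L := L.toSignature) ((L.iso_spec hk).2.2.2.1 p.arr)

theorem refl_andThen {s t : NHom I A} {r : NHom K I} (hk : L.kind K = .refl A I s t r) :
    NHom.andThen (L := L.toSignature) r ⟨A, s⟩ = NHom.andThen (L := L.toSignature) r ⟨A, t⟩ :=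
  NHom.andThen_congr (L := L.toSignature) (L.refl_spec hk).2.2.2.1

theorem transp_andThen_s {f : NHom A B} {s t : NHom I B} {e : NHom K I} {f₁ f₂ : NHom K A}
    (hk : L.kind K = .transp A B I f s t e f₁ f₂) :
    NHom.andThen (L := L.toSignature) e ⟨B, s⟩ =
      NHom.andThen (L := L.toSignature) f₁ ⟨B, f⟩ :=
  NHom.andThen_congr (L := L.toSignature) (L.transp_spec hk).2.2.2.2.2.2.1

theorem transp_andThen_t {f : NHom A B} {s t : NHom I B} {e : NHom K I} {f₁ f₂ : NHom K A}
    (hk : L.kind K = .transp A B I f s t e f₁ f₂) :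
    NHom.andThen (L := L.toSignature) e ⟨B, t⟩ =
      NHom.andThen (L := L.toSignature) f₂ ⟨B, f⟩ :=
  NHom.andThen_congr (L := L.toSignature) (L.transp_spec hk).2.2.2.2.2.2.2.1

theorem transp_andThen {f : NHom A B} {s t : NHom I B} {e : NHom K I} {f₁ f₂ : NHom K A}
    (hk : L.kind K = .transp A B I f s t e f₁ f₂) (g : Arr A) (hg : g ≠ ⟨B, f⟩) :
    NHom.andThen (L := L.toSignature) f₁ g = NHom.andThen (L := L.toSignature) f₂ g :=
  NHom.andThen_congr (L := L.toSignature) ((L.transp_spec hk).2.2.2.2.2.2.2.2.1 g.arr hg)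

/-- This is where `f` being top-level matters: the argument at position `f` occurs in the type of no
other argument of `A`, so it may be replaced by a variable. -/
theorem transp_andThen_ne {f : NHom A B} {s t : NHom I B} {e : NHom K I} {f₁ f₂ : NHom K A}
    (hk : L.kind K = .transp A B I f s t e f₁ f₂) (g : Arr A) (p : Arr g.cod) :
    NHom.andThen (L := L.toSignature) g.arr p ≠ ⟨B, f⟩ := by
  intro h
  obtain ⟨C, p⟩ := p
  simp only [NHom.andThen, Arr.mk.injEq] at h
  obtain ⟨rfl, h⟩ := h
  exact (L.transp_spec hk).2.1 _ _ _ (eq_of_heq h).symm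

/-- The equations `se = ff₁` and `te = ff₂` exhibit the argument at `e` as a path between the two
arguments at position `f`. -/
theorem interpSort_transp_path {f : NHom A B} {s t : NHom I B} {e : NHom K I} {f₁ f₂ : NHom K A}
    (hk : L.kind K = .transp A B I f s t e f₁ f₂) (N : L.Obj → Expr) (a : Arr K → Expr) :
    (L.interpSort N I fun p => a (NHom.andThen (L := L.toSignature) e p)) =
      Id (L.interpSort N B fun p => a (NHom.andThen (L := L.toSignature)
          (NHom.comp (L := L.toSignature) f₁ f) p))
        (a (NHom.andThen (L := L.toSignature) f₁ ⟨B, f⟩))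
        (a (NHom.andThen (L := L.toSignature) f₂ ⟨B, f⟩)) := by
  have hc : NHom.comp (L := L.toSignature) e s = NHom.comp (L := L.toSignature) f₁ f := by
    have h := (L.transp_spec hk).2.2.2.2.2.2.1
    simp [NHom.comp, h]
  rw [interpSort_iso (L.transp_spec hk).1, ← transp_andThen_s hk, ← transp_andThen_t hk, ← hc]
  exact congrArg (fun b => Id (L.interpSort N B b) _ _) (funext fun q =>
    congrArg a (NHom.andThen_andThen e ⟨B, s⟩ q).symm)

/-- A proper composite through `f` is not `f` itself, and away from `f` the arrows `f₁` and `f₂`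
have equal composites. Hence both endpoints of the path lie in the same type. -/
theorem transp_comp_andThen {f : NHom A B} {s t : NHom I B} {e : NHom K I} {f₁ f₂ : NHom K A}
    (hk : L.kind K = .transp A B I f s t e f₁ f₂) (p : Arr B) :
    NHom.andThen (L := L.toSignature) (NHom.comp (L := L.toSignature) f₁ f) p =
      NHom.andThen (L := L.toSignature) (NHom.comp (L := L.toSignature) f₂ f) p :=
  (NHom.andThen_andThen f₁ ⟨B, f⟩ p).trans
    ((transp_andThen hk _ (transp_andThen_ne hk ⟨B, f⟩ p)).trans
      (NHom.andThen_andThen f₂ ⟨B, f⟩ p).symm)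

/-- The family of types along which the sort `τ_f` transports. -/
noncomputable def transpMotive (L : HSignature) {K A B : L.Obj} (N : L.Obj → Expr)
    (f : NHom A B) (f₁ : NHom K A) (a : Arr K → Expr) : Expr :=
  L.interpSort (fun C => (N C).subst shift) A
    (setAt (fun p => (a (NHom.andThen (L := L.toSignature) f₁ p)).subst shift) ⟨B, f⟩ (var 0))

theorem transpMotive_left (N : L.Obj → Expr) (f : NHom A B) (f₁ : NHom K A) (a : Arr K → Expr) :
    (L.transpMotive N f f₁ a).subst
        (scons (a (NHom.andThen (L := L.toSignature) f₁ ⟨B, f⟩)) var) =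
      L.interpSort N A fun p => a (NHom.andThen (L := L.toSignature) f₁ p) := by
  simp only [transpMotive, subst_interpSort, subst_setAt, subst_subst, comp_shift_scons,
    Expr.subst_var]
  congr 1
  funext p
  by_cases hp : p = ⟨B, f⟩
  · subst hp; simp
  · simp [setAt_of_ne _ _ hp]

/-- The family is built from the arguments of `f₁`, but those at positions other than `f` coincide
with the arguments of `f₂`. -/
theorem transpMotive_right {f : NHom A B} {s t : NHom I B} {e : NHom K I} {f₁ f₂ : NHom K A}
    (hk : L.kind K = .transp A B I f s t e f₁ f₂) (N : L.Obj → Expr) (a : Arr K → Expr) :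
    (L.transpMotive N f f₁ a).subst
        (scons (a (NHom.andThen (L := L.toSignature) f₂ ⟨B, f⟩)) var) =
      L.interpSort N A fun p => a (NHom.andThen (L := L.toSignature) f₂ p) := by
  simp only [transpMotive, subst_interpSort, subst_setAt, subst_subst, comp_shift_scons,
    Expr.subst_var]
  congr 1
  funext p
  by_cases hp : p = ⟨B, f⟩
  · subst hp; simp
  · simp [setAt_of_ne _ _ hp, transp_andThen hk p hp]

theorem transpMotive_form {f : NHom A B} {s t : NHom I B} {e : NHom K I} {f₁ f₂ : NHom K A}
    (hk : L.kind K = .transp A B I f s t e f₁ f₂) (ih : ∀ A ∈ L.below K, L.SortFormWF cl A)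
    (hE : Der cl E ok) (hN : L.InterpWF cl E N (L.below K)) {a : Arr K → Expr}
    (ha : L.ArgsWF cl E N K a) :
    Der cl (L.interpSort N B (fun p => a (NHom.andThen (L := L.toSignature)
        (NHom.comp (L := L.toSignature) f₁ f) p)) :: E) (ty (L.transpMotive N f f₁ a)) := by
  have hB : Der cl E (ty (L.interpSort N B (fun p => a (NHom.andThen (L := L.toSignature)
      (NHom.comp (L := L.toSignature) f₁ f) p)))) :=
    (ih B ⟨NHom.comp (L := L.toSignature) f₁ f⟩ E N _ hE
      (hN.mono (below_subset (NHom.comp (L := L.toSignature) f₁ f)))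
      (ha.face (NHom.comp (L := L.toSignature) f₁ f))).2
  refine (ih A ⟨f₁⟩ _ _ _ (.ctxCons hB) ((hN.mono (below_subset f₁)).weaken hB) fun g => ?_).2
  -- The required types never mention position `f`, so replacing its value by the new variable
  -- leaves them unchanged up to weakening.
  simp only [setAt_of_ne _ _ (transp_andThen_ne hk _ _)]
  by_cases hg : g = ⟨B, f⟩
  · subst hg
    have := Der.var_zero hB
    rw [subst_interpSort] at this
    rw [setAt_self]
    exact (congrArg (fun b => Der cl _ (tm _ (L.interpSort _ B b))) (funext fun q =>
      congrArg (fun x => (a x).subst shift) (NHom.andThen_andThen f₁ ⟨B, f⟩ q))).mp this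
  · rw [setAt_of_ne _ _ hg]
    simpa using (ha.face f₁ g).weaken hB

/-- Induction on the rank. A non-logical sort is a function applied along its telescope of
arguments. A logical sort is an identity type over a smaller sort, and the equations between arrows
in the signature say precisely that its two endpoints have the same type. Codes exist because the
universe is closed under identity types. -/
theorem sortFormWF (cl : Bool) (K : L.Obj) : L.SortFormWF cl K := by
  induction K using induction_rank with
  | h K ih =>
    intro E N a hE hN ha
    have hN' := hN.mono (Set.subset_insert K (L.below K))
    cases hk : L.kind K with
    | nonlogical =>
      rw [interpSort_nonlogical hk]
      refine underlying_small ?_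
      have hc := hN K (Set.mem_insert _ _) hk
      unfold sortTy at hc
      split at hc
      · next h =>
        rw [h]
        exact .appArrow (.oneForm hE) (typesOfHLevel_form _ hE) hc (.star hE)
      · next f fs h =>
        have := foldl_app_form (P := []) ih h hE hN' ha (by simp) hc
        rw [h]
        exact this
    | iso A s t =>
      rw [interpSort_iso hk]
      obtain ⟨h1, h2⟩ := ih A ⟨s⟩ E N _ hE (hN'.mono (below_subset s)) (ha.face s)
      have hs := ha (NHom.toArr (L := L.toSignature) s)
      have ht := ha (NHom.toArr (L := L.toSignature) t)
      -- The endpoint at `t` is retyped with the arguments at `s`, using `gs = gt`.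
      have ht := (congrArg (fun b => Der cl _ (tm _ (L.interpSort _ A b))) (funext fun q =>
        congrArg a (iso_andThen hk q))).mpr ht
      exact ⟨h1.id hs ht, .idForm h2 hs ht⟩
    | refl A I s t r =>
      rw [interpSort_refl hk]
      obtain ⟨h1, h2⟩ := ih I ⟨r⟩ E N _ hE (hN'.mono (below_subset r)) (ha.face r)
      have hr := ha (NHom.toArr (L := L.toSignature) r)
      have hx := Der.refl (ha.face r ⟨A, s⟩)
      have hx' : Der cl E (tm (.refl (a (NHom.andThen (L := L.toSignature) r ⟨A, s⟩)))
          (L.interpSort N I fun p => a (NHom.andThen (L := L.toSignature) r p))) := by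
        rw [interpSort_iso (L.refl_spec hk).1]
        simp only [NHom.toArr, ← refl_andThen hk]
        exact hx
      exact ⟨h1.id hr hx', .idForm h2 hr hx'⟩
    | transp A B I f s t e f₁ f₂ =>
      rw [interpSort_transp hk]
      obtain ⟨h1, h2⟩ := ih A ⟨f₁⟩ E N _ hE (hN'.mono (below_subset f₁)) (ha.face f₂)
      have hP := transpMotive_form hk ih hE hN' ha
      have ht1 := ha (NHom.toArr (L := L.toSignature) f₁)
      have ht2 := ha (NHom.toArr (L := L.toSignature) f₂)
      have he := ha (NHom.toArr (L := L.toSignature) e)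
      have he := (congrArg (fun T => Der cl E (tm _ T)) (interpSort_transp_path hk N a)).mp he
      have hx₁ := ha (NHom.andThen (L := L.toSignature) f₁ ⟨B, f⟩)
      -- The second endpoint, typed a priori by the composites through `f₂`, is retyped by those
      -- through `f₁`.
      have hx₂ := (congrArg (fun b => Der cl E (tm _ (L.interpSort N B b))) (funext fun q =>
        congrArg a (transp_comp_andThen hk q))).mpr
          (ha (NHom.andThen (L := L.toSignature) f₂ ⟨B, f⟩))
      have htr := Der.trans hx₁ hx₂ he hP (by rw [transpMotive_left]; exact ht1)
      rw [transpMotive_right hk] at htr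
      exact ⟨h1.id ht2 htr, .idForm h2 ht2 htr⟩

end HSignature

end FOLIso

namespace FOLIso

namespace HSignature

open HoTT HoTT.Expr HoTT.Jdg

variable {L : HSignature} {cl : Bool} {E : List Expr} {N : L.Obj → Expr} {K A : L.Obj}
  {P Ks : List L.Obj}

/-! ### Structures -/

theorem mem_of_mem_below (hl : L.sorts = P ++ K :: Ks) (hA : A ∈ L.below K)
    (hk : L.kind A = .nonlogical) : A ∈ P := by
  obtain ⟨f⟩ := hA
  have hm := L.mem_sorts.2 hk
  have ho := L.sorts_ordered
  rw [hl, List.pairwise_append, List.pairwise_cons] at ho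
  rw [hl, List.mem_append, List.mem_cons] at hm
  rcases hm with hm | rfl | hm
  · exact hm
  · exact absurd rfl f.ne
  · exact absurd (L.lt_of_arr f) (ho.2.1.1 A hm)

theorem notMem_below (hl : L.sorts = P ++ K :: Ks) (hA : A ∈ P ++ [K]) : K ∉ L.below A := by
  rintro ⟨f⟩
  have ho := L.sorts_ordered
  rw [hl, List.pairwise_append] at ho
  rcases List.mem_append.1 hA with hA | hA
  · exact ho.2.2 A hA K (by simp) (L.lt_of_arr f)
  · exact f.ne (List.mem_singleton.1 hA).symm

theorem head_notMem (hl : L.sorts = P ++ K :: Ks) : K ∉ P := fun hf => by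
  have := L.sorts_nodup
  rw [hl, List.nodup_append] at this
  exact this.2.2 K hf K (by simp) rfl

theorem InterpWF.sortTy_form (h : L.InterpWF cl E N {A | A ∈ P}) (hE : Der cl E ok)
    (hl : L.sorts = P ++ K :: Ks) : Der cl E (ty (L.sortTy N K)) :=
  HSignature.sortTy_form (fun A _ => sortFormWF cl A) hE
    fun A hA hk => h A (mem_of_mem_below hl hA hk) hk

/-- As the sorts are listed in increasing order, `K` is not below any sort of `P` or itself, so the
types of interpretations of these sorts do not see the new value. -/
theorem InterpWF.setAt (h : L.InterpWF cl E N {A | A ∈ P}) (hl : L.sorts = P ++ K :: Ks) {t : Expr}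
    (ht : Der cl E (tm t (L.sortTy N K))) :
    L.InterpWF cl E (setAt N K t) {A | A ∈ P ++ [K]} := fun A hA hk => by
  have hne : ∀ C ∈ L.below A, C ≠ K := fun C hC h => notMem_below hl hA (h ▸ hC)
  rw [sortTy_congr (N' := N) fun C hC => setAt_of_ne _ _ (hne C hC)]
  rcases List.mem_append.1 hA with hA | hA
  · have hAK : A ≠ K := fun h => head_notMem hl (h ▸ hA)
    rw [setAt_of_ne _ _ hAK]
    exact h A hA hk
  · obtain rfl := List.mem_singleton.1 hA
    rwa [setAt_self]

@[simp]
theorem subst_strucTyAux (N : L.Obj → Expr) (Ks : List L.Obj) (s : ℕ → Expr) :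
    (L.strucTyAux N Ks).subst s = L.strucTyAux (fun A => (N A).subst s) Ks := by
  induction Ks generalizing N s with
  | nil => simp [strucTyAux]
  | cons K Ks ih =>
    cases Ks with
    | nil => simp [strucTyAux]
    | cons K' Ks => simp [strucTyAux, ih, subst_setAt]

theorem InterpWF.strucTyAux_form (h : L.InterpWF cl E N {A | A ∈ P}) (hE : Der cl E ok)
    (hl : L.sorts = P ++ Ks) : Der cl E (ty (L.strucTyAux N Ks)) := by
  induction Ks generalizing P E N with
  | nil => exact .oneForm hE
  | cons K Ks ih =>
    have hK := h.sortTy_form hE hl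
    cases Ks with
    | nil => exact hK
    | cons K' Ks =>
      simp only [strucTyAux, wk_eq]
      refine .sgForm hK (ih ((h.weaken hK).setAt hl ?_) (.ctxCons hK) (by simp [hl]))
      simpa using Der.var_zero hK

/-- The first projection interprets the next sort, and the second is a term of the remaining Σ-type
with this first projection substituted, to which induction applies. -/
theorem InterpWF.projAux (h : L.InterpWF cl E N {A | A ∈ P}) (hl : L.sorts = P ++ Ks) {M : Expr}
    (hM : Der cl E (tm M (L.strucTyAux N Ks))) :
    L.InterpWF cl E (L.projAux N Ks M) {A | A ∈ P ++ Ks} := by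
  induction Ks generalizing P N M with
  | nil => simpa [HSignature.projAux] using h
  | cons K Ks ih =>
    have hE := hM.ctx_ok
    have hK := h.sortTy_form hE hl
    cases Ks with
    | nil => exact h.setAt hl hM
    | cons K' Ks =>
      simp only [strucTyAux, wk_eq] at hM
      have hS := ((h.weaken hK).setAt hl (by simpa using Der.var_zero hK)).strucTyAux_form
        (Ks := K' :: Ks) (.ctxCons hK) (by simp [hl])
      have h2 := Der.snd hS hM
      rw [subst_strucTyAux, subst_setAt] at h2
      have := ih (h.setAt hl (.fst hS hM)) (by simp [hl]) (by simpa using h2)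
      simpa [HSignature.projAux] using this

theorem IsStructure.interpWF {M : Expr} (hM : L.IsStructure cl E M) :
    L.InterpWF cl E (L.proj M) Set.univ := by
  intro A _ hk
  refine InterpWF.projAux (P := []) (fun A hA => by simp at hA) (by simp) hM A ?_ hk
  simpa using L.mem_sorts.2 hk

end HSignature

/-! ### Contexts and context morphisms -/

section

variable {L : Signature} {Γ Δ : Ctx L} {K : SortExpr L} {φ : Form L} {x : ℕ} {r : ℕ → ℕ}

theorem HasSort.lt_length (h : HasSort Γ x K) : x < Γ.length := by
  obtain ⟨K₀, h, -⟩ := h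
  exact (List.getElem?_eq_some_iff.1 h).1

theorem hasSort_zero : HasSort (K :: Γ) 0 (K.rename Nat.succ) := ⟨K, rfl, rfl⟩

theorem HasSort.succ {K' : SortExpr L} (h : HasSort Γ x K) :
    HasSort (K' :: Γ) (x + 1) (K.rename Nat.succ) := by
  obtain ⟨K₀, h, rfl⟩ := h
  exact ⟨K₀, by simpa using h, rfl⟩

/-- Variables of an extended context. -/
theorem HasSort.cases_cons {K' : SortExpr L} (h : HasSort (K' :: Γ) x K) :
    (x = 0 ∧ K = K'.rename Nat.succ) ∨
      ∃ y K₀, x = y + 1 ∧ K = K₀.rename Nat.succ ∧ HasSort Γ y K₀ := by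
  obtain ⟨K₀, h, rfl⟩ := h
  cases x with
  | zero =>
    obtain rfl : K' = K₀ := by simpa using h
    exact .inl ⟨rfl, rfl⟩
  | succ y => exact .inr ⟨y, K₀.rename (· + (y + 1)), rfl, rfl, K₀, by simpa using h, rfl⟩

theorem CtxMor.succ (K : SortExpr L) : CtxMor (K :: Γ) Γ Nat.succ := fun _ _ h => h.succ

theorem CtxMor.lift (h : CtxMor Γ Δ r) (K : SortExpr L) :
    CtxMor (K.rename r :: Γ) (K :: Δ) (HoTT.Expr.liftR r) := by
  intro x K' hx
  rcases hx.cases_cons with ⟨rfl, rfl⟩ | ⟨y, K₀, rfl, rfl, hy⟩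
  · exact hasSort_zero
  · exact (h y K₀ hy).succ

theorem SortWF.rename (hK : SortWF Δ K) (h : CtxMor Γ Δ r) : SortWF Γ (K.rename r) :=
  fun f => h _ _ (hK f)

theorem FormWF.rename (hφ : FormWF Δ φ) (h : CtxMor Γ Δ r) : FormWF Γ (φ.rename r) := by
  induction φ generalizing Γ Δ r with
  | bot => trivial
  | top => trivial
  | and φ ψ ih₁ ih₂ => exact ⟨ih₁ hφ.1 h, ih₂ hφ.2 h⟩
  | or φ ψ ih₁ ih₂ => exact ⟨ih₁ hφ.1 h, ih₂ hφ.2 h⟩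
  | imp φ ψ ih₁ ih₂ => exact ⟨ih₁ hφ.1 h, ih₂ hφ.2 h⟩
  | all K φ ih => exact ⟨hφ.1.rename h, ih hφ.2 (h.lift K)⟩
  | ex K φ ih => exact ⟨hφ.1.rename h, ih hφ.2 (h.lift K)⟩

theorem FormWF.wk (hφ : FormWF Γ φ) (K : SortExpr L) : FormWF (K :: Γ) φ.wk :=
  hφ.rename (.succ K)

theorem ctxMor_swap01 (K K' : SortExpr L) :
    CtxMor (K.rename Nat.succ :: K' :: Γ) (K'.rename Nat.succ :: K :: Γ) swap01 := by
  intro x K₁ hx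
  rcases hx.cases_cons with ⟨rfl, rfl⟩ | ⟨y, K₀, rfl, rfl, hy⟩
  · exact ⟨K', rfl, rfl⟩
  rcases hy.cases_cons with ⟨rfl, rfl⟩ | ⟨z, K₀, rfl, rfl, hz⟩
  · exact ⟨K.rename Nat.succ, rfl, rfl⟩
  · exact hz.succ.succ

theorem CtxMor.renameTele (h : CtxMor Γ Δ r) (Γ' : Ctx L) :
    CtxMor (renameTele r Γ' ++ Γ) (Γ' ++ Δ) (liftN r Γ'.length) := by
  induction Γ' with
  | nil => exact h
  | cons K Γ' ih => exact ih.lift K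

theorem CtxWF.renameTele {Γ' : Ctx L} (h : CtxMor Γ Δ r) (hΓ : CtxWF Γ) (hΔ : CtxWF (Γ' ++ Δ)) :
    CtxWF (renameTele r Γ' ++ Γ) := by
  induction Γ' with
  | nil => exact hΓ
  | cons K Γ' ih => exact ⟨ih hΔ.1, hΔ.2.rename (h.renameTele Γ')⟩

theorem CtxWF.of_append {Γ' : Ctx L} (h : CtxWF (Γ' ++ Γ)) : CtxWF Γ := by
  induction Γ' with
  | nil => exact h
  | cons _ _ ih => exact ih h.1

/-- The rules state well-formedness only where it does not follow from their premises. The semantic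
arguments need it for every sequent in a derivation, to know that the interpretations are types. -/
theorem Entails.wf {L : HSignature} {cl : Bool} {T : Theory L.toSignature}
    {σ : Sequent L.toSignature} (h : Entails L cl T σ) : σ.WF := by
  induction h with
  | ax h => exact T.wf _ h
  | sub hΓ hr _ ih => exact ⟨hΓ, ih.2.1.rename hr, ih.2.2.rename hr⟩
  | cut _ _ ih₁ ih₂ => exact ⟨ih₁.1, ih₁.2.1, ih₂.2.2⟩
  | conWk hK _ ih => exact ⟨⟨ih.1, hK⟩, ih.2.1.wk _, ih.2.2.wk _⟩
  | @conExch Γ Γ' K K' φ ψ hK hK' _ ih =>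
    have hm := ctxMor_swap01 (Γ := Γ) K K'
    have hΓ : CtxWF Γ := ih.1.of_append.1.1
    have hW : CtxWF (K.rename Nat.succ :: K' :: Γ) := ⟨⟨hΓ, hK'⟩, hK.rename (.succ K')⟩
    exact ⟨CtxWF.renameTele hm hW ih.1, ih.2.1.rename (hm.renameTele Γ'),
      ih.2.2.rename (hm.renameTele Γ')⟩
  | andIntro _ _ ih₁ ih₂ => exact ⟨ih₁.1, ih₁.2.1, ih₁.2.2, ih₂.2.2⟩
  | andLeft _ ih => exact ⟨ih.1, ih.2.1, ih.2.2.1⟩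
  | andRight _ ih => exact ⟨ih.1, ih.2.1, ih.2.2.2⟩
  | orElim _ _ ih₁ ih₂ => exact ⟨ih₁.1, ⟨ih₁.2.1, ih₂.2.1⟩, ih₁.2.2⟩
  | orLeft _ ih => exact ⟨ih.1, ih.2.1.1, ih.2.2⟩
  | orRight _ ih => exact ⟨ih.1, ih.2.1.2, ih.2.2⟩
  | impIntro _ ih => exact ⟨ih.1, ih.2.1.1, ih.2.1.2, ih.2.2⟩
  | impElim _ ih => exact ⟨ih.1, ⟨ih.2.1, ih.2.2.1⟩, ih.2.2.2⟩
  | allIntro hθ _ ih => exact ⟨ih.1.1, hθ, ih.1.2, ih.2.2⟩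
  | allElim _ ih => exact ⟨⟨ih.1, ih.2.2.1⟩, ih.2.1.wk _, ih.2.2.2⟩
  | exElim hθ _ ih => exact ⟨ih.1.1, ⟨ih.1.2, ih.2.1⟩, hθ⟩
  | exIntro _ ih => exact ⟨⟨ih.1, ih.2.1.1⟩, ih.2.1.2, ih.2.2.wk _⟩
  | _ => assumption

end

end FOLIso

namespace FOLIso.HSignature

open HoTT HoTT.Expr HoTT.Jdg

variable {L : HSignature} {cl : Bool} {E : List Expr} {N : L.Obj → Expr} {v v' : ℕ → Expr}
  {Γ Δ : Ctx L.toSignature} {K : SortExpr L.toSignature} {φ : Form L.toSignature}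

/-! ### Interpretation of formulas -/

@[simp]
theorem subst_interpForm (N : L.Obj → Expr) (v : ℕ → Expr) (φ : Form L.toSignature)
    (s : ℕ → Expr) :
    (L.interpForm N v φ).subst s = L.interpForm (fun A => (N A).subst s) (comp v s) φ := by
  induction φ generalizing N v s with
  | bot => simp [interpForm]
  | top => simp [interpForm]
  | and φ ψ ih₁ ih₂ => simp [interpForm, ih₁, ih₂]
  | or φ ψ ih₁ ih₂ => simp [interpForm, ih₁, ih₂]
  | imp φ ψ ih₁ ih₂ => simp [interpForm, ih₁, ih₂]
  | all K φ ih => simp [interpForm, ih]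
  | ex K φ ih => simp [interpForm, ih]

theorem interpForm_rename (N : L.Obj → Expr) (v : ℕ → Expr) (φ : Form L.toSignature)
    (r : ℕ → ℕ) : L.interpForm N v (φ.rename r) = L.interpForm N (fun i => v (r i)) φ := by
  induction φ generalizing N v r with
  | bot => rfl
  | top => rfl
  | and φ ψ ih₁ ih₂ => simp [interpForm, Form.rename, ih₁, ih₂]
  | or φ ψ ih₁ ih₂ => simp [interpForm, Form.rename, ih₁, ih₂]
  | imp φ ψ ih₁ ih₂ => simp [interpForm, Form.rename, ih₁, ih₂]
  | all K φ ih => simp only [interpForm, Form.rename, ih, liftS_liftR]; rfl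
  | ex K φ ih => simp only [interpForm, Form.rename, ih, liftS_liftR]; rfl

theorem interpForm_wk (N : L.Obj → Expr) (v : ℕ → Expr) (φ : Form L.toSignature) :
    L.interpForm N v φ.wk = L.interpForm N (comp shift v) φ :=
  interpForm_rename N v φ Nat.succ

/-- Valuations are total functions on indices, but only the variables declared in the context occur
in a well-formed formula. -/
theorem interpForm_congr (hφ : FormWF Γ φ) (h : ∀ i < Γ.length, v i = v' i) :
    L.interpForm N v φ = L.interpForm N v' φ := by
  have hl (v v' : ℕ → Expr) (Γ : Ctx L.toSignature) (K) (h : ∀ i < Γ.length, v i = v' i) :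
      ∀ i < (K :: Γ).length, liftS v i = liftS v' i := by
    rintro (_ | i) hi
    · rfl
    · exact congrArg Expr.wk (h i (by simpa using hi))
  have hs (N : L.Obj → Expr) (v v' : ℕ → Expr) (Γ : Ctx L.toSignature)
      (K : SortExpr L.toSignature) (hK : SortWF Γ K) (h : ∀ i < Γ.length, v i = v' i) :
      (L.interpSort N K.head fun f => v (K.args f)) =
        L.interpSort N K.head fun f => v' (K.args f) :=
    congrArg _ (funext fun f => h _ (hK f).lt_length)
  induction φ generalizing N v v' Γ with
  | bot => rfl
  | top => rfl
  | and φ ψ ih₁ ih₂ => simp only [interpForm, ih₁ hφ.1 h, ih₂ hφ.2 h]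
  | or φ ψ ih₁ ih₂ => simp only [interpForm, ih₁ hφ.1 h, ih₂ hφ.2 h]
  | imp φ ψ ih₁ ih₂ => simp only [interpForm, ih₁ hφ.1 h, ih₂ hφ.2 h]
  | all K φ ih => simp only [interpForm, ih hφ.2 (hl v v' Γ K h), hs N v v' Γ K hφ.1 h]
  | ex K φ ih => simp only [interpForm, ih hφ.2 (hl v v' Γ K h), hs N v v' Γ K hφ.1 h]

/-- The type interpreting a sort expression. -/
noncomputable def interpSortExpr (L : HSignature) (N : L.Obj → Expr) (v : ℕ → Expr)
    (K : SortExpr L.toSignature) : Expr :=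
  L.interpSort N K.head fun f => v (K.args f)

@[simp]
theorem subst_interpSortExpr (N : L.Obj → Expr) (v : ℕ → Expr) (K : SortExpr L.toSignature)
    (s : ℕ → Expr) : (L.interpSortExpr N v K).subst s =
      L.interpSortExpr (fun A => (N A).subst s) (comp v s) K :=
  subst_interpSort _ _ _ _

theorem interpForm_all (N : L.Obj → Expr) (v : ℕ → Expr) (K : SortExpr L.toSignature)
    (φ : Form L.toSignature) : L.interpForm N v (.all K φ) = Pi (L.interpSortExpr N v K)
      (L.interpForm (fun A => (N A).subst shift) (scons (var 0) (comp v shift)) φ) := by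
  simp [interpForm, interpSortExpr]

theorem interpForm_ex (N : L.Obj → Expr) (v : ℕ → Expr) (K : SortExpr L.toSignature)
    (φ : Form L.toSignature) : L.interpForm N v (.ex K φ) = Tr (Sg (L.interpSortExpr N v K)
      (L.interpForm (fun A => (N A).subst shift) (scons (var 0) (comp v shift)) φ)) := by
  simp [interpForm, interpSortExpr]

/-- The terms `v x` interpret the variables of the context `Γ`. -/
def ValWF (L : HSignature) (cl : Bool) (E : List Expr) (N : L.Obj → Expr) (v : ℕ → Expr)
    (Γ : Ctx L.toSignature) : Prop :=
  ∀ x K, HasSort Γ x K → Der cl E (tm (v x) (L.interpSortExpr N v K))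

theorem ValWF.argsWF (hv : L.ValWF cl E N v Γ) (hK : SortWF Γ K) :
    L.ArgsWF cl E N K.head fun f => v (K.args f) := fun f => hv _ _ (hK f)

theorem ValWF.ctxMor (hv : L.ValWF cl E N v Γ) {r : ℕ → ℕ} (hr : CtxMor Γ Δ r) :
    L.ValWF cl E N (fun i => v (r i)) Δ := fun x K hx => hv _ _ (hr x K hx)

theorem ValWF.tail (hv : L.ValWF cl E N v (K :: Γ)) : L.ValWF cl E N (comp shift v) Γ :=
  hv.ctxMor (.succ K)

theorem ValWF.head (hv : L.ValWF cl E N v (K :: Γ)) :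
    Der cl E (tm (v 0) (L.interpSortExpr N (comp shift v) K)) := hv _ _ hasSort_zero

theorem ValWF.substWF {Δ : List Expr} {s : ℕ → Expr} (hv : L.ValWF cl E N v Γ)
    (hs : SubstWF cl Δ s E) (hΔ : Der cl Δ ok) :
    L.ValWF cl Δ (fun A => (N A).subst s) (comp v s) Γ := fun x K hx => by
  simpa using (hv x K hx).substWF hs hΔ

theorem ValWF.weaken {T : Expr} (hv : L.ValWF cl E N v Γ) (hT : Der cl E (ty T)) :
    L.ValWF cl (T :: E) (fun A => (N A).subst shift) (comp v shift) Γ :=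
  hv.substWF (.shift hT) (.ctxCons hT)

theorem ValWF.scons {t : Expr} (hv : L.ValWF cl E N v Γ)
    (ht : Der cl E (tm t (L.interpSortExpr N v K))) : L.ValWF cl E N (scons t v) (K :: Γ) := by
  intro x K' hx
  rcases hx.cases_cons with ⟨rfl, rfl⟩ | ⟨y, K₀, rfl, rfl, hy⟩
  · exact ht
  · exact hv y K₀ hy

theorem ValWF.lift (hv : L.ValWF cl E N v Γ) (hK : Der cl E (ty (L.interpSortExpr N v K))) :
    L.ValWF cl (L.interpSortExpr N v K :: E) (fun A => (N A).subst shift)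
      (Expr.scons (var 0) (comp v shift)) (K :: Γ) :=
  (hv.weaken hK).scons (by simpa using Der.var_zero hK)

theorem ValWF.sort_form (hv : L.ValWF cl E N v Γ) (hE : Der cl E ok)
    (hN : L.InterpWF cl E N Set.univ) (hK : SortWF Γ K) :
    IsSmall cl E (L.interpSortExpr N v K) ∧ Der cl E (ty (L.interpSortExpr N v K)) :=
  sortFormWF cl _ E N _ hE (hN.mono (Set.subset_univ _)) (hv.argsWF hK)

/-- Formulas are interpreted by small propositions. -/
theorem ValWF.interpForm (hv : L.ValWF cl E N v Γ) (hE : Der cl E ok)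
    (hN : L.InterpWF cl E N Set.univ) (hφ : FormWF Γ φ) :
    Der cl E (ty (L.interpForm N v φ)) ∧ IsSmall cl E (L.interpForm N v φ) ∧
      Inh cl E (isProp (L.interpForm N v φ)) := by
  induction φ generalizing E N v Γ with
  | bot => exact ⟨.zeroForm hE, .zero hE, .isProp_zero hE⟩
  | top => exact ⟨.oneForm hE, .one hE, .isProp_one hE⟩
  | and φ ψ ih₁ ih₂ =>
    obtain ⟨h₁, s₁, p₁⟩ := ih₁ hv hE hN hφ.1
    obtain ⟨h₂, s₂, p₂⟩ := ih₂ hv hE hN hφ.2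
    exact ⟨.prodForm h₁ h₂, .prod h₁ s₁ s₂, .isProp_prod h₁ h₂ p₁ p₂⟩
  | or φ ψ ih₁ ih₂ =>
    obtain ⟨h₁, s₁, p₁⟩ := ih₁ hv hE hN hφ.1
    obtain ⟨h₂, s₂, p₂⟩ := ih₂ hv hE hN hφ.2
    exact ⟨.trForm (.sumForm h₁ h₂), (s₁.sum s₂).tr, .isProp_tr (.sumForm h₁ h₂)⟩
  | imp φ ψ ih₁ ih₂ =>
    obtain ⟨h₁, s₁, p₁⟩ := ih₁ hv hE hN hφ.1
    obtain ⟨h₂, s₂, p₂⟩ := ih₂ hv hE hN hφ.2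
    exact ⟨.arrowForm h₁ h₂, .arrow h₁ s₁ s₂, .isProp_arrow h₁ h₂ p₂⟩
  | all K φ ih =>
    obtain ⟨sK, hK⟩ := hv.sort_form hE hN hφ.1
    obtain ⟨h, s, p⟩ := ih (hv.lift hK) (.ctxCons hK) (hN.weaken hK) hφ.2
    rw [interpForm_all]
    exact ⟨.piForm hK h, sK.pi s, .isProp_pi h p⟩
  | ex K φ ih =>
    obtain ⟨sK, hK⟩ := hv.sort_form hE hN hφ.1
    obtain ⟨h, s, p⟩ := ih (hv.lift hK) (.ctxCons hK) (hN.weaken hK) hφ.2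
    rw [interpForm_ex]
    exact ⟨.trForm (.sgForm hK h), (sK.sg s).tr, .isProp_tr (.sgForm hK h)⟩

end FOLIso.HSignature

namespace HoTT

open HoTT.Expr HoTT.Jdg

variable {cl : Bool} {Γ : List Expr} {A B C : Expr}

/-- Elimination for existential quantifiers: the truncation is removed because the goal is a
proposition, after which the pair is split. -/
theorem Inh.tr_sg_elim (hB : Der cl (A :: Γ) (ty B)) (hC : Der cl Γ (ty C))
    (hp : Inh cl Γ (isProp C)) (h : Inh cl (B :: A :: Γ) (C.subst (comp shift shift)))
    (ht : Inh cl Γ (Tr (Sg A B))) : Inh cl Γ C := by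
  have hA := hB.ctx_ok.ty_of_ok_cons
  have hS := Der.sgForm hA hB
  refine Inh.tr_elim hC hp ?_ ht
  have hB1 := hB.weaken_under hS
  have h1 := h.substWF ((SubstWF.lift (.shift hS) (hA.weaken hS)).lift hB1) (.ctxCons hB1)
  refine Inh.sg_elim (by simpa using hS.weaken hS) (hC.weaken hS) (by simpa using h1)
    ⟨.var 0, by simpa using Der.var_zero hS⟩

end HoTT

/-! ### Forcing and soundness of the logical rules -/

namespace FOLIso.HSignature

open HoTT HoTT.Expr HoTT.Jdg

variable {L : HSignature} {cl : Bool} {E : List Expr} {N : L.Obj → Expr} {v : ℕ → Expr}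
  {Γ Δ : Ctx L.toSignature} {K : SortExpr L.toSignature} {φ ψ χ θ : Form L.toSignature}
  {W : List Expr → (L.Obj → Expr) → Prop}

/-- A class of interpretations of the non-logical sorts which is closed under extension of the
context. -/
structure IsWorldClass (L : HSignature) (cl : Bool) (W : List Expr → (L.Obj → Expr) → Prop) :
    Prop where
  ok : ∀ {E N}, W E N → Der cl E ok
  interpWF : ∀ {E N}, W E N → L.InterpWF cl E N Set.univ
  extend : ∀ {E N T}, W E N → Der cl E (ty T) → W (T :: E) fun A => (N A).subst shift

/-- Validity of the sequent `Γ | φ ⇒ ψ` for all interpretations in the class `W`. -/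
def Forces (L : HSignature) (cl : Bool) (W : List Expr → (L.Obj → Expr) → Prop)
    (Γ : Ctx L.toSignature) (φ ψ : Form L.toSignature) : Prop :=
  ∀ E N v, W E N → L.ValWF cl E N v Γ → Inh cl E (L.interpForm N v φ) →
    Inh cl E (L.interpForm N v ψ)

namespace IsWorldClass

theorem form (hW : L.IsWorldClass cl W)
    (hEN : W E N) (hv : L.ValWF cl E N v Γ) (hφ : FormWF Γ φ) :
    Der cl E (ty (L.interpForm N v φ)) :=
  (hv.interpForm (hW.ok hEN) (hW.interpWF hEN) hφ).1

theorem isProp (hW : L.IsWorldClass cl W)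
    (hEN : W E N) (hv : L.ValWF cl E N v Γ) (hφ : FormWF Γ φ) :
    Inh cl E (isProp (L.interpForm N v φ)) :=
  (hv.interpForm (hW.ok hEN) (hW.interpWF hEN) hφ).2.2

theorem sort (hW : L.IsWorldClass cl W)
    (hEN : W E N) (hv : L.ValWF cl E N v Γ) (hK : SortWF Γ K) :
    Der cl E (ty (L.interpSortExpr N v K)) :=
  (hv.sort_form (hW.ok hEN) (hW.interpWF hEN) hK).2

theorem top (hW : L.IsWorldClass cl W) : L.Forces cl W Γ φ .top :=
  fun _ _ _ hEN _ _ => ⟨_, .star (hW.ok hEN)⟩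

theorem bot (hW : L.IsWorldClass cl W)
    (hφ : FormWF Γ φ) : L.Forces cl W Γ .bot φ := fun _ _ _ hEN hv h =>
  h.exfalso (hW.form hEN hv hφ)

theorem andIntro (hW : L.IsWorldClass cl W)
    (hφ : FormWF Γ φ) (hψ : FormWF Γ ψ) (h₁ : L.Forces cl W Γ θ φ)
    (h₂ : L.Forces cl W Γ θ ψ) : L.Forces cl W Γ θ (.and φ ψ) := fun _ _ _ hEN hv h =>
  .prod_intro (hW.form hEN hv hψ) (h₁ _ _ _ hEN hv h) (h₂ _ _ _ hEN hv h) (hW.form hEN hv hφ)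

theorem andLeft (hW : L.IsWorldClass cl W)
    (hφ : FormWF Γ φ) (hψ : FormWF Γ ψ) : L.Forces cl W Γ (.and φ ψ) φ :=
  fun _ _ _ hEN hv h => h.prod_left (hW.form hEN hv hφ) (hW.form hEN hv hψ)

theorem andRight (hW : L.IsWorldClass cl W)
    (hφ : FormWF Γ φ) (hψ : FormWF Γ ψ) : L.Forces cl W Γ (.and φ ψ) ψ :=
  fun _ _ _ hEN hv h => h.prod_right (hW.form hEN hv hφ) (hW.form hEN hv hψ)

/-- Validity of `φ ⇒ ψ` yields a derivation of `ψ` from the hypothesis `φ`. -/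
theorem hyp (hW : L.IsWorldClass cl W)
    (hφ : FormWF Γ φ) (h : L.Forces cl W Γ φ ψ) (hEN : W E N)
    (hv : L.ValWF cl E N v Γ) :
    Inh cl (L.interpForm N v φ :: E) ((L.interpForm N v ψ).subst shift) := by
  have hT := hW.form hEN hv hφ
  have := h _ _ _ (hW.extend hEN hT) (hv.weaken hT) ⟨_, by simpa using Der.var_zero hT⟩
  simpa using this

theorem orElim (hW : L.IsWorldClass cl W)
    (hφ : FormWF Γ φ) (hψ : FormWF Γ ψ) (hθ : FormWF Γ θ) (h₁ : L.Forces cl W Γ φ θ)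
    (h₂ : L.Forces cl W Γ ψ θ) : L.Forces cl W Γ (.or φ ψ) θ := fun E N v hEN hv h => by
  have hφ' := hW.form hEN hv hφ
  have hψ' := hW.form hEN hv hψ
  have hθ' := hW.form hEN hv hθ
  have hS := Der.sumForm hφ' hψ'
  refine Inh.tr_elim hθ' (hW.isProp hEN hv hθ) ?_ h
  have hEN' := hW.extend hEN hS
  have hv' := hv.weaken hS
  have l := hW.hyp hφ h₁ hEN' hv'
  have r := hW.hyp hψ h₂ hEN' hv'
  exact Inh.sum_elim (hφ'.weaken hS) (hψ'.weaken hS) (hθ'.weaken hS)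
    (by simpa using l) (by simpa using r) ⟨.var 0, by simpa using Der.var_zero hS⟩

theorem orLeft (hW : L.IsWorldClass cl W)
    (hψ : FormWF Γ ψ) : L.Forces cl W Γ φ (.or φ ψ) :=
  fun _ _ _ hEN hv h => (h.inl (hW.form hEN hv hψ)).tr

theorem orRight (hW : L.IsWorldClass cl W)
    (hφ : FormWF Γ φ) : L.Forces cl W Γ ψ (.or φ ψ) :=
  fun _ _ _ hEN hv h => (h.inr (hW.form hEN hv hφ)).tr

/-- The premise is used in the world extended by a proof of `φ`; abstracting the new variable gives
the function. -/
theorem impIntro (hW : L.IsWorldClass cl W)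
    (hθ : FormWF Γ θ) (hφ : FormWF Γ φ) (h : L.Forces cl W Γ (.and θ φ) ψ) :
    L.Forces cl W Γ θ (.imp φ ψ) := fun E N v hEN hv ht => by
  have hT := hW.form hEN hv hφ
  have hEN' := hW.extend hEN hT
  have hv' := hv.weaken hT
  refine Inh.arrow_intro ?_
  have := h _ _ _ hEN' hv' (Inh.prod_intro (hW.form hEN' hv' hφ) (by simpa using ht.weaken hT)
    ⟨_, by simpa using Der.var_zero hT⟩ (hW.form hEN' hv' hθ))
  simpa using this

theorem impElim (hW : L.IsWorldClass cl W)
    (hθ : FormWF Γ θ) (hφ : FormWF Γ φ) (hψ : FormWF Γ ψ)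
    (h : L.Forces cl W Γ θ (.imp φ ψ)) : L.Forces cl W Γ (.and θ φ) ψ := fun E N v hEN hv ht => by
  have h₁ := hW.form hEN hv hθ
  have h₂ := hW.form hEN hv hφ
  exact (h _ _ _ hEN hv (ht.prod_left h₁ h₂)).arrow_elim (hW.form hEN hv hψ) h₂
    (ht.prod_right h₁ h₂)

/-- The premise is used in the world extended by a generic element of the sort, over which the
result is then abstracted. -/
theorem allIntro (hW : L.IsWorldClass cl W)
    (hK : SortWF Γ K) (h : L.Forces cl W (K :: Γ) θ.wk φ) :
    L.Forces cl W Γ θ (.all K φ) := fun E N v hEN hv ht => by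
  have hT := hW.sort hEN hv hK
  rw [interpForm_all]
  refine (h _ _ _ (hW.extend hEN hT) (hv.lift hT) ?_).lam
  simpa [interpForm_wk] using ht.weaken hT

theorem allElim (hW : L.IsWorldClass cl W)
    (hK : SortWF Γ K) (hφ : FormWF (K :: Γ) φ) (h : L.Forces cl W Γ θ (.all K φ)) :
    L.Forces cl W (K :: Γ) θ.wk φ := fun E N v hEN hv ht => by
  have hT := hW.sort hEN hv.tail hK
  have ht := h _ _ _ hEN hv.tail (by simpa [interpForm_wk] using ht)
  rw [interpForm_all] at ht
  simpa using Inh.app (hW.form (hW.extend hEN hT) (hv.tail.lift hT) hφ) ht hv.head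

theorem ex_intro (hW : L.IsWorldClass cl W)
    (hK : SortWF Γ K) (hφ : FormWF (K :: Γ) φ) (hEN : W E N)
    (hv : L.ValWF cl E N v Γ) {t : Expr} (ht : Der cl E (tm t (L.interpSortExpr N v K)))
    (h : Inh cl E (L.interpForm N (scons t v) φ)) : Inh cl E (L.interpForm N v (.ex K φ)) := by
  have hT := hW.sort hEN hv hK
  rw [interpForm_ex]
  exact (Inh.pair (hW.form (hW.extend hEN hT) (hv.lift hT) hφ) ht (by simpa using h)).tr

theorem exIntro (hW : L.IsWorldClass cl W)
    (hK : SortWF Γ K) (hφ : FormWF (K :: Γ) φ) (h : L.Forces cl W Γ (.ex K φ) θ) :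
    L.Forces cl W (K :: Γ) φ θ.wk := fun E N v hEN hv ht => by
  rw [interpForm_wk]
  exact h _ _ _ hEN hv.tail (hW.ex_intro hK hφ hEN hv.tail hv.head (by simpa using ht))

theorem exElim (hW : L.IsWorldClass cl W)
    (hK : SortWF Γ K) (hφ : FormWF (K :: Γ) φ) (hθ : FormWF Γ θ)
    (h : L.Forces cl W (K :: Γ) φ θ.wk) : L.Forces cl W Γ (.ex K φ) θ := fun E N v hEN hv ht => by
  have hT := hW.sort hEN hv hK
  have hEN' := hW.extend hEN hT
  have hv' := hv.lift hT
  rw [interpForm_ex] at ht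
  refine Inh.tr_sg_elim (hW.form hEN' hv' hφ) (hW.form hEN hv hθ) (hW.isProp hEN hv hθ) ?_ ht
  simpa [interpForm_wk] using hW.hyp hφ h hEN' hv'

theorem exTop (hW : L.IsWorldClass cl W)
    (hK : SortWF Γ K) (hφ : FormWF (K :: Γ) φ) :
    L.Forces cl W Γ (.ex K φ) (.ex K .top) :=
  hW.exElim hK hφ ⟨hK, trivial⟩ fun _ _ _ hEN hv _ =>
    hW.exIntro (θ := .ex K .top) hK (φ := .top) trivial (fun _ _ _ _ _ h => h) _ _ _ hEN hv
      ⟨_, .star (hW.ok hEN)⟩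

theorem and_swap (hW : L.IsWorldClass cl W)
    (hφ : FormWF Γ φ) (hψ : FormWF Γ ψ) :
    L.Forces cl W Γ (.and φ ψ) (.and ψ φ) :=
  hW.andIntro hψ hφ (hW.andRight hφ hψ) (hW.andLeft hφ hψ)

/-- A consequence of implication: moving `φ` to the right of the sequent leaves a bare existential
on the left, to which its elimination rule applies. The proof of `dist` uses the same device with
disjunction. -/
theorem frob (hW : L.IsWorldClass cl W)
    (hφ : FormWF Γ φ) (hK : SortWF Γ K) (hψ : FormWF (K :: Γ) ψ) :
    L.Forces cl W Γ (.and φ (.ex K ψ)) (.ex K (.and φ.wk ψ)) := by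
  have hφ' := hφ.wk K
  have hχ : FormWF Γ (.ex K (.and φ.wk ψ)) := ⟨hK, hφ', hψ⟩
  have h₁ : L.Forces cl W (K :: Γ) (.and φ.wk ψ) (Form.ex K (.and φ.wk ψ)).wk :=
    hW.exIntro hK ⟨hφ', hψ⟩ fun _ _ _ _ _ h => h
  have h₂ : L.Forces cl W Γ (.ex K ψ) (.imp φ (.ex K (.and φ.wk ψ))) :=
    hW.exElim hK hψ ⟨hφ, hχ⟩ (hW.impIntro hψ hφ' fun _ _ _ hEN hv h =>
      h₁ _ _ _ hEN hv (hW.and_swap hψ hφ' _ _ _ hEN hv h))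
  have hex : FormWF Γ (.ex K ψ) := ⟨hK, hψ⟩
  exact fun _ _ _ hEN hv h =>
    hW.impElim hex hφ hχ h₂ _ _ _ hEN hv (hW.and_swap hφ hex _ _ _ hEN hv h)

theorem dist (hW : L.IsWorldClass cl W)
    (hφ : FormWF Γ φ) (hψ : FormWF Γ ψ) (hχ : FormWF Γ χ) :
    L.Forces cl W Γ (.and φ (.or ψ χ)) (.or (.and φ ψ) (.and φ χ)) := by
  have hθ : FormWF Γ (.or (.and φ ψ) (.and φ χ)) := ⟨⟨hφ, hψ⟩, hφ, hχ⟩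
  have h : L.Forces cl W Γ (.or ψ χ) (.imp φ (.or (.and φ ψ) (.and φ χ))) :=
    hW.orElim hψ hχ ⟨hφ, hθ⟩
      (hW.impIntro hψ hφ fun _ _ _ hEN hv h => hW.orLeft hθ.2 _ _ _ hEN hv
        (hW.and_swap hψ hφ _ _ _ hEN hv h))
      (hW.impIntro hχ hφ fun _ _ _ hEN hv h => hW.orRight hθ.1 _ _ _ hEN hv
        (hW.and_swap hχ hφ _ _ _ hEN hv h))
  have hor : FormWF Γ (.or ψ χ) := ⟨hψ, hχ⟩
  exact fun _ _ _ hEN hv ht =>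
    hW.impElim hor hφ hθ h _ _ _ hEN hv (hW.and_swap hφ hor _ _ _ hEN hv ht)

theorem lem (hW : L.IsWorldClass cl W)
    (hcl : cl = true) (hφ : FormWF Γ φ) :
    L.Forces cl W Γ .top (.or φ (.imp φ .bot)) := fun _ _ _ hEN hv _ => by
  obtain ⟨h, s, p⟩ := hv.interpForm (hW.ok hEN) (hW.interpWF hEN) hφ
  exact (Inh.lem hcl h s p).tr

end IsWorldClass

theorem Forces.rename {r : ℕ → ℕ} (hr : CtxMor Γ Δ r) (h : L.Forces cl W Δ φ ψ) :
    L.Forces cl W Γ (φ.rename r) (ψ.rename r) := fun E N v hEN hv ht => by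
  rw [interpForm_rename] at ht ⊢
  exact h _ _ _ hEN (hv.ctxMor hr) ht

end FOLIso.HSignature

/-! ### Soundness of the rules for isomorphism -/

namespace FOLIso.HSignature

open HoTT HoTT.Expr HoTT.Jdg

variable {L : HSignature} {cl : Bool} {E : List Expr} {N : L.Obj → Expr} {v : ℕ → Expr}
  {Γ : Ctx L.toSignature} {K K' : SortExpr L.toSignature} {φ θ : Form L.toSignature}
  {W : List Expr → (L.Obj → Expr) → Prop}

/-! ### Isomorphism, reflexivity and transport sorts -/

/-- If the variable `0` is the argument at `f`, then its sort determines the arguments at the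
composites of `f`. -/
theorem args_andThen_eq {I R : L.Obj} {q : Arr I → ℕ} {w : Arr R → ℕ} {r : NHom R I}
    (hw : SortWF (⟨I, q⟩ :: Γ) (⟨R, w⟩ : SortExpr L.toSignature))
    (hr : w (NHom.toArr (L := L.toSignature) r) = 0) (p : Arr I) :
    w (NHom.andThen (L := L.toSignature) r p) = q p + 1 := by
  have h := hw (NHom.toArr (L := L.toSignature) r)
  simp only [hr] at h
  rcases h.cases_cons with ⟨-, h⟩ | ⟨y, _, h, -⟩
  · have h' : (⟨I, fun p => w (NHom.andThen (L := L.toSignature) r p)⟩ : SortExpr L.toSignature) =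
      ⟨I, fun p => q p + 1⟩ := h
    simp only [SortExpr.mk.injEq, heq_eq_eq, true_and] at h'
    exact congrFun h' p
  · simp at h

theorem interpSortExpr_refl {A I R : L.Obj} {s t : NHom I A} {r : NHom R I} {q : Arr I → ℕ}
    {w : Arr R → ℕ} (hR : L.kind R = .refl A I s t r)
    (hw : SortWF (⟨I, q⟩ :: Γ) (⟨R, w⟩ : SortExpr L.toSignature))
    (hr : w (NHom.toArr (L := L.toSignature) r) = 0) (N : L.Obj → Expr) (v : ℕ → Expr) :
    L.interpSortExpr N v ⟨R, w⟩ = Id (L.interpSortExpr N (comp shift v) ⟨I, q⟩) (v 0)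
      (.refl (v (q (NHom.toArr (L := L.toSignature) s) + 1))) := by
  rw [interpSortExpr, interpSort_refl hR]
  simp only [args_andThen_eq hw hr, hr]
  rfl

namespace IsWorldClass

/-- Reflexivity paths satisfy the predicate `ρ`. -/
theorem refl_inh (hW : L.IsWorldClass cl W)
    {A I R : L.Obj} {s t : NHom I A} {r : NHom R I} {q : Arr I → ℕ} {w : Arr R → ℕ}
    (hR : L.kind R = .refl A I s t r)
    (hq : SortWF Γ (⟨I, q⟩ : SortExpr L.toSignature))
    (hqst : q (NHom.toArr (L := L.toSignature) s) = q (NHom.toArr (L := L.toSignature) t))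
    (hw : SortWF (⟨I, q⟩ :: Γ) (⟨R, w⟩ : SortExpr L.toSignature))
    (hr : w (NHom.toArr (L := L.toSignature) r) = 0) (hEN : W E N)
    (hv : L.ValWF cl E N v Γ) :
    Der cl E (tm (.refl (v (q (NHom.toArr (L := L.toSignature) s))))
      (L.interpSortExpr N v ⟨I, q⟩)) ∧
    Inh cl E (L.interpForm N (scons (.refl (v (q (NHom.toArr (L := L.toSignature) s)))) v)
      (.ofSort ⟨R, w⟩)) := by
  have hx := Der.refl (hv.argsWF hq (NHom.toArr (L := L.toSignature) s))
  have hx' : Der cl E (tm (.refl (v (q (NHom.toArr (L := L.toSignature) s))))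
      (L.interpSortExpr N v ⟨I, q⟩)) := by
    rw [interpSortExpr, interpSort_iso (L.refl_spec hR).1]
    simp only [← hqst]
    exact hx
  have hv' := hv.scons hx'
  refine ⟨hx', hW.ex_intro hw (φ := .top) trivial hEN hv' 
    -- At the reflexivity path, `ρ` asks for a path from reflexivity to itself, hence the double
    -- `refl`.
    (t := .refl (.refl (v (q (NHom.toArr (L := L.toSignature) s))))) ?_
    ⟨_, .star (hW.ok hEN)⟩⟩
  rw [interpSortExpr_refl hR hw hr]
  exact Der.refl hx'

theorem rho (hW : L.IsWorldClass cl W)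
    {A I R : L.Obj} {s t : NHom I A} {r : NHom R I} {q : Arr I → ℕ} {w : Arr R → ℕ}
    (hR : L.kind R = .refl A I s t r)
    (hqst : q (NHom.toArr (L := L.toSignature) s) = q (NHom.toArr (L := L.toSignature) t))
    (hr : w (NHom.toArr (L := L.toSignature) r) = 0)
    (hq : SortWF Γ (⟨I, q⟩ : SortExpr L.toSignature))
    (hw : SortWF (⟨I, q⟩ :: Γ) (⟨R, w⟩ : SortExpr L.toSignature)) :
    L.Forces cl W Γ θ (.ex ⟨I, q⟩ (.ofSort ⟨R, w⟩)) := fun E N v hEN hv _ => by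
  obtain ⟨h₁, h₂⟩ := hW.refl_inh hR hq hqst hw hr hEN hv
  exact hW.ex_intro hq ⟨hw, trivial⟩ hEN hv h₁ h₂

/-- An element of `ρ(q)` is a path from `q` to reflexivity, so transport along `q` fixes the common
argument at `f₁` and `f₂`. That fixed-point path is the required element of the transport sort. -/
theorem tauRho (hW : L.IsWorldClass cl W)
    {A B I R T : L.Obj} {f : NHom B A} {s t : NHom I A} {r : NHom R I}
    {e : NHom T I} {f₁ f₂ : NHom T B} {q : Arr I → ℕ} {w : Arr R → ℕ} {u : Arr T → ℕ}
    (hR : L.kind R = .refl A I s t r) (hT : L.kind T = .transp B A I f s t e f₁ f₂)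
    (hqst : q (NHom.toArr (L := L.toSignature) s) = q (NHom.toArr (L := L.toSignature) t))
    (hr : w (NHom.toArr (L := L.toSignature) r) = 0)
    (he : u (NHom.toArr (L := L.toSignature) e) = 0)
    (hf : u (NHom.toArr (L := L.toSignature) f₁) = u (NHom.toArr (L := L.toSignature) f₂))
    (hw : SortWF (⟨I, q⟩ :: Γ) (⟨R, w⟩ : SortExpr L.toSignature))
    (hu : SortWF (⟨I, q⟩ :: Γ) (⟨T, u⟩ : SortExpr L.toSignature)) :
    L.Forces cl W (⟨I, q⟩ :: Γ) (.ofSort ⟨R, w⟩) (.ofSort ⟨T, u⟩) := by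
  -- The hypothesis `ρ(q)` abbreviates an existential; opening it puts the path to reflexivity in
  -- position 0 of the valuation.
  refine hW.exElim hw trivial ⟨hu, trivial⟩ fun E N v hEN hv _ => ?_
  rw [interpForm_wk]
  have hpath := hv.head
  rw [interpSortExpr_refl hR hw hr] at hpath
  replace hv := hv.tail
  generalize comp shift v = v' at hv hpath
  have ha : L.ArgsWF cl E N T fun g => v' (u g) := hv.argsWF hu
  have hE := hW.ok hEN
  have hN := (hW.interpWF hEN).mono (Set.subset_univ (L.below T))
  have hP := transpMotive_form hT (fun A _ => sortFormWF cl A) hE hN ha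
  -- The argument at `e` is the variable `q : x ≅ x`, whose sort forces both arguments at position
  -- `f` to be `x`.
  have hx₁ : v' (u (NHom.andThen (L := L.toSignature) f₁ ⟨A, f⟩)) =
      v' (q (NHom.toArr (L := L.toSignature) s) + 1) := by
    rw [← transp_andThen_s hT, args_andThen_eq hu he]
    rfl
  have hx₂ : v' (u (NHom.andThen (L := L.toSignature) f₂ ⟨A, f⟩)) =
      v' (q (NHom.toArr (L := L.toSignature) s) + 1) := by
    rw [← transp_andThen_t hT, args_andThen_eq hu he, hqst]
    rfl
  have hI : L.interpSortExpr N (comp shift v') ⟨I, q⟩ =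
      L.interpSort N I fun p => v' (u (NHom.andThen (L := L.toSignature) e p)) := by
    simp only [args_andThen_eq hu he]
    rfl
  have hpe := interpSort_transp_path hT N fun g => v' (u g)
  have hl := transpMotive_left N f f₁ fun g => v' (u g)
  have hrt := transpMotive_right hT N fun g => v' (u g)
  simp only [hx₁, hx₂] at hpe hl hrt
  rw [hI, hpe] at hpath
  have hq' := (congrArg (fun X => Der cl E (tm _ X)) hpe).mp
    (ha (NHom.toArr (L := L.toSignature) e))
  have hx := ha (NHom.andThen (L := L.toSignature) f₁ ⟨A, f⟩)
  have ht := (congrArg (fun X => Der cl E (tm _ X)) hl).mpr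
    (ha (NHom.toArr (L := L.toSignature) f₁))
  simp only [hx₁] at hx
  simp only [he] at hq'
  obtain ⟨d, hd⟩ := Inh.id_trans_of_refl hx hP ht hq' ⟨_, hpath⟩
  refine hW.ex_intro hu (φ := .top) trivial hEN hv (t := d) ?_ ⟨_, .star hE⟩
  rw [interpSortExpr, interpSort_transp hT]
  simp only [hx₁, hx₂, he]
  rw [hrt] at hd
  simp only [hf] at hd ⊢
  exact hd

/-- This is the base case of the path induction. The premise of (J) applies at the reflexivity path,
which satisfies its extra hypothesis `ρ` by `refl_inh`. -/
theorem J_refl (hW : L.IsWorldClass cl W)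
    {A I R : L.Obj} {s t : NHom I A} {r : NHom R I} {p : Arr I → ℕ} {w : Arr R → ℕ}
    (hR : L.kind R = .refl A I s t r)
    (hs : p (NHom.toArr (L := L.toSignature) s) = 1)
    (ht : p (NHom.toArr (L := L.toSignature) t) = 0)
    (hr : w (NHom.toArr (L := L.toSignature) r) = 0)
    (hwf : (Sequent.mk (⟨I, fun g => contract01 (p g)⟩ :: K :: Γ)
      (.and (.ofSort ⟨R, w⟩) (θ.rename (liftR contract01)))
      (φ.rename (liftR contract01))).WF)
    (h : L.Forces cl W (⟨I, fun g => contract01 (p g)⟩ :: K :: Γ)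
      (.and (.ofSort ⟨R, w⟩) (θ.rename (liftR contract01))) (φ.rename (liftR contract01)))
    (hEN : W E N) (hv : L.ValWF cl E N v (K :: Γ)) :
    Inh cl E (arrow (L.interpForm N (scons (.refl (v 0)) (scons (v 0) v)) θ)
      (L.interpForm N (scons (.refl (v 0)) (scons (v 0) v)) φ)) := by
  obtain ⟨⟨-, hq⟩, ⟨hρ, hθ'⟩, -⟩ := hwf
  obtain ⟨h₁, h₂⟩ := hW.refl_inh hR hq (by simp [hs, ht, contract01]) hρ.1 hr hEN hv
  simp only [hs, contract01] at h₁ h₂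
  -- Below the path variable, `contract01` identifies `x` and `y`, so the valuation `refl x, x, …`
  -- pulls back to `refl x, x, x, …`.
  have e : (fun i => scons (.refl (v 0)) v (liftR contract01 i)) =
      scons (.refl (v 0)) (scons (v 0) v) := by
    funext i
    rcases i with _ | _ | i <;> rfl
  have := hW.impIntro hρ hθ' h _ _ _ hEN (hv.scons h₁) h₂
  rwa [interpForm, interpForm_rename, interpForm_rename, e] at this

/-- Based path induction at `x`, in which `y` and `p : x ≅ y` vary. -/
theorem J (hW : L.IsWorldClass cl W)
    {A I R : L.Obj} {s t : NHom I A} {r : NHom R I} {p : Arr I → ℕ} {w : Arr R → ℕ}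
    (hR : L.kind R = .refl A I s t r)
    (hs : p (NHom.toArr (L := L.toSignature) s) = 1)
    (ht : p (NHom.toArr (L := L.toSignature) t) = 0)
    (hr : w (NHom.toArr (L := L.toSignature) r) = 0)
    (hσ : (Sequent.mk (⟨I, p⟩ :: K.rename Nat.succ :: K :: Γ) θ φ).WF)
    (hwf : (Sequent.mk (⟨I, fun g => contract01 (p g)⟩ :: K :: Γ)
      (.and (.ofSort ⟨R, w⟩) (θ.rename (liftR contract01)))
      (φ.rename (liftR contract01))).WF)
    (h : L.Forces cl W (⟨I, fun g => contract01 (p g)⟩ :: K :: Γ)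
      (.and (.ofSort ⟨R, w⟩) (θ.rename (liftR contract01))) (φ.rename (liftR contract01))) :
    L.Forces cl W (⟨I, p⟩ :: K.rename Nat.succ :: K :: Γ) θ φ := fun E N v hEN hv hθ => by
  obtain ⟨⟨⟨-, hK⟩, hp⟩, hθ', hφ'⟩ := hσ
  -- The sort `K` is not given as having head `A`. This follows because the variable 1, declared
  -- with sort `K`, is the argument of the isomorphism sort at `s`; the shift by 2 weakens `K` past
  -- `x` and `y`.
  obtain ⟨k, rfl, hk⟩ : ∃ k : Arr A → ℕ, K = ⟨A, k⟩ ∧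
      ∀ g, p (NHom.andThen (L := L.toSignature) s g) = k g + 2 := by
    obtain ⟨K₀, h₀, h₁⟩ := hp (NHom.toArr (L := L.toSignature) s)
    simp only [hs] at h₀ h₁
    obtain rfl : K = K₀ := by simpa using h₀
    obtain ⟨H, k⟩ := K
    have h₂ : (⟨A, fun g => p (NHom.andThen (L := L.toSignature) s g)⟩ :
      SortExpr L.toSignature) = ⟨H, fun g => k g + 2⟩ := h₁
    obtain rfl : A = H := congrArg SortExpr.head h₂
    simp only [SortExpr.mk.injEq, heq_eq_eq, true_and] at h₂
    exact ⟨k, rfl, congrFun h₂⟩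
  have hv₁ := hv.tail.tail
  set v₁ := comp shift (comp shift v)
  have hT := hW.sort hEN hv₁ hK
  have hEN₂ := hW.extend hEN hT
  have hv₂ := hv₁.lift hT
  have hI := hW.sort hEN₂ hv₂ hp
  have hEN₃ := hW.extend hEN₂ hI
  have hv₃ := hv₂.lift hI
  -- The hypothesis `θ` may depend on `y` and `p`, so it is made part of the motive.
  have hC := Der.arrowForm (hW.form hEN₃ hv₃ hθ') (hW.form hEN₃ hv₃ hφ')
  have hIso (N : L.Obj → Expr) (v : ℕ → Expr) : L.interpSortExpr N v ⟨I, p⟩ =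
      Id (L.interpSortExpr N (comp shift v) (SortExpr.rename Nat.succ ⟨A, k⟩)) (v 1) (v 0) := by
    rw [interpSortExpr, interpSort_iso (L.refl_spec hR).1]
    simp only [hk, hs, ht]
    rfl
  rw [hIso] at hC
  have ha : Der cl E (tm (v₁ 0) (L.interpSortExpr N v₁ (SortExpr.rename Nat.succ ⟨A, k⟩))) :=
    hv₁.head
  have hb : Der cl E (tm (v 1) (L.interpSortExpr N v₁ (SortExpr.rename Nat.succ ⟨A, k⟩))) :=
    hv.tail.head
  have hpath := hv.head
  rw [hIso] at hpath
  have key := Inh.path_ind ha (by simpa using hC) ?_ hb hpath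
  · have e : scons (v 0) (scons (v 1) v₁) = v := by
      funext i
      rcases i with _ | _ | i <;> rfl
    simp only [subst_arrow, subst_interpForm, comp_scons, Expr.subst, scons_zero, scons_one,
      subst_subst, comp_assoc, comp_shift_scons, Expr.subst_var, comp_var_right, e] at key
    exact key.arrow_elim (hW.form hEN hv hφ') (hW.form hEN hv hθ') hθ
  · simpa using hW.J_refl hR hs ht hr hwf h hEN hv₁

end IsWorldClass

end FOLIso.HSignature

/-! ### Soundness for forcing, and forcing versus satisfaction -/

namespace FOLIso

open HoTT HoTT.Expr HoTT.Jdg HSignature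

theorem Entails.forces {L : HSignature} {cl : Bool} {T : Theory L.toSignature}
    {W : List Expr → (L.Obj → Expr) → Prop} (hW : L.IsWorldClass cl W)
    (hT : ∀ σ ∈ T.axioms, L.Forces cl W σ.ctx σ.hyp σ.concl) {σ : Sequent L.toSignature}
    (h : Entails L cl T σ) : L.Forces cl W σ.ctx σ.hyp σ.concl := by
  induction h with
  | ax h => exact hT _ h
  | iden _ => exact fun _ _ _ _ _ h => h
  | sub _ hr _ ih => exact ih.rename hr
  | cut _ _ ih₁ ih₂ => exact fun _ _ _ hEN hv h => ih₂ _ _ _ hEN hv (ih₁ _ _ _ hEN hv h)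
  | conWk _ _ ih => exact ih.rename (.succ _)
  | @conExch Γ Γ' K K' _ _ _ _ _ ih => exact ih.rename ((ctxMor_swap01 K K').renameTele Γ')
  | top _ => exact hW.top
  | bot h => exact hW.bot h.2.2
  | exTop h => exact hW.exTop h.2.1.1 h.2.1.2
  | andIntro h₁ h₂ ih₁ ih₂ => exact hW.andIntro h₁.wf.2.2 h₂.wf.2.2 ih₁ ih₂
  | andLeft h ih =>
    exact fun _ _ _ hEN hv ht =>
      hW.andLeft h.wf.2.2.1 h.wf.2.2.2 _ _ _ hEN hv (ih _ _ _ hEN hv ht)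
  | andRight h ih =>
    exact fun _ _ _ hEN hv ht =>
      hW.andRight h.wf.2.2.1 h.wf.2.2.2 _ _ _ hEN hv (ih _ _ _ hEN hv ht)
  | orElim h₁ h₂ ih₁ ih₂ => exact hW.orElim h₁.wf.2.1 h₂.wf.2.1 h₁.wf.2.2 ih₁ ih₂
  | orLeft h ih =>
    exact fun _ _ _ hEN hv ht => ih _ _ _ hEN hv (hW.orLeft h.wf.2.1.2 _ _ _ hEN hv ht)
  | orRight h ih =>
    exact fun _ _ _ hEN hv ht => ih _ _ _ hEN hv (hW.orRight h.wf.2.1.1 _ _ _ hEN hv ht)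
  | impIntro h ih => exact hW.impIntro h.wf.2.1.1 h.wf.2.1.2 ih
  | impElim h ih => exact hW.impElim h.wf.2.1 h.wf.2.2.1 h.wf.2.2.2 ih
  | allIntro _ h ih => exact hW.allIntro h.wf.1.2 ih
  | allElim h ih => exact hW.allElim h.wf.2.2.1 h.wf.2.2.2 ih
  | exElim hθ h ih => exact hW.exElim h.wf.1.2 h.wf.2.1 hθ ih
  | exIntro h ih => exact hW.exIntro h.wf.2.1.1 h.wf.2.1.2 ih
  | frob h => exact hW.frob h.2.1.1 h.2.1.2.1 h.2.1.2.2
  | dist h => exact hW.dist h.2.1.1 h.2.1.2.1 h.2.1.2.2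
  | lem hcl h => exact hW.lem hcl h.2.2.1
  | rho _ hR hs ht hr h => exact hW.rho hR (hs.trans ht.symm) hr h.2.2.1 h.2.2.2.1
  | tauRho hR hE hs ht hr he h₁ h₂ h =>
    exact fun _ _ _ hEN hv hh =>
      hW.tauRho hR hE (hs.trans ht.symm) hr he (h₁.trans h₂.symm) h.2.1.1.1 h.2.2.1 _ _ _ hEN hv
        (hW.andLeft h.2.1.1 h.2.1.2 _ _ _ hEN hv hh)
  | J _ hR hs ht hr hσ h ih => exact hW.J hR hs ht hr hσ h.wf ih

namespace HSignature

variable {L : HSignature} {cl : Bool} {Γ₀ E : List Expr} {M B : Expr} {N : L.Obj → Expr}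
  {v s : ℕ → Expr} {Γ : Ctx L.toSignature} {σ : Sequent L.toSignature}

/-- The interpretations of the non-logical sorts that are induced by the structure `M`, in all
contexts over `Γ₀`. -/
def structureWorlds (L : HSignature) (cl : Bool) (Γ₀ : List Expr) (M : Expr) (E : List Expr)
    (N : L.Obj → Expr) : Prop :=
  ∃ s, SubstWF cl E s Γ₀ ∧ Der cl E ok ∧ N = fun A => (L.proj M A).subst s

theorem isWorldClass_structureWorlds (hM : L.IsStructure cl Γ₀ M) :
    L.IsWorldClass cl (L.structureWorlds cl Γ₀ M) where
  ok := fun ⟨_, _, h, _⟩ => h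
  interpWF := by
    rintro E N ⟨s, hs, hE, rfl⟩
    exact hM.interpWF.substWF hs hE
  extend := by
    rintro E N T ⟨s, hs, hE, rfl⟩ hT
    exact ⟨_, hs.comp_shift hT, .ctxCons hT, by simp⟩

/-- The context of type theory that interprets `Γ`. -/
noncomputable def interpCtx (L : HSignature) (Γ₀ : List Expr) (M : Expr) :
    Ctx L.toSignature → List Expr
  | [] => Γ₀
  | K :: Γ => L.interpSortExpr (fun A => (L.proj M A).wkN Γ.length) var K :: interpCtx L Γ₀ M Γ

/-- This provides the generic world and valuation: over the interpretation of `Γ`, the variables of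
type theory interpret those of `Γ`. -/
theorem interpCtx_wf (hM : L.IsStructure cl Γ₀ M) (hΓ : CtxWF Γ) :
    L.structureWorlds cl Γ₀ M (L.interpCtx Γ₀ M Γ) (fun A => (L.proj M A).wkN Γ.length) ∧
      L.ValWF cl (L.interpCtx Γ₀ M Γ) (fun A => (L.proj M A).wkN Γ.length) var Γ := by
  have hW := isWorldClass_structureWorlds hM
  induction Γ with
  | nil =>
    have hok := Der.ctx_ok hM
    refine ⟨⟨var, .id hok, hok, ?_⟩, fun x K h => absurd h.lt_length (by simp)⟩
    simp [wkN_zero]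
  | cons K Γ ih =>
    obtain ⟨h₁, h₂⟩ := ih hΓ.1
    have hK := hW.sort h₁ h₂ hΓ.2
    have h₃ := hW.extend h₁ hK
    have h₄ := h₂.lift hK
    simp only [← wkN_succ, comp_var_left, scons_var_shift] at h₃ h₄
    exact ⟨h₃, h₄⟩

theorem inh_piCtx (hB : Der cl (L.interpCtx Γ₀ M Γ) (ty B)) :
    Inh cl Γ₀ (L.piCtx M Γ B) ↔ Inh cl (L.interpCtx Γ₀ M Γ) B := by
  induction Γ generalizing B with
  | nil => rfl
  | cons K Γ ih => exact (ih (.piForm hB.ctx_ok.ty_of_ok_cons hB)).trans ⟨.unlam hB, .lam⟩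

/-- The substitution that extends `s` by the first `n` terms of `v`. -/
def extSubst (s : ℕ → Expr) : ℕ → (ℕ → Expr) → ℕ → Expr
  | 0, _ => s
  | n + 1, v => scons (v 0) (extSubst s n (comp shift v))

theorem wkN_subst_extSubst (e : Expr) (s : ℕ → Expr) (n : ℕ) (v : ℕ → Expr) :
    (e.wkN n).subst (extSubst s n v) = e.subst s := by
  induction n generalizing v with
  | zero => rw [wkN_zero]; rfl
  | succ n ih => rw [extSubst, wkN_add_one_scons, ih]

theorem extSubst_of_lt (s : ℕ → Expr) {n i : ℕ} (v : ℕ → Expr) (h : i < n) :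
    extSubst s n v i = v i := by
  induction n generalizing v i with
  | zero => omega
  | succ n ih =>
    cases i with
    | zero => rfl
    | succ i => exact ih (comp shift v) (by omega)

/-- Every world with a valuation of `Γ` is obtained from the generic one by substitution. -/
theorem substWF_extSubst (hΓ : CtxWF Γ) (hs : SubstWF cl E s Γ₀)
    (hv : L.ValWF cl E (fun A => (L.proj M A).subst s) v Γ) :
    SubstWF cl E (extSubst s Γ.length v) (L.interpCtx Γ₀ M Γ) := by
  induction Γ generalizing v with
  | nil => exact hs
  | cons K Γ ih =>
    refine SubstWF.scons (ih hΓ.1 hv.tail) ?_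
    have h := hv.head
    rw [subst_interpSortExpr]
    simp only [wkN_subst_extSubst, comp_var_left]
    convert h using 2
    exact congrArg _ (funext fun f => extSubst_of_lt s _ (hΓ.2 f).lt_length)

/-- After currying the iterated Π-type, satisfaction is an inhabitant of the implication in the
generic world. Substitution carries it to all worlds and valuations; conversely, forcing is applied
in the generic world extended by a proof of the hypothesis. -/
theorem satisfies_iff_forces (hM : L.IsStructure cl Γ₀ M) (hσ : σ.WF) :
    L.Satisfies cl Γ₀ M σ ↔
      L.Forces cl (L.structureWorlds cl Γ₀ M) σ.ctx σ.hyp σ.concl := by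
  have hW := isWorldClass_structureWorlds hM
  obtain ⟨h₁, h₂⟩ := interpCtx_wf hM hσ.1
  have hA := hW.form h₁ h₂ hσ.2.1
  have hB := hW.form h₁ h₂ hσ.2.2
  refine (inh_piCtx (.arrowForm hA hB)).trans ⟨fun h E N v hEN hv ht => ?_, fun h =>
    (hW.hyp hσ.2.1 h h₁ h₂).arrow_intro⟩
  obtain ⟨s, hs, hE, rfl⟩ := id hEN
  have h := h.substWF (substWF_extSubst hσ.1 hs hv) hE
  simp only [subst_arrow, subst_interpForm, wkN_subst_extSubst, comp_var_left] at h
  -- Substitution evaluates the formulas at `extSubst s _ v`, which agrees with `v` on the variables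
  -- of the context though not beyond.
  rw [interpForm_congr hσ.2.1 fun i hi => extSubst_of_lt s v hi,
    interpForm_congr hσ.2.2 fun i hi => extSubst_of_lt s v hi] at h
  exact h.arrow_elim (hW.form hEN hv hσ.2.2) (hW.form hEN hv hσ.2.1) ht

end HSignature

end FOLIso

theorem theorem4 (L : FOLIso.HSignature) (cl : Bool) (T : FOLIso.Theory L.toSignature)
    (σ : FOLIso.Sequent L.toSignature) (hσ : FOLIso.Entails L cl T σ) :
    L.SemConsequence cl T σ := fun _ _ hM hT =>
  (FOLIso.HSignature.satisfies_iff_forces hM hσ.wf).2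
    (hσ.forces (FOLIso.HSignature.isWorldClass_structureWorlds hM) fun σ' h =>
      (FOLIso.HSignature.satisfies_iff_forces hM (T.wf σ' h)).1 (hT σ' h))
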